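/- Let $k$ be an algebraically closed field of characteristic $p=0$ or $p>2$. Let $G$ be one of the classical groups $\mathrm{SL}(n,k)$, $\mathrm{GL}(n,k)$, $\mathrm{SO}(n,k)$, $\mathrm{Sp}(2n,k)$; here $\gamma(x)={}^tx^{-1}$, $J_n$ is the matrix with $1$ on the antidiagonal and $0$ elsewhere, and $\mathrm O(n,k)$, $\mathrm{Sp}(2n,k)$ are the groups preserving the forms $J_n$ and $\begin{pmatrix}0&J_n\\-J_n&0\end{pmatrix}$. Let $\theta$ be an automorphism of $G$ of order $m$, $p\nmid m$, where $\theta=\mathrm{Int}\,g$ or $\theta=\mathrm{Int}\,g\circ\gamma$ is as in the table below ($g\in \mathrm{GL}(n,k)$ if $G$ is $\mathrm{SL}(n,k)$ or $\mathrm{GL}(n,k)$, $g\in\mathrm O(n,k)$ if $G=\mathrm{SO}(n,k)$, $g\in G$ if $G=\mathrm{Sp}(2n,k)$). Fix a primitive $m$-th root of unity $\zeta\in k$, let $\mathfrak g=\mathrm{Lie}(G)$ and $\mathfrak g(1)=\{x\in\mathfrak g: d\theta(x)=\zeta x\}$, and let $\mathfrak c$ be a Cartan subspace of $\mathfrak g(1)$,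 i.e. a maximal element among the commutative subspaces of $\mathfrak g(1)$ consisting of semisimple elements. Let $r=\dim\mathfrak c$, except that $r=\dim\mathfrak c+1$ if $G=\mathrm{SL}(n,k)$ and either $\theta=\mathrm{Int}\,g$, $m=1$, or $\theta=\mathrm{Int}\,g\circ\gamma$, $m=2$. For a group $K$ let $Z_K(\mathfrak c)^\theta$ be the set of $\theta$-fixed elements of $K$ centralizing $\mathfrak c$. In the following table each row lists $G$, the conditions on $\theta$, a group $L$, and the form of $\theta|_L$. 1. $\mathrm{SL}(n)$ or $\mathrm{GL}(n)$; $\theta=\mathrm{Int}\,g$; $L=\mathrm{SL}(rm)^*$; $\theta|_L$ inner. 2. (I) $\mathrm{SO}(2n+1)$; $\theta=\mathrm{Int}\,g$, $m$ even, $g^m=I$; $L=\mathrm{SO}(rm+1)$; $\theta|_L=\mathrm{Int}\,h$, $h\in\mathrm O(rm+1)$. (I) $\mathrm{SO}(2n)$; $m$ even, $g^m=I$, $Z_{\mathrm O(2n)}(\mathfrak c)^\theta\ne Z_G(\mathfrak c)^\theta$; $L=\mathrm{SO}(rm+1)$; $\theta|_L=\mathrm{Int}\,h$, $h\in\mathrm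 O(rm+1)$. (I) $\mathrm{SO}(2n)$; $m$ even, $g^m=I$, $Z_{\mathrm O(2n)}(\mathfrak c)^\theta= Z_G(\mathfrak c)^\theta$; $L=\mathrm{SO}(rm)$; $\theta|_L=\mathrm{Int}\,h$, $h\in\mathrm O(rm)$. (II) $\mathrm{SO}(2n)$; $m$ even, $g^m=-I$; $L=\mathrm{SL}(rm)^*$ (dual type); $\theta|_L$ inner. (III) $\mathrm{SO}(2n+1)$, $m$ odd, or $\mathrm{SO}(2n)$, $m$ odd and $Z_{\mathrm O(2n)}(\mathfrak c)^\theta\ne Z_G(\mathfrak c)^\theta$; $L=\mathrm{SO}(2rm+1)$; $\theta|_L=\mathrm{Int}\,h$, $h\in\mathrm O(2rm+1)$. (III) $\mathrm{SO}(2n)$, $m$ odd and $Z_{\mathrm O(2n)}(\mathfrak c)^\theta= Z_G(\mathfrak c)^\theta$; $L=\mathrm{SO}(2rm)$; $\theta|_L=\mathrm{Int}\,h$, $h\in\mathrm O(2rm)$. 3. (I) $\mathrm{Sp}(2n)$; $\theta=\mathrm{Int}\,g$, $m$ even, $g^m=-I$; $L=\mathrm{Sp}(rm)$; $\theta|_L=\mathrm{Int}\,h$,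 $h\in L$. (II) $\mathrm{Sp}(2n)$; $m$ even, $g^m=I$; $L=\mathrm{SL}(rm)^*$ (dual type); $\theta|_L$ inner. (III) $\mathrm{Sp}(2n)$; $m$ odd; $L=\mathrm{Sp}(2rm)$; $\theta|_L=\mathrm{Int}\,h$, $h\in L$. 4. ($G=\mathrm{SL}(n)$ or $\mathrm{GL}(n)$; $\theta=\mathrm{Int}\,g\circ\gamma$, $m$ even) (I) $m/2$ odd, $(g\gamma(g))^{m/2}=I$; $L=\mathrm{SL}(rm/2)^*$; $\theta|_L=\mathrm{Int}\,h\circ\gamma$ with $h\in\mathrm{GL}(rm/2,k)$. (II) $m/2$ odd, $(g\gamma(g))^{m/2}=-I$; $L=(\mathrm{SL}(rm/2)\times\mathrm{SL}(rm/2))^*$ (dual type); $\theta|_L:(x,y)\mapsto(\sigma(y),x)$ with $\sigma=\mathrm{Int}\,h$, $h\in\mathrm{GL}(rm/2,k)$. (III) $m/2$ even, $(g\gamma(g))^{m/2}=I$, $Z_{\mathrm{GL}(n)}(\mathfrak c)^\theta\ne Z_{\mathrm{SL}(n)}(\mathfrak c)^\theta$; $L=\mathrm{SO}(rm+1)$;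 $\theta|_L=\mathrm{Int}\,h$, $h\in\mathrm O(rm+1)$. (III) $m/2$ even, $(g\gamma(g))^{m/2}=I$, $Z_{\mathrm{GL}(n)}(\mathfrak c)^\theta= Z_{\mathrm{SL}(n)}(\mathfrak c)^\theta$; $L=\mathrm{SO}(rm)$; $\theta|_L=\mathrm{Int}\,h$, $h\in\mathrm O(rm)$. (III) $m/2$ even, $(g\gamma(g))^{m/2}=-I$; $L=\mathrm{Sp}(rm)$; $\theta|_L=\mathrm{Int}\,h$, $h\in L$. Here an entry $L$ means that $L$ is embedded in $G\subset\mathrm{GL}(V)$ in the standard way: $V=U\oplus U'$, $L$ acts trivially on $U'$, and $U$ is the natural module of $L$; for the entries of dual type, $U$ is the sum of the natural module and its dual in the case of $\mathrm{SL}(a)$, and the sum of the natural module of the first factor and the dual of that of the second in the case of $\mathrm{SL}(a)\times\mathrm{SL}(a)$. In the starred entries, if $p\mid r$ (that is, $r=0$ in $k$), each $\mathrm{SL}(a)$ is replaced by $\mathrm{GL}(a)$, closedly embedded in $G$ so as to extend the given embedding of $\mathrm{SL}(a)$; if $G=\mathrm{GL}(n)$ this replacement is allowed for all $r$. Let $L\subset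 G$ be a $\theta$-stable subgroup as listed in the row of $(G,\theta)$, with $\theta|_L$ of the listed form and $\mathfrak c\subset\mathfrak l=\mathrm{Lie}(L)$ (for instance one such that, in addition, every element of the little Weyl group $N_{G(0)}(\mathfrak c)/Z_{G(0)}(\mathfrak c)$, $G(0)=(G^\theta)^\circ$, has a representative in $(L^\theta)^\circ$). Then $\theta|_L$ is N-regular: $\mathfrak l(1)=\{x\in\mathfrak l: d\theta(x)=\zeta x\}$ contains a regular nilpotent element of $\mathfrak l$, that is, a nilpotent element whose centralizer in $\mathfrak l$ has the minimal dimension among centralizers of elements of $\mathfrak l$. -/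

import Mathlib

open Matrix

/-! ## Linear algebraic groups as matrix groups -/

/-- The Lie algebra of a (closed) subgroup `L` of `GL_n(k)`: the Zariski tangent space of `L` at the
identity, that is, the matrices `X` killed by the differential at `1` of every polynomial in the
matrix entries that vanishes on `L`. -/
def lieAlg {k : Type*} [Field k] {N : ℕ} (L : Subgroup (GL (Fin N) k)) :
    Submodule k (Matrix (Fin N) (Fin N) k) where
  carrier := {X | ∀ f : MvPolynomial (Fin N × Fin N) k,
    (∀ x ∈ L, MvPolynomial.eval (fun p => (x : Matrix (Fin N) (Fin N) k) p.1 p.2) f = 0) →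
    ∑ p : Fin N × Fin N, X p.1 p.2 *
      MvPolynomial.eval (fun q => (1 : Matrix (Fin N) (Fin N) k) q.1 q.2)
        (MvPolynomial.pderiv p f) = 0}
  add_mem' := by
    intro X Y hX hY f hf
    have h1 := hX f hf
    have h2 := hY f hf
    simp only [Matrix.add_apply, add_mul, Finset.sum_add_distrib, h1, h2, add_zero]
  zero_mem' := by
    intro f _
    simp
  smul_mem' := by
    intro a X hX f hf
    have h1 := hX f hf
    simp only [Matrix.smul_apply, smul_eq_mul, mul_assoc, ← Finset.mul_sum, h1, mul_zero]

/-- The function `f` is the restriction to `S ⊆ GL_β(k)` (pulled back along `ρ`) of a regular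
function on `GL_β`, i.e. of a polynomial in the entries of a matrix and of its inverse. -/
def IsRegularOn {k : Type*} [Field k] {H : Type*} {β : Type*} [Fintype β] [DecidableEq β]
    (ρ : H → GL β k) (f : H → k) : Prop :=
  ∃ F : MvPolynomial ((β × β) ⊕ (β × β)) k, ∀ x : H,
    f x = MvPolynomial.eval
      (Sum.elim (fun p => (ρ x : Matrix β β k) p.1 p.2)
        (fun p => (((ρ x)⁻¹ : GL β k) : Matrix β β k) p.1 p.2)) F

/-- `γ : GL_n → GL_n`, the inverse transpose. -/
def contra {k : Type*} [Field k] {n : Type*} [Fintype n] [DecidableEq n] : GL n k →* GL n k where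
  toFun x := ⟨((x⁻¹ : GL n k) : Matrix n n k)ᵀ, (x : Matrix n n k)ᵀ,
    by rw [← Matrix.transpose_mul, Units.mul_inv, Matrix.transpose_one],
    by rw [← Matrix.transpose_mul, Units.inv_mul, Matrix.transpose_one]⟩
  map_one' := by
    ext1
    simp
  map_mul' x y := by
    ext1
    simp [Matrix.transpose_mul]

/-- The automorphism `Int g` of `GL_n` (`outer = false`) or `Int g ∘ γ` (`outer = true`). -/
def autHom {k : Type*} [Field k] {n : Type*} [Fintype n] [DecidableEq n] (outer : Bool)
    (g : GL n k) : GL n k →* GL n k :=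
  match outer with
  | false => (MulAut.conj g).toMonoidHom
  | true => (MulAut.conj g).toMonoidHom.comp contra

/-- The differential of `autHom outer g`: `Ad g`, respectively `X ↦ - Ad g (Xᵀ)`. -/
def autDiff {k : Type*} [Field k] {n : Type*} [Fintype n] [DecidableEq n] (outer : Bool)
    (g : GL n k) (X : Matrix n n k) : Matrix n n k :=
  match outer with
  | false => (g : Matrix n n k) * X * ((g⁻¹ : GL n k) : Matrix n n k)
  | true => -((g : Matrix n n k) * Xᵀ * ((g⁻¹ : GL n k) : Matrix n n k))

/-- The restriction of `θ` to the subgroup `G` has order exactly `m`. -/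
def HasOrderOn {X : Type*} [Group X] (G : Subgroup X) (θ : X →* X) (m : ℕ) : Prop :=
  0 < m ∧ ∀ j : ℕ, (∀ x ∈ G, (θ^[j]) x = x) ↔ m ∣ j

/-! ## The classical groups -/

/-- `SL_n(k)` as a subgroup of `GL_n(k)`. -/
def slGroup (k : Type*) [Field k] (N : ℕ) : Subgroup (GL (Fin N) k) :=
  (Matrix.GeneralLinearGroup.det (n := Fin N) (R := k)).ker

/-- The subgroup of `GL_N(k)` preserving the bilinear form with Gram matrix `B`. -/
def formGroup {k : Type*} [Field k] {N : ℕ} (B : Matrix (Fin N) (Fin N) k) :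
    Subgroup (GL (Fin N) k) where
  carrier := {x | (x : Matrix (Fin N) (Fin N) k)ᵀ * B * (x : Matrix (Fin N) (Fin N) k) = B}
  one_mem' := by simp
  mul_mem' := by
    intro x y hx hy
    simp only [Set.mem_ofPred_eq] at hx hy ⊢
    calc ((x * y : GL (Fin N) k) : Matrix (Fin N) (Fin N) k)ᵀ * B
          * ((x * y : GL (Fin N) k) : Matrix (Fin N) (Fin N) k)
        = (y : Matrix (Fin N) (Fin N) k)ᵀ * ((x : Matrix (Fin N) (Fin N) k)ᵀ * B
          * (x : Matrix (Fin N) (Fin N) k)) * (y : Matrix (Fin N) (Fin N) k) := by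
          simp [Matrix.transpose_mul, Matrix.mul_assoc]
      _ = B := by rw [hx, hy]
  inv_mem' := by
    intro x hx
    simp only [Set.mem_ofPred_eq] at hx ⊢
    have h1 : (x : Matrix (Fin N) (Fin N) k) * ((x⁻¹ : GL (Fin N) k) : Matrix (Fin N) (Fin N) k)
        = 1 := Units.mul_inv x
    have h2 : ((x⁻¹ : GL (Fin N) k) : Matrix (Fin N) (Fin N) k)ᵀ
        * (x : Matrix (Fin N) (Fin N) k)ᵀ = 1 := by
      rw [← Matrix.transpose_mul, h1, Matrix.transpose_one]
    calc ((x⁻¹ : GL (Fin N) k) : Matrix (Fin N) (Fin N) k)ᵀ * B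
          * ((x⁻¹ : GL (Fin N) k) : Matrix (Fin N) (Fin N) k)
        = ((x⁻¹ : GL (Fin N) k) : Matrix (Fin N) (Fin N) k)ᵀ
          * ((x : Matrix (Fin N) (Fin N) k)ᵀ * B * (x : Matrix (Fin N) (Fin N) k))
          * ((x⁻¹ : GL (Fin N) k) : Matrix (Fin N) (Fin N) k) := by rw [hx]
      _ = (((x⁻¹ : GL (Fin N) k) : Matrix (Fin N) (Fin N) k)ᵀ
          * (x : Matrix (Fin N) (Fin N) k)ᵀ) * B * ((x : Matrix (Fin N) (Fin N) k)
          * ((x⁻¹ : GL (Fin N) k) : Matrix (Fin N) (Fin N) k)) := by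
          simp only [Matrix.mul_assoc]
      _ = B := by rw [h1, h2, Matrix.one_mul, Matrix.mul_one]

/-- The matrix `J_N` with `1` on the antidiagonal and `0` elsewhere. -/
def antidiag (k : Type*) [Field k] (N : ℕ) : Matrix (Fin N) (Fin N) k :=
  fun i j => if j = Fin.rev i then 1 else 0

/-- For `N = 2n` the block matrix `(0, J_n; -J_n, 0)`. It is only used for even `N`. -/
def skewAntidiag (k : Type*) [Field k] (N : ℕ) : Matrix (Fin N) (Fin N) k :=
  fun i j => if j = Fin.rev i then (if i < j then 1 else -1) else 0

/-- `O(N, k)`, for the symmetric form `J_N`. -/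
def oGroup (k : Type*) [Field k] (N : ℕ) : Subgroup (GL (Fin N) k) := formGroup (antidiag k N)

/-- `SO(N, k)`. -/
def soGroup (k : Type*) [Field k] (N : ℕ) : Subgroup (GL (Fin N) k) := oGroup k N ⊓ slGroup k N

/-- `Sp(N, k)`, for `N` even. -/
def spGroup (k : Type*) [Field k] (N : ℕ) : Subgroup (GL (Fin N) k) :=
  formGroup (skewAntidiag k N)

/-- The two groups of type `A` under consideration: `SL_n` and `GL_n`. -/
inductive TypeA
  | SL
  | GL

/-- The group `SL_n(k)` or `GL_n(k)`. -/
def TypeA.group (k : Type*) [Field k] (n : ℕ) : TypeA → Subgroup (GL (Fin n) k)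
  | TypeA.SL => slGroup k n
  | TypeA.GL => ⊤

/-! ## Graded Lie algebras -/

/-- `c` is a Cartan subspace of `𝔤(1) = {X ∈ Lie(G) | dθ(X) = ζ X}`, `θ = autHom outer g`:
a maximal element among the commutative subspaces of `𝔤(1)` consisting of semisimple elements. -/
def IsCartanSubspace {k : Type*} [Field k] {N : ℕ} (G : Subgroup (GL (Fin N) k)) (outer : Bool)
    (g : GL (Fin N) k) (ζ : k) (c : Submodule k (Matrix (Fin N) (Fin N) k)) : Prop :=
  Maximal (fun d : Submodule k (Matrix (Fin N) (Fin N) k) =>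
    d ≤ lieAlg G ∧ (∀ X ∈ d, autDiff outer g X = ζ • X) ∧
    (∀ X ∈ d, Module.End.IsSemisimple (Matrix.toLin' X)) ∧ (∀ X ∈ d, ∀ Y ∈ d, X * Y = Y * X)) c

/-- The centralizer `𝔷_𝔩(x)` of a matrix `x` in a space `𝔩` of matrices. -/
def centralizerIn {k : Type*} [Field k] {N : ℕ} (l : Submodule k (Matrix (Fin N) (Fin N) k))
    (x : Matrix (Fin N) (Fin N) k) : Submodule k (Matrix (Fin N) (Fin N) k) :=
  l ⊓ LinearMap.ker
    (LinearMap.mulLeft k x - LinearMap.mulRight k x :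
      Matrix (Fin N) (Fin N) k →ₗ[k] Matrix (Fin N) (Fin N) k)

/-- `x` is a regular element of `𝔩`: its centralizer in `𝔩` has minimal dimension. -/
def IsRegularElement {k : Type*} [Field k] {N : ℕ} (l : Submodule k (Matrix (Fin N) (Fin N) k))
    (x : Matrix (Fin N) (Fin N) k) : Prop :=
  x ∈ l ∧ ∀ y ∈ l,
    Module.finrank k (centralizerIn l x) ≤ Module.finrank k (centralizerIn l y)

/-- `θ|_L` is N-regular, where `θ = autHom outer g`: the space
`𝔩(1) = {X ∈ Lie(L) | dθ(X) = ζ X}` contains a regular nilpotent element of `𝔩 = Lie(L)`. -/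
def IsNRegular {k : Type*} [Field k] {N : ℕ} (L : Subgroup (GL (Fin N) k)) (outer : Bool)
    (g : GL (Fin N) k) (ζ : k) : Prop :=
  ∃ e ∈ lieAlg L, autDiff outer g e = ζ • e ∧ IsNilpotent e ∧ IsRegularElement (lieAlg L) e

/-- `Z_K(c)^θ`: the `θ`-fixed elements of `K` that centralize `c`. -/
def fixedCentralizer {k : Type*} [Field k] {N : ℕ} (K : Subgroup (GL (Fin N) k))
    (θ : GL (Fin N) k →* GL (Fin N) k) (c : Submodule k (Matrix (Fin N) (Fin N) k)) :
    Set (GL (Fin N) k) :=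
  {x | x ∈ K ∧ θ x = x ∧ ∀ X ∈ c, (x : Matrix (Fin N) (Fin N) k) * X
    = X * (x : Matrix (Fin N) (Fin N) k)}

/-! ## The subgroups `L` -/

/-- `(x, y) ↦ diag(x, γ(y))`, an embedding of `GL_a × GL_a` in `GL_{2a}`. -/
def pairHom (k : Type*) [Field k] (a : ℕ) :
    GL (Fin a) k × GL (Fin a) k →* GL (Fin a ⊕ Fin a) k where
  toFun p := ⟨Matrix.fromBlocks (p.1 : Matrix (Fin a) (Fin a) k) 0 0
      (contra p.2 : Matrix (Fin a) (Fin a) k),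
    Matrix.fromBlocks ((p.1⁻¹ : GL (Fin a) k) : Matrix (Fin a) (Fin a) k) 0 0
      (((contra p.2)⁻¹ : GL (Fin a) k) : Matrix (Fin a) (Fin a) k),
    by rw [Matrix.fromBlocks_multiply, Units.mul_inv, Units.mul_inv]; simp,
    by rw [Matrix.fromBlocks_multiply, Units.inv_mul, Units.inv_mul]; simp⟩
  map_one' := by
    ext1
    simp
  map_mul' p q := by
    ext1
    simp [Matrix.fromBlocks_multiply]

/-- `x ↦ diag(x, γ(x))`, the action of `GL_a` on the sum of its natural module and the dual. -/
def dualHom (k : Type*) [Field k] (a : ℕ) : GL (Fin a) k →* GL (Fin a ⊕ Fin a) k :=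
  (pairHom k a).comp ((MonoidHom.id _).prod (MonoidHom.id _))

/-- `L` is the image of a closed embedding `Φ` (an injective homomorphism, regular with regular
inverse) of the linear algebraic group `M ≤ H` in `GL_N`, under which `θ|_L` becomes `σ`.
Here `ρ` is the representation of `H` on `k^β` giving the variety structure. The embedding is
the standard one on the subgroup `M₀ ≤ M`: there is a decomposition `k^N = U ⊕ U'`, with
`U = im P ≅ k^β` and `U' = ker Q`, such that `M₀` acts on `U` by `ρ` and trivially on `U'`. -/
def IsRealized {k : Type*} [Field k] {H : Type*} [Group H] {β : Type*} [Fintype β] [DecidableEq β]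
    {N : ℕ} (ρ : H →* GL β k) (M M₀ : Subgroup H) (σ : H → H)
    (θ : GL (Fin N) k →* GL (Fin N) k) (L : Subgroup (GL (Fin N) k)) : Prop :=
  ∃ Φ : M →* GL (Fin N) k,
    (∀ i j, IsRegularOn (fun x : M => ρ x) (fun x => (Φ x : Matrix (Fin N) (Fin N) k) i j)) ∧
    (∀ i j, IsRegularOn (fun x : M => Φ x) (fun x => (ρ x : Matrix β β k) i j)) ∧
    Φ.range = L ∧
    (∃ (P : Matrix (Fin N) β k) (Q : Matrix β (Fin N) k), Q * P = 1 ∧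
      ∀ x : M, (x : H) ∈ M₀ →
        (Φ x : Matrix (Fin N) (Fin N) k) = 1 + P * ((ρ x : Matrix β β k) - 1) * Q) ∧
    (∀ x y : M, (y : H) = σ x → θ (Φ x) = Φ y)

/-- The possible forms of the pair `(L, θ|_L)`. In the first four cases the flag `full` says that
the special linear groups are replaced by the general linear groups. -/
inductive LForm
  /-- `L = SL_a` acting on `U = k^a`, with `θ|_L` inner. -/
  | sl (full : Bool) (a : ℕ)
  /-- `L = SL_a` acting on `U = k^a ⊕ (k^a)^*`, with `θ|_L` inner. -/
  | slDual (full : Bool) (a : ℕ)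
  /-- `L = SL_a` acting on `U = k^a`, with `θ|_L` of the form `Int h ∘ γ`. -/
  | slOuter (full : Bool) (a : ℕ)
  /-- `L = SL_a × SL_a` acting on `U = k^a ⊕ (k^a)^*`, with `θ(x, y) = (h y h⁻¹, x)` on `L`. -/
  | slPair (full : Bool) (a : ℕ)
  /-- `L = SO_a` acting on `U = k^a`, with `θ|_L = Int h`, `h ∈ O_a`. -/
  | so (a : ℕ)
  /-- `L = Sp_a` acting on `U = k^a`, with `θ|_L = Int h`, `h ∈ Sp_a`. -/
  | sp (a : ℕ)

/-- `SL_a` or, if `full`, `GL_a`. -/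
def slOrGl (k : Type*) [Field k] (full : Bool) (a : ℕ) : Subgroup (GL (Fin a) k) :=
  if full then ⊤ else slGroup k a

/-- The subgroup `L` of `GL_N` together with the restriction of `θ` is of the given form. -/
def HasForm {k : Type*} [Field k] {N : ℕ} (θ : GL (Fin N) k →* GL (Fin N) k)
    (L : Subgroup (GL (Fin N) k)) : LForm → Prop
  | LForm.sl full a => ∃ h : GL (Fin a) k,
      IsRealized (MonoidHom.id _) (slOrGl k full a) (slGroup k a) (fun x => autHom false h x) θ L
  | LForm.slDual full a => ∃ h : GL (Fin a) k,
      IsRealized (dualHom k a) (slOrGl k full a) (slGroup k a) (fun x => autHom false h x) θ L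
  | LForm.slOuter full a => ∃ h : GL (Fin a) k,
      IsRealized (MonoidHom.id _) (slOrGl k full a) (slGroup k a) (fun x => autHom true h x) θ L
  | LForm.slPair full a => ∃ h : GL (Fin a) k,
      IsRealized (pairHom k a) ((slOrGl k full a).prod (slOrGl k full a))
        ((slGroup k a).prod (slGroup k a)) (fun p => (autHom false h p.2, p.1)) θ L
  | LForm.so a => ∃ h ∈ oGroup k a,
      IsRealized (MonoidHom.id _) (soGroup k a) (soGroup k a) (fun x => autHom false h x) θ L
  | LForm.sp a => ∃ h ∈ spGroup k a,
      IsRealized (MonoidHom.id _) (spGroup k a) (spGroup k a) (fun x => autHom false h x) θ L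

/-! ## The list of cases -/

/-- The number `r` of cycles of length `l`. It is `dim c`, except that for `SL_n` and `l = 1` the
trace condition makes `dim c` smaller by one. -/
noncomputable def TypeA.cycles {k : Type*} [Field k] {N : ℕ} (s : TypeA) (l : ℕ)
    (c : Submodule k (Matrix (Fin N) (Fin N) k)) : ℕ :=
  match s with
  | TypeA.SL => if l = 1 then Module.finrank k c + 1 else Module.finrank k c
  | TypeA.GL => Module.finrank k c

/-- In `SL_n` the special linear groups are replaced by the general linear ones exactly
if `char k ∣ r`; in `GL_n` one may always use the latter, and must do so if `char k ∣ r`. -/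
def TypeA.FullRule (k : Type*) [Field k] (s : TypeA) (full : Bool) (r : ℕ) : Prop :=
  match s with
  | TypeA.SL => full = true ↔ (r : k) = 0
  | TypeA.GL => full = false → (r : k) ≠ 0

/-- The list of cases: `G` is a classical group, `θ = autHom outer g` an automorphism of order `m`,
`c` a Cartan subspace, `r` the number of cycles, and the last argument is the form of `(L, θ|_L)`.
For automorphisms `Int g ∘ γ` in type `A` we write `m = 2 l`. -/
inductive ClassicalCase {k : Type*} [Field k] (m r : ℕ) :
    {N : ℕ} → Subgroup (GL (Fin N) k) → Bool → GL (Fin N) k →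
    Submodule k (Matrix (Fin N) (Fin N) k) → LForm → Prop
  | first {n : ℕ} (s : TypeA) (g : GL (Fin n) k) (c : Submodule k (Matrix (Fin n) (Fin n) k))
      (full : Bool) (hr : s.cycles m c = r) (hfull : s.FullRule k full r) :
      ClassicalCase m r (s.group k n) false g c (LForm.sl full (r * m))
  | secondI_odd {n : ℕ} (g : GL (Fin (2 * n + 1)) k)
      (c : Submodule k (Matrix (Fin (2 * n + 1)) (Fin (2 * n + 1)) k))
      (hg : g ∈ oGroup k (2 * n + 1)) (hr : Module.finrank k c = r) (hm : Even m)
      (hgm : g ^ m = 1) :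
      ClassicalCase m r (soGroup k (2 * n + 1)) false g c (LForm.so (r * m + 1))
  | secondI_even {n : ℕ} (g : GL (Fin (2 * n)) k)
      (c : Submodule k (Matrix (Fin (2 * n)) (Fin (2 * n)) k))
      (hg : g ∈ oGroup k (2 * n)) (hr : Module.finrank k c = r) (hm : Even m) (hgm : g ^ m = 1)
      (hZ : fixedCentralizer (oGroup k (2 * n)) (autHom false g) c
        ≠ fixedCentralizer (soGroup k (2 * n)) (autHom false g) c) :
      ClassicalCase m r (soGroup k (2 * n)) false g c (LForm.so (r * m + 1))
  | secondI_even' {n : ℕ} (g : GL (Fin (2 * n)) k)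
      (c : Submodule k (Matrix (Fin (2 * n)) (Fin (2 * n)) k))
      (hg : g ∈ oGroup k (2 * n)) (hr : Module.finrank k c = r) (hm : Even m) (hgm : g ^ m = 1)
      (hZ : fixedCentralizer (oGroup k (2 * n)) (autHom false g) c
        = fixedCentralizer (soGroup k (2 * n)) (autHom false g) c) :
      ClassicalCase m r (soGroup k (2 * n)) false g c (LForm.so (r * m))
  | secondII {n : ℕ} (g : GL (Fin (2 * n)) k)
      (c : Submodule k (Matrix (Fin (2 * n)) (Fin (2 * n)) k)) (full : Bool)
      (hg : g ∈ oGroup k (2 * n)) (hr : Module.finrank k c = r) (hm : Even m) (hgm : g ^ m = -1)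
      (hfull : full = true ↔ (r : k) = 0) :
      ClassicalCase m r (soGroup k (2 * n)) false g c (LForm.slDual full (r * m))
  | secondIII_odd {n : ℕ} (g : GL (Fin (2 * n + 1)) k)
      (c : Submodule k (Matrix (Fin (2 * n + 1)) (Fin (2 * n + 1)) k))
      (hg : g ∈ oGroup k (2 * n + 1)) (hr : Module.finrank k c = r) (hm : Odd m) :
      ClassicalCase m r (soGroup k (2 * n + 1)) false g c (LForm.so (2 * r * m + 1))
  | secondIII_even {n : ℕ} (g : GL (Fin (2 * n)) k)
      (c : Submodule k (Matrix (Fin (2 * n)) (Fin (2 * n)) k))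
      (hg : g ∈ oGroup k (2 * n)) (hr : Module.finrank k c = r) (hm : Odd m)
      (hZ : fixedCentralizer (oGroup k (2 * n)) (autHom false g) c
        ≠ fixedCentralizer (soGroup k (2 * n)) (autHom false g) c) :
      ClassicalCase m r (soGroup k (2 * n)) false g c (LForm.so (2 * r * m + 1))
  | secondIII_even' {n : ℕ} (g : GL (Fin (2 * n)) k)
      (c : Submodule k (Matrix (Fin (2 * n)) (Fin (2 * n)) k))
      (hg : g ∈ oGroup k (2 * n)) (hr : Module.finrank k c = r) (hm : Odd m)
      (hZ : fixedCentralizer (oGroup k (2 * n)) (autHom false g) c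
        = fixedCentralizer (soGroup k (2 * n)) (autHom false g) c) :
      ClassicalCase m r (soGroup k (2 * n)) false g c (LForm.so (2 * r * m))
  | thirdI {n : ℕ} (g : GL (Fin (2 * n)) k)
      (c : Submodule k (Matrix (Fin (2 * n)) (Fin (2 * n)) k))
      (hg : g ∈ spGroup k (2 * n)) (hr : Module.finrank k c = r) (hm : Even m)
      (hgm : g ^ m = -1) :
      ClassicalCase m r (spGroup k (2 * n)) false g c (LForm.sp (r * m))
  | thirdII {n : ℕ} (g : GL (Fin (2 * n)) k)
      (c : Submodule k (Matrix (Fin (2 * n)) (Fin (2 * n)) k)) (full : Bool)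
      (hg : g ∈ spGroup k (2 * n)) (hr : Module.finrank k c = r) (hm : Even m) (hgm : g ^ m = 1)
      (hfull : full = true ↔ (r : k) = 0) :
      ClassicalCase m r (spGroup k (2 * n)) false g c (LForm.slDual full (r * m))
  | thirdIII {n : ℕ} (g : GL (Fin (2 * n)) k)
      (c : Submodule k (Matrix (Fin (2 * n)) (Fin (2 * n)) k))
      (hg : g ∈ spGroup k (2 * n)) (hr : Module.finrank k c = r) (hm : Odd m) :
      ClassicalCase m r (spGroup k (2 * n)) false g c (LForm.sp (2 * r * m))
  | fourthI {n : ℕ} (s : TypeA) (l : ℕ) (g : GL (Fin n) k)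
      (c : Submodule k (Matrix (Fin n) (Fin n) k)) (full : Bool) (hr : s.cycles l c = r)
      (hml : m = 2 * l) (hl : Odd l) (hgm : (g * contra g) ^ l = 1)
      (hfull : s.FullRule k full r) :
      ClassicalCase m r (s.group k n) true g c (LForm.slOuter full (r * l))
  | fourthII {n : ℕ} (s : TypeA) (l : ℕ) (g : GL (Fin n) k)
      (c : Submodule k (Matrix (Fin n) (Fin n) k)) (full : Bool) (hr : s.cycles l c = r)
      (hml : m = 2 * l) (hl : Odd l) (hgm : (g * contra g) ^ l = -1)
      (hfull : s.FullRule k full r) :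
      ClassicalCase m r (s.group k n) true g c (LForm.slPair full (r * l))
  | fourthIII {n : ℕ} (s : TypeA) (l : ℕ) (g : GL (Fin n) k)
      (c : Submodule k (Matrix (Fin n) (Fin n) k)) (hr : Module.finrank k c = r)
      (hml : m = 2 * l) (hl : Even l) (hgm : (g * contra g) ^ l = 1)
      (hZ : fixedCentralizer ⊤ (autHom true g) c
        ≠ fixedCentralizer (slGroup k n) (autHom true g) c) :
      ClassicalCase m r (s.group k n) true g c (LForm.so (r * m + 1))
  | fourthIII' {n : ℕ} (s : TypeA) (l : ℕ) (g : GL (Fin n) k)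
      (c : Submodule k (Matrix (Fin n) (Fin n) k)) (hr : Module.finrank k c = r)
      (hml : m = 2 * l) (hl : Even l) (hgm : (g * contra g) ^ l = 1)
      (hZ : fixedCentralizer ⊤ (autHom true g) c
        = fixedCentralizer (slGroup k n) (autHom true g) c) :
      ClassicalCase m r (s.group k n) true g c (LForm.so (r * m))
  | fourthIII'' {n : ℕ} (s : TypeA) (l : ℕ) (g : GL (Fin n) k)
      (c : Submodule k (Matrix (Fin n) (Fin n) k)) (hr : Module.finrank k c = r)
      (hml : m = 2 * l) (hl : Even l) (hgm : (g * contra g) ^ l = -1) :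
      ClassicalCase m r (s.group k n) true g c (LForm.sp (r * m))

/-! Transport to a model. A subgroup `L` of the table is the image of a closed embedding `Φ` of a
model group (special or general linear, a product of two of these, orthogonal or symplectic), and
`Φ` turns θ into an explicit `σ`. The differential of `Φ` is a linear isomorphism of the model Lie
algebra onto `lieAlg L` that respects commutation and intertwines dσ with dθ
(`IsRealized.exists_isLieModel`). It therefore preserves dimensions of centralizers, and a regular
nilpotent `E` with dσ(E) = ζE may be sought in the model. Its image is nilpotent because on the
semisimple part the embedding is X ↦ P X Q on a summand.

The Cartan subspace determines σ up to conjugacy. Let σ = Int h. As θ^m = 1 on `L`, the matrix h^m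
commutes with the model group and is a scalar λ. The pull-back of `c` is a commuting space of
matrices X with hX = ζXh, semisimple where this is needed; if it has dimension r it has r linearly
independent weights χ_i (`exists_independent_weights`). Since h multiplies weights by ζ⁻¹, the
weights ζ^(-s) χ_i with s < m are distinct, so r weight vectors have rm independent translates under
powers of h. On their span h consists of r twisted m-cycles, and all m-th roots of λ occur equally
often. In dimension rm, h is thus conjugate to diag(α ζ^i), 0 ≤ i < rm, for any α with α^m = λ, and
conjugation by this matrix multiplies the subdiagonal Jordan block by ζ. If m is odd and a form is
preserved, weights come in pairs ±χ while -1 is not a power of ζ, so the number of cycles doubles.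

Forms. `modelForm` makes the Jordan block skew, and diag(α ζ^i) is an isometry of it as soon as α²
ζ^(b-1) = 1 (with one more condition on an extra basis vector). Isometries that are conjugate by a
matrix are conjugate by an isometry (`exists_isometry_conj`, by a square root), so the model can be
moved to the given form. The condition on α restricts λ: for m odd the sign of α can be adjusted;
for m even λ is read off from g^m or (gγ(g))^(m/2) by Schur's lemma
(`HasScalarPower.pow_eq_smul_one`); for SO(rm+1) it suffices that det h = ±1. In SO(rm) with rm even
the regular nilpotent has blocks rm - 1 and 1.

Outer automorphisms in type A. For σ = Int h ∘ γ the square of σ is Int u with u = hγ(h), and the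
cycle argument applies to u, ζ² and l = m/2. Viewed as a bilinear form, h is determined up to
congruence by its asymmetry u (`exists_congruence`), so h is congruent to `outerForm`, for which the
Jordan block is an eigenvector. For a pair of factors the square of σ is Int h on each factor, and
(ζE, E) is the required element.

Regularity. Along the line from an arbitrary y to a suitable semisimple element, generic
centralizers contain many independent powers and are no larger than that of y
(`le_finrank_centralizer`). This bounds all centralizers below by a in gl_a and by a/2 (rounded
down) in the orthogonal and symplectic cases, and the model nilpotents attain the bounds. In sl_a
the argument needs a ≠ 0 in k, which is why the general linear group enters when p divides r. -/

/-! ## Differential calculus along maps to `GL_β` -/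

section Calculus

universe u
variable {k : Type u} [Field k] {β γ : Type*} [Fintype β] [DecidableEq β] [Fintype γ]
  [DecidableEq γ] {T S : Type*}

/-- Evaluation of a polynomial in the entries of two matrices. -/
noncomputable def pairEval {R : Type*} [CommRing R] [Algebra k R] (x y : Matrix β β R) :
    MvPolynomial ((β × β) ⊕ (β × β)) k →ₐ[k] R :=
  MvPolynomial.aeval (Sum.elim (fun p => x p.1 p.2) (fun p => y p.1 p.2))

/-- Evaluation of a polynomial in the entries of a matrix. -/
noncomputable def matEval {R : Type*} [CommRing R] [Algebra k R] (x : Matrix β β R) :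
    MvPolynomial (β × β) k →ₐ[k] R :=
  MvPolynomial.aeval (fun p => x p.1 p.2)

lemma map_matEval {R R' : Type*} [CommRing R] [Algebra k R] [CommRing R'] [Algebra k R']
    (φ : R →ₐ[k] R') (x : Matrix β β R) (f : MvPolynomial (β × β) k) :
    φ (matEval x f) = matEval (x.map φ) f := by
  have : φ.comp (matEval x : MvPolynomial (β × β) k →ₐ[k] R) = matEval (x.map φ) := by
    ext p
    simp [matEval]
  rw [← this, AlgHom.comp_apply]

/-- The matrix `Z + ε W` over the dual numbers. -/
def dualMat {γ δ : Type*} (Z W : Matrix γ δ k) : Matrix γ δ (DualNumber k) :=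
  fun i j => TrivSqZeroExt.inl (Z i j) + TrivSqZeroExt.inr (W i j)

/-- The point `1 + ε X`. -/
def dualPt (X : Matrix β β k) : Matrix β β (DualNumber k) := dualMat 1 X

lemma dualMat_mul {α γ δ : Type*} [Fintype γ] (Z W : Matrix α γ k) (Z' W' : Matrix γ δ k) :
    dualMat Z W * dualMat Z' W' = dualMat (Z * Z') (Z * W' + W * Z') := by
  ext i j
  · simp [dualMat, Matrix.mul_apply, TrivSqZeroExt.fst_sum]
  · simp [dualMat, Matrix.mul_apply, TrivSqZeroExt.snd_sum, Finset.sum_add_distrib, mul_comm]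

lemma dualMat_one_zero : dualMat (1 : Matrix β β k) 0 = 1 := by
  ext i j <;> by_cases h : i = j <;> simp [dualMat, Matrix.one_apply, h]

lemma dualPt_mul_neg (X : Matrix β β k) : dualPt X * dualPt (-X) = 1 := by
  rw [dualPt, dualPt, dualMat_mul, ← dualMat_one_zero]
  simp

lemma det_dualPt (X : Matrix β β k) :
    (dualPt X).det = TrivSqZeroExt.inl 1 + TrivSqZeroExt.inr X.trace := by
  have h : dualPt X = 1 + (TrivSqZeroExt.inr 1 : DualNumber k) •
      X.map (TrivSqZeroExt.inl : k → DualNumber k) := by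
    ext i j <;> by_cases h : i = j <;>
      simp [dualPt, dualMat, Matrix.one_apply, h, -DualNumber.inr_eq_smul_eps]
  rw [h, Matrix.det_one_add_smul]
  have h2 : (TrivSqZeroExt.inr 1 : DualNumber k) ^ 2 = 0 := by
    rw [pow_two, TrivSqZeroExt.inr_mul_inr]
  rw [h2, mul_zero, add_zero]
  ext
  · simp [Matrix.trace, TrivSqZeroExt.fst_sum, -DualNumber.inr_eq_smul_eps]
  · simp [Matrix.trace, TrivSqZeroExt.fst_sum, -DualNumber.inr_eq_smul_eps]

/-- First-order Taylor expansion. It converts the partial derivatives in `lieAlg` into evaluation at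
a point over the dual numbers, after which only algebra homomorphisms are needed. -/
lemma aeval_dual {ι : Type*} [Fintype ι] (a b : ι → k) (f : MvPolynomial ι k) :
    MvPolynomial.aeval (fun i => (TrivSqZeroExt.inl (a i) + TrivSqZeroExt.inr (b i) :
      DualNumber k)) f
      = TrivSqZeroExt.inl (MvPolynomial.eval a f) +
        TrivSqZeroExt.inr (∑ i, b i * MvPolynomial.eval a (MvPolynomial.pderiv i f)) := by
  classical
  induction f using MvPolynomial.induction_on with
  | C c =>
    ext <;> simp [TrivSqZeroExt.algebraMap_eq_inl]
  | add p q hp hq =>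
    rw [map_add, hp, hq]
    ext <;> simp [mul_add, Finset.sum_add_distrib]
  | mul_X p i hp =>
    rw [map_mul, hp, MvPolynomial.aeval_X]
    have h : ∀ j, b j * MvPolynomial.eval a (MvPolynomial.pderiv j (p * MvPolynomial.X i))
        = a i * (b j * MvPolynomial.eval a (MvPolynomial.pderiv j p)) +
          (if j = i then b i * MvPolynomial.eval a p else 0) := by
      intro j
      rw [MvPolynomial.pderiv_mul, MvPolynomial.pderiv_X]
      by_cases hij : j = i
      · subst hij
        simp
        ring
      · simp [hij, Ne.symm hij]
        ring
    ext
    · simp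
    · simp only [h, Finset.sum_add_distrib, ← Finset.mul_sum]
      simp
      ring

/-- Denominators can be cleared in a regular function on `GL_β`. -/
lemma exists_clear_denominators (F : MvPolynomial ((β × β) ⊕ (β × β)) k) :
    ∃ (n : ℕ) (f : MvPolynomial (β × β) k), ∀ (R : Type u) [CommRing R] [Algebra k R]
      (x y : Matrix β β R), x * y = 1 → matEval x f = x.det ^ n * pairEval x y F := by
  have hgen : ∀ (R : Type u) [CommRing R] [Algebra k R] (x : Matrix β β R),
      (Matrix.mvPolynomialX β β k).map (matEval x) = x := by
    intro R _ _ x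
    ext i j
    simp [matEval, Matrix.mvPolynomialX]
  have hdet : ∀ (R : Type u) [CommRing R] [Algebra k R] (x : Matrix β β R),
      matEval x (Matrix.mvPolynomialX β β k).det = x.det := by
    intro R _ _ x
    rw [AlgHom.map_det, AlgHom.mapMatrix_apply, hgen]
  have hadj : ∀ (R : Type u) [CommRing R] [Algebra k R] (x : Matrix β β R) (i j : β),
      matEval x ((Matrix.mvPolynomialX β β k).adjugate i j) = x.adjugate i j := by
    intro R _ _ x i j
    have := AlgHom.map_adjugate (matEval x : MvPolynomial (β × β) k →ₐ[k] R)
      (Matrix.mvPolynomialX β β k)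
    rw [AlgHom.mapMatrix_apply, AlgHom.mapMatrix_apply, hgen] at this
    rw [← this]
    rfl
  induction F using MvPolynomial.induction_on with
  | C a =>
    refine ⟨0, MvPolynomial.C a, fun R _ _ x y _ => ?_⟩
    simp [matEval, pairEval]
  | add p q hp hq =>
    obtain ⟨n, f, hf⟩ := hp
    obtain ⟨n', f', hf'⟩ := hq
    refine ⟨n + n', (Matrix.mvPolynomialX β β k).det ^ n' * f +
      (Matrix.mvPolynomialX β β k).det ^ n * f', fun R _ _ x y h => ?_⟩
    rw [map_add, map_add, map_mul, map_mul, map_pow, map_pow, hdet, hf R x y h, hf' R x y h]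
    ring
  | mul_X p i hp =>
    obtain ⟨n, f, hf⟩ := hp
    rcases i with i | i
    · refine ⟨n, f * MvPolynomial.X i, fun R _ _ x y h => ?_⟩
      rw [map_mul, map_mul, hf R x y h]
      simp [matEval, pairEval, mul_assoc]
    -- A variable for an entry of the inverse costs one factor of the determinant, because the
    -- adjugate is `det x • y`.
    · refine ⟨n + 1, f * (Matrix.mvPolynomialX β β k).adjugate i.1 i.2, fun R _ _ x y h => ?_⟩
      have h1 : x.adjugate = x.det • y := by
        calc x.adjugate = x.adjugate * (x * y) := by rw [h, mul_one]
          _ = x.det • y := by rw [← mul_assoc, Matrix.adjugate_mul, Matrix.smul_mul, one_mul]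
      rw [map_mul, map_mul, hf R x y h, hadj, h1]
      simp only [pairEval, MvPolynomial.aeval_X, Sum.elim_inr, Matrix.smul_apply, smul_eq_mul]
      ring

/-- `X` is tangent at `1` to the closure of the image of `p`. -/
def IsTangent (p : T → GL β k) (X : Matrix β β k) : Prop :=
  ∀ f : MvPolynomial (β × β) k, (∀ t, matEval (p t : Matrix β β k) f = 0) →
    matEval (dualPt X) f = 0

/-- Tangency tests only polynomials in the entries of the matrix. Clearing denominators extends the
test to entries of the inverse, since the determinant of `1 + ε X` is a unit. -/
lemma IsTangent.pairEval_eq_zero {p : T → GL β k} {X : Matrix β β k} (hX : IsTangent p X)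
    (F : MvPolynomial ((β × β) ⊕ (β × β)) k)
    (hF : ∀ t, pairEval (p t : Matrix β β k) ((p t)⁻¹ : GL β k) F = 0) :
    pairEval (dualPt X) (dualPt (-X)) F = 0 := by
  obtain ⟨n, f, hf⟩ := exists_clear_denominators F
  have h1 := hX f (fun t => by rw [hf k _ _ (Units.mul_inv (p t)), hF, mul_zero])
  rw [hf _ _ _ (dualPt_mul_neg X)] at h1
  have h2 : IsUnit ((dualPt X).det ^ n) := by
    refine IsUnit.pow _ ?_
    refine IsUnit.of_mul_eq_one (dualPt (-X)).det ?_
    rw [← Matrix.det_mul, dualPt_mul_neg, Matrix.det_one]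
  exact (h2.mul_right_eq_zero).1 h1

/-- As `1 ∈ L`, a polynomial vanishing on `L` has no constant term at `1 + ε X`; what is left is the
derivative used in `lieAlg`. -/
lemma mem_lieAlg_iff {N : ℕ} (L : Subgroup (GL (Fin N) k)) (X : Matrix (Fin N) (Fin N) k) :
    X ∈ lieAlg L ↔ IsTangent (fun x : L => (x : GL (Fin N) k)) X := by
  have key : ∀ f : MvPolynomial (Fin N × Fin N) k, matEval (dualPt X) f
      = TrivSqZeroExt.inl (MvPolynomial.eval (fun q => (1 : Matrix (Fin N) (Fin N) k) q.1 q.2) f) +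
        TrivSqZeroExt.inr (∑ p : Fin N × Fin N, X p.1 p.2 *
      MvPolynomial.eval (fun q => (1 : Matrix (Fin N) (Fin N) k) q.1 q.2)
        (MvPolynomial.pderiv p f)) := fun f => aeval_dual _ _ f
  have hev : ∀ (x : Matrix (Fin N) (Fin N) k) (f : MvPolynomial (Fin N × Fin N) k),
      matEval x f = MvPolynomial.eval (fun p => x p.1 p.2) f := by
    intro x f
    have : (matEval x : MvPolynomial (Fin N × Fin N) k →ₐ[k] k).toRingHom
        = MvPolynomial.eval (fun p : Fin N × Fin N => x p.1 p.2) := by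
      apply MvPolynomial.ringHom_ext <;> intro r <;> simp [matEval]
    rw [← this]
    rfl
  constructor
  · intro h f hf
    rw [key, h f (fun x hx => by rw [← hev]; exact hf ⟨x, hx⟩)]
    have h1 : MvPolynomial.eval (fun q : Fin N × Fin N =>
        (1 : Matrix (Fin N) (Fin N) k) q.1 q.2) f = 0 := by
      rw [← hev]
      exact hf 1
    rw [h1, TrivSqZeroExt.inl_zero, TrivSqZeroExt.inr_zero, add_zero]
  · intro h f hf
    have := h f (fun t => by rw [hev]; exact hf t t.2)
    rw [key] at this
    simpa using congrArg TrivSqZeroExt.snd this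

/-- `f = F ∘ p` for a regular function `F` on `GL_β` with `F(1 + ε X) = a + ε b`. -/
def HasD (p : T → GL β k) (X : Matrix β β k) (f : T → k) (a b : k) : Prop :=
  ∃ F : MvPolynomial ((β × β) ⊕ (β × β)) k,
    (∀ t, f t = pairEval (p t : Matrix β β k) ((p t)⁻¹ : GL β k) F) ∧
    pairEval (dualPt X) (dualPt (-X)) F = TrivSqZeroExt.inl a + TrivSqZeroExt.inr b

/-- The entrywise version of `HasD`. -/
def HasDM {δ ε : Type*} (p : T → GL β k) (X : Matrix β β k) (A : T → Matrix δ ε k)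
    (Z W : Matrix δ ε k) : Prop :=
  ∀ i j, HasD p X (fun t => A t i j) (Z i j) (W i j)

/-- The difference of two polynomials representing the same function vanishes on the image of `p`,
hence at `1 + ε X`. In this way every identity between regular maps yields an identity between
differentials. -/
lemma HasD.unique {p : T → GL β k} {X : Matrix β β k} (hX : IsTangent p X) {f g : T → k}
    (hfg : ∀ t, f t = g t) {a b c d : k} (hf : HasD p X f a b) (hg : HasD p X g c d) : b = d := by
  obtain ⟨F, hF, hFX⟩ := hf
  obtain ⟨G, hG, hGX⟩ := hg
  have := hX.pairEval_eq_zero (F - G) (fun t => by rw [map_sub, ← hF, ← hG, hfg, sub_self])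
  rw [map_sub, hFX, hGX] at this
  simpa [sub_eq_zero] using congrArg TrivSqZeroExt.snd this

lemma HasDM.unique {δ ε : Type*} {p : T → GL β k} {X : Matrix β β k} (hX : IsTangent p X)
    {A B : T → Matrix δ ε k} (h : ∀ t, A t = B t) {Z W Z' W' : Matrix δ ε k}
    (hA : HasDM p X A Z W) (hB : HasDM p X B Z' W') : W = W' := by
  ext i j
  exact HasD.unique hX (fun t => by rw [h]) (hA i j) (hB i j)

section rules
variable {p : T → GL β k} {X : Matrix β β k}

lemma HasD.const (c : k) : HasD p X (fun _ => c) c 0 :=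
  ⟨MvPolynomial.C c, fun t => by simp [pairEval], by
    simp [pairEval, TrivSqZeroExt.algebraMap_eq_inl]⟩

lemma HasD.add {f g : T → k} {a b c d : k} (hf : HasD p X f a b) (hg : HasD p X g c d) :
    HasD p X (fun t => f t + g t) (a + c) (b + d) := by
  obtain ⟨F, hF, hFX⟩ := hf
  obtain ⟨G, hG, hGX⟩ := hg
  refine ⟨F + G, fun t => by rw [map_add, ← hF, ← hG], ?_⟩
  rw [map_add, hFX, hGX]
  ext <;> simp

lemma HasD.mul {f g : T → k} {a b c d : k} (hf : HasD p X f a b) (hg : HasD p X g c d) :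
    HasD p X (fun t => f t * g t) (a * c) (a * d + b * c) := by
  obtain ⟨F, hF, hFX⟩ := hf
  obtain ⟨G, hG, hGX⟩ := hg
  refine ⟨F * G, fun t => by rw [map_mul, ← hF, ← hG], ?_⟩
  rw [map_mul, hFX, hGX]
  ext <;> simp

lemma HasD.sum {ι : Type*} (s : Finset ι) {f : ι → T → k} {a b : ι → k}
    (h : ∀ i ∈ s, HasD p X (f i) (a i) (b i)) :
    HasD p X (fun t => ∑ i ∈ s, f i t) (∑ i ∈ s, a i) (∑ i ∈ s, b i) := by
  classical
  induction s using Finset.induction_on with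
  | empty => simpa using HasD.const (p := p) (X := X) 0
  | insert i s hi ih =>
    simp only [Finset.sum_insert hi]
    exact (h i (Finset.mem_insert_self i s)).add
      (ih (fun j hj => h j (Finset.mem_insert_of_mem hj)))

lemma HasDM.base : HasDM p X (fun t => (p t : Matrix β β k)) 1 X := fun i j =>
  ⟨MvPolynomial.X (Sum.inl (i, j)), fun t => by simp [pairEval], by
    simp [pairEval, dualPt, dualMat, -DualNumber.inr_eq_smul_eps]⟩

lemma HasDM.base_inv : HasDM p X (fun t => (((p t)⁻¹ : GL β k) : Matrix β β k)) 1 (-X) :=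
  fun i j => ⟨MvPolynomial.X (Sum.inr (i, j)), fun t => by simp [pairEval], by
    simp [pairEval, dualPt, dualMat, -DualNumber.inr_eq_smul_eps]⟩

variable {δ ε η : Type*}

lemma HasDM.const (A : Matrix δ ε k) : HasDM p X (fun _ => A) A 0 := fun i j => HasD.const (A i j)

lemma HasDM.add {A B : T → Matrix δ ε k} {Z W Z' W' : Matrix δ ε k} (hA : HasDM p X A Z W)
    (hB : HasDM p X B Z' W') : HasDM p X (fun t => A t + B t) (Z + Z') (W + W') :=
  fun i j => (hA i j).add (hB i j)

lemma HasDM.mul [Fintype ε] {A : T → Matrix δ ε k} {B : T → Matrix ε η k} {Z W : Matrix δ ε k}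
    {Z' W' : Matrix ε η k} (hA : HasDM p X A Z W) (hB : HasDM p X B Z' W') :
    HasDM p X (fun t => A t * B t) (Z * Z') (Z * W' + W * Z') := by
  intro i j
  have := HasD.sum Finset.univ (fun l _ => (hA i l).mul (hB l j))
  simpa [Matrix.mul_apply, Finset.sum_add_distrib] using this

lemma HasDM.transpose {A : T → Matrix δ ε k} {Z W : Matrix δ ε k} (hA : HasDM p X A Z W) :
    HasDM p X (fun t => (A t)ᵀ) Zᵀ Wᵀ := fun i j => hA j i

lemma HasDM.congr {A B : T → Matrix δ ε k} {Z W Z' W' : Matrix δ ε k} (hA : HasDM p X A Z W)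
    (h : ∀ t, A t = B t) (hZ : Z = Z') (hW : W = W') : HasDM p X B Z' W' := by
  subst hZ hW
  intro i j
  have := hA i j
  simpa only [h] using this

/-- Conjugation by constant rectangular matrices. -/
lemma HasDM.mul_mul [Fintype δ] [Fintype ε] {ι : Type*} {A : T → Matrix δ ε k} {Z W : Matrix δ ε k}
    (hA : HasDM p X A Z W) (P : Matrix η δ k) (Q : Matrix ε ι k) :
    HasDM p X (fun t => P * A t * Q) (P * Z * Q) (P * W * Q) :=
  (((HasDM.const P).mul hA).mul (HasDM.const Q)).congr (fun _ => rfl) rfl (by simp)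

lemma HasDM.linear [Fintype δ] [Fintype ε] [DecidableEq δ] [DecidableEq ε] {ι : Type*}
    {A : T → Matrix δ ε k} {Z W : Matrix δ ε k}
    (hA : HasDM p X A Z W) (φ : Matrix δ ε k →ₗ[k] Matrix η ι k) :
    HasDM p X (fun t => φ (A t)) (φ Z) (φ W) := by
  have key : ∀ Y : Matrix δ ε k, φ Y = ∑ a, ∑ b, Y a b • φ (Matrix.single a b 1) := by
    intro Y
    conv_lhs => rw [Matrix.matrix_eq_sum_single Y]
    simp only [map_sum]
    refine Finset.sum_congr rfl fun a _ => Finset.sum_congr rfl fun b _ => ?_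
    rw [← map_smul, Matrix.smul_single, smul_eq_mul, mul_one]
  intro i j
  have h := HasD.sum Finset.univ (fun a _ => HasD.sum Finset.univ (fun b _ =>
    (hA a b).mul (HasD.const (p := p) (X := X) (φ (Matrix.single a b 1) i j))))
  simp only [mul_zero, zero_add] at h
  have key' : ∀ Y : Matrix δ ε k, φ Y i j = ∑ a, ∑ b, Y a b * φ (Matrix.single a b 1) i j := by
    intro Y
    rw [key Y]
    simp [Matrix.sum_apply]
  change HasD p X (fun t => φ (A t) i j) (φ Z i j) (φ W i j)
  rw [key' Z, key' W, show (fun t => φ (A t) i j) = _ from funext fun t => key' (A t)]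
  exact h

lemma HasDM.det [Fintype δ] [DecidableEq δ] {A : T → Matrix δ δ k} {W : Matrix δ δ k}
    (hA : HasDM p X A 1 W) : HasD p X (fun t => (A t).det) 1 W.trace := by
  choose F hF hFX using hA
  refine ⟨(Matrix.of F).det, fun t => ?_, ?_⟩
  · rw [AlgHom.map_det]
    refine congrArg Matrix.det (Matrix.ext fun i j => ?_)
    rw [AlgHom.mapMatrix_apply, Matrix.map_apply, Matrix.of_apply, ← hF]
  · rw [AlgHom.map_det, ← det_dualPt]
    congr 1
    refine Matrix.ext fun i j => ?_
    rw [AlgHom.mapMatrix_apply, Matrix.map_apply, Matrix.of_apply, hFX]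
    rfl

end rules

/-- The chain rule, by substitution of polynomials. Both `q` and its inverse are differentiated
because a regular function on the target may involve either. -/
lemma HasD.comp {p : T → GL β k} {X : Matrix β β k} {q : T → GL γ k} {Z : Matrix γ γ k}
    (hq : HasDM p X (fun t => (q t : Matrix γ γ k)) 1 Z)
    (hq' : HasDM p X (fun t => (((q t)⁻¹ : GL γ k) : Matrix γ γ k)) 1 (-Z))
    {f : T → k} {a b : k} (hf : HasD q Z f a b) : HasD p X f a b := by
  obtain ⟨F, hF, hFX⟩ := hf
  choose G hG hGX using hq
  choose H hH hHX using hq'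
  refine ⟨MvPolynomial.bind₁ (Sum.elim (fun r => G r.1 r.2) (fun r => H r.1 r.2)) F,
    fun t => ?_, ?_⟩
  · rw [hF, pairEval, pairEval, MvPolynomial.aeval_bind₁]
    congr 2
    ext r
    rcases r with r | r
    · exact hG r.1 r.2 t
    · exact hH r.1 r.2 t
  · rw [← hFX, pairEval, pairEval, MvPolynomial.aeval_bind₁]
    congr 2
    funext r
    rcases r with r | r
    · exact hGX r.1 r.2
    · exact hHX r.1 r.2

lemma HasDM.comp {δ ε : Type*} {p : T → GL β k} {X : Matrix β β k} {q : T → GL γ k}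
    {Z : Matrix γ γ k} (hq : HasDM p X (fun t => (q t : Matrix γ γ k)) 1 Z)
    (hq' : HasDM p X (fun t => (((q t)⁻¹ : GL γ k) : Matrix γ γ k)) 1 (-Z))
    {A : T → Matrix δ ε k} {V W : Matrix δ ε k} (hA : HasDM q Z A V W) : HasDM p X A V W :=
  fun i j => (hA i j).comp hq hq'

lemma HasD.reindex {p : T → GL β k} {X : Matrix β β k} {f : T → k} {a b : k}
    (hf : HasD p X f a b) (φ : S → T) : HasD (fun s => p (φ s)) X (fun s => f (φ s)) a b := by
  obtain ⟨F, hF, hFX⟩ := hf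
  exact ⟨F, fun s => hF (φ s), hFX⟩

lemma HasDM.reindex {δ ε : Type*} {p : T → GL β k} {X : Matrix β β k} {A : T → Matrix δ ε k}
    {Z W : Matrix δ ε k} (hA : HasDM p X A Z W) (φ : S → T) :
    HasDM (fun s => p (φ s)) X (fun s => A (φ s)) Z W :=
  fun i j => (hA i j).reindex φ

/-- Regular maps carry tangent vectors to tangent vectors. -/
lemma IsTangent.map {p : T → GL β k} {X : Matrix β β k} (hX : IsTangent p X) {q : S → GL γ k}
    (φ : T → S) {Z : Matrix γ γ k} (hq : HasDM p X (fun t => (q (φ t) : Matrix γ γ k)) 1 Z) :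
    IsTangent q Z := by
  intro f hf
  choose G hG hGX using hq
  have h := hX.pairEval_eq_zero (MvPolynomial.bind₁ (fun r : γ × γ => G r.1 r.2) f) (fun t => by
    rw [← hf (φ t), pairEval, matEval, MvPolynomial.aeval_bind₁]
    congr 2
    funext r
    exact (hG r.1 r.2 t).symm)
  rw [← h, pairEval, matEval, MvPolynomial.aeval_bind₁]
  congr 2
  funext r
  exact (hGX r.1 r.2).symm

/-- The line `t ↦ 1 + t X`, restricted to the `t` for which this is invertible. -/
noncomputable def lineGL (X : Matrix β β k) (t : {t : k // (1 + t • X).det ≠ 0}) : GL β k :=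
  Matrix.GeneralLinearGroup.mkOfDetNeZero (1 + (t : k) • X) t.2

lemma coe_lineGL (X : Matrix β β k) (t : {t : k // (1 + t • X).det ≠ 0}) :
    (lineGL X t : Matrix β β k) = 1 + (t : k) • X := rfl

/-- Along the line `f` becomes a polynomial in `t` that vanishes wherever `det (1 + t X)` does not.
Its product with this nonzero polynomial vanishes on the infinite field, so it is the zero
polynomial, and `ε` may be substituted for `t`. -/
lemma isTangent_lineGL [Infinite k] (X : Matrix β β k) : IsTangent (lineGL X) X := by
  intro f hf
  set A : Matrix β β (Polynomial k) := 1 + (Polynomial.X : Polynomial k) •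
    X.map Polynomial.C with hA
  have hev : ∀ t : k, A.map (Polynomial.aeval (R := k) t) = 1 + t • X := by
    intro t
    ext i j
    by_cases h : i = j <;>
    · simp [hA, h]
      exact mul_comm _ _
  have hevalf : ∀ t : k, Polynomial.aeval t (matEval A f) = matEval (1 + t • X) f := by
    intro t
    rw [map_matEval, hev]
  have hdet : ∀ t : k, Polynomial.aeval t A.det = (1 + t • X).det := by
    intro t
    rw [AlgHom.map_det, AlgHom.mapMatrix_apply, hev]
  have hdet0 : A.det ≠ 0 := by
    intro h0
    have := hdet 0
    rw [h0] at this
    simp at this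
  have hprod : matEval A f * A.det = 0 := by
    refine Polynomial.funext fun t => ?_
    have h1 : Polynomial.eval t (matEval A f * A.det)
        = matEval (1 + t • X) f * (1 + t • X).det := by
      rw [← hevalf, ← hdet, Polynomial.eval_mul]
      simp [Polynomial.aeval_def]
    rw [h1, Polynomial.eval_zero]
    by_cases ht : (1 + t • X).det = 0
    · rw [ht, mul_zero]
    · have := hf ⟨t, ht⟩
      rw [coe_lineGL] at this
      rw [this, zero_mul]
  have h0 : matEval A f = 0 := (mul_eq_zero.1 hprod).resolve_right hdet0
  have h1 := congrArg (Polynomial.aeval (R := k) (TrivSqZeroExt.inr 1 : DualNumber k)) h0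
  rw [map_zero, map_matEval] at h1
  rw [← h1]
  congr 2
  ext i j <;> by_cases h : i = j <;>
    simp [hA, dualPt, dualMat, h, Matrix.one_apply, TrivSqZeroExt.algebraMap_eq_inl,
      -DualNumber.inr_eq_smul_eps]

end Calculus

/-! ## Differentials of homomorphisms -/

section Differentials

universe u
variable {k : Type u} [Field k] {β γ : Type*} [Fintype β] [DecidableEq β] [Fintype γ]
  [DecidableEq γ] {T S : Type*}

/-- The coefficients do not depend on `X`, so tangency is a system of linear conditions and tangent
vectors form a subspace. -/
lemma matEval_dualPt (f : MvPolynomial (β × β) k) : ∃ c : β × β → k,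
    ∃ d : k, ∀ X : Matrix β β k,
    matEval (dualPt X) f = TrivSqZeroExt.inl d + TrivSqZeroExt.inr (∑ p, X p.1 p.2 * c p) :=
  ⟨_, _, fun X => aeval_dual (fun q : β × β => (1 : Matrix β β k) q.1 q.2)
    (fun q => X q.1 q.2) f⟩

lemma isTangent_zero {p : T → GL β k} (t : T) (ht : p t = 1) : IsTangent p 0 := by
  intro f hf
  have h1 : dualPt (0 : Matrix β β k) =
      (1 : Matrix β β k).map (Algebra.ofId k (DualNumber k)) := by
    rw [dualPt, dualMat_one_zero]
    exact ((Algebra.ofId k (DualNumber k)).mapMatrix (m := β)).map_one.symm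
  have := hf t
  rw [ht] at this
  rw [h1, ← map_matEval]
  change _ = _
  rw [show matEval (1 : Matrix β β k) f = 0 from this, map_zero]

lemma IsTangent.add {p : T → GL β k} {X Y : Matrix β β k} (hX : IsTangent p X)
    (hY : IsTangent p Y) : IsTangent p (X + Y) := by
  intro f hf
  obtain ⟨c, d, hc⟩ := matEval_dualPt f
  have h1 := hX f hf
  have h2 := hY f hf
  rw [hc] at h1 h2 ⊢
  have h3 := congrArg TrivSqZeroExt.fst h1
  have h4 := congrArg TrivSqZeroExt.snd h1
  have h5 := congrArg TrivSqZeroExt.snd h2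
  simp only [TrivSqZeroExt.fst_add, TrivSqZeroExt.snd_add, TrivSqZeroExt.fst_inl,
    TrivSqZeroExt.fst_inr, TrivSqZeroExt.snd_inl, TrivSqZeroExt.snd_inr, add_zero, zero_add,
    TrivSqZeroExt.fst_zero, TrivSqZeroExt.snd_zero] at h3 h4 h5
  simp only [Matrix.add_apply, add_mul, Finset.sum_add_distrib, h4, h5, h3, add_zero,
    TrivSqZeroExt.inl_zero, TrivSqZeroExt.inr_zero]

lemma IsTangent.smul {p : T → GL β k} {X : Matrix β β k} (hX : IsTangent p X) (a : k) :
    IsTangent p (a • X) := by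
  intro f hf
  obtain ⟨c, d, hc⟩ := matEval_dualPt f
  have h1 := hX f hf
  rw [hc] at h1 ⊢
  have h3 := congrArg TrivSqZeroExt.fst h1
  have h4 := congrArg TrivSqZeroExt.snd h1
  simp only [TrivSqZeroExt.fst_add, TrivSqZeroExt.snd_add, TrivSqZeroExt.fst_inl,
    TrivSqZeroExt.fst_inr, TrivSqZeroExt.snd_inl, TrivSqZeroExt.snd_inr, add_zero, zero_add,
    TrivSqZeroExt.fst_zero, TrivSqZeroExt.snd_zero] at h3 h4
  simp only [Matrix.smul_apply, smul_eq_mul, mul_assoc, ← Finset.mul_sum, h4, h3, mul_zero,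
    TrivSqZeroExt.inl_zero, TrivSqZeroExt.inr_zero, add_zero]

lemma IsTangent.mono {p : T → GL β k} {q : S → GL β k} {X : Matrix β β k} (hX : IsTangent p X)
    (h : ∀ t, ∃ s, q s = p t) : IsTangent q X := by
  intro f hf
  refine hX f fun t => ?_
  obtain ⟨s, hs⟩ := h t
  rw [← hs]
  exact hf s

lemma HasDM.smul {δ ε : Type*} {p : T → GL β k} {X : Matrix β β k} {f : T → k} {a b : k}
    (hf : HasD p X f a b) {A : T → Matrix δ ε k} {Z W : Matrix δ ε k} (hA : HasDM p X A Z W) :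
    HasDM p X (fun t => f t • A t) (a • Z) (a • W + b • Z) :=
  fun i j => hf.mul (hA i j)

lemma isRegularOn_iff_hasD {p : T → GL β k} (X : Matrix β β k) (f : T → k) :
    IsRegularOn p f ↔ ∃ a b, HasD p X f a b := by
  have key : ∀ (t : T) (F : MvPolynomial ((β × β) ⊕ (β × β)) k),
      MvPolynomial.eval (Sum.elim (fun r => (p t : Matrix β β k) r.1 r.2)
        (fun r => (((p t)⁻¹ : GL β k) : Matrix β β k) r.1 r.2)) F
      = pairEval (p t : Matrix β β k) ((p t)⁻¹ : GL β k) F := by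
    intro t F
    have : (pairEval (p t : Matrix β β k) ((p t)⁻¹ : GL β k) :
        MvPolynomial ((β × β) ⊕ (β × β)) k →ₐ[k] k).toRingHom
        = MvPolynomial.eval (Sum.elim (fun r : β × β => (p t : Matrix β β k) r.1 r.2)
        (fun r : β × β => (((p t)⁻¹ : GL β k) : Matrix β β k) r.1 r.2)) := by
      apply MvPolynomial.ringHom_ext
      · intro r
        simp [pairEval]
      · intro r
        rcases r with r | r <;> simp [pairEval]
    rw [← this]
    rfl
  constructor
  · rintro ⟨F, hF⟩
    refine ⟨(pairEval (dualPt X) (dualPt (-X)) F).fst, (pairEval (dualPt X) (dualPt (-X)) F).snd,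
      F, fun t => by rw [hF, key], ?_⟩
    rw [TrivSqZeroExt.inl_fst_add_inr_snd_eq]
  · rintro ⟨a, b, F, hF, -⟩
    exact ⟨F, fun t => by rw [hF, key]⟩

variable {Γ : Type*} [Group Γ]

/-- The matrix entries of `Φ` are regular functions in the representation `ρ`. -/
def IsRegularWrt (ρ : Γ →* GL β k) (Φ : Γ →* GL γ k) : Prop :=
  ∀ i j, IsRegularOn (fun x => ρ x) (fun x => (Φ x : Matrix γ γ k) i j)

/-- `δ` is the differential at `1` of `Φ`, for the variety structure given by `ρ`. -/
def IsDifferential (ρ : Γ →* GL β k) (Φ : Γ →* GL γ k)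
    (δ : Matrix β β k →ₗ[k] Matrix γ γ k) : Prop :=
  ∀ X, HasDM (fun x => ρ x) X (fun x => (Φ x : Matrix γ γ k)) 1 (δ X)

/-- The tangent space at `1` of the image of `ρ`. -/
def tangentSpace (ρ : Γ →* GL β k) : Submodule k (Matrix β β k) where
  carrier := {X | IsTangent (fun x => ρ x) X}
  add_mem' := IsTangent.add
  zero_mem' := isTangent_zero 1 (map_one ρ)
  smul_mem' a _ h := h.smul a

lemma mem_tangentSpace {ρ : Γ →* GL β k} {X : Matrix β β k} :
    X ∈ tangentSpace ρ ↔ IsTangent (fun x => ρ x) X := Iff.rfl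

/-- The map `δ` is the formal derivative of one choice of representing polynomials. On all matrices
it depends on that choice; on tangent vectors it is canonical by `HasD.unique`. -/
lemma IsRegularWrt.exists_isDifferential {ρ : Γ →* GL β k} {Φ : Γ →* GL γ k}
    (h : IsRegularWrt ρ Φ) : ∃ δ, IsDifferential ρ Φ δ := by
  have h' := fun i j => (isRegularOn_iff_hasD (p := fun x => ρ x) 0
    (fun x => (Φ x : Matrix γ γ k) i j)).1 (h i j)
  choose a b F hF _ using h'
  set e : (β × β) ⊕ (β × β) → k := Sum.elim (fun p => (1 : Matrix β β k) p.1 p.2)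
    (fun p => (1 : Matrix β β k) p.1 p.2) with he
  have hone : ∀ i j, MvPolynomial.eval e (F i j) = (1 : Matrix γ γ k) i j := by
    intro i j
    have h1 := hF i j 1
    simp only [map_one, inv_one, Units.val_one] at h1
    have : (pairEval (1 : Matrix β β k) (1 : Matrix β β k) :
        MvPolynomial ((β × β) ⊕ (β × β)) k →ₐ[k] k).toRingHom = MvPolynomial.eval e := by
      apply MvPolynomial.ringHom_ext
      · intro r
        simp [pairEval]
      · intro r
        rcases r with r | r <;> simp [pairEval, he]
    rw [← this]
    exact h1.symm
  let v : Matrix β β k → (β × β) ⊕ (β × β) → k := fun X =>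
    Sum.elim (fun p => X p.1 p.2) (fun p => -X p.1 p.2)
  have hv : ∀ X i j, pairEval (dualPt X) (dualPt (-X)) (F i j)
      = TrivSqZeroExt.inl ((1 : Matrix γ γ k) i j) + TrivSqZeroExt.inr (∑ r, v X r *
        MvPolynomial.eval e (MvPolynomial.pderiv r (F i j))) := by
    intro X i j
    rw [← hone, ← aeval_dual]
    have : (pairEval (dualPt X) (dualPt (-X)) :
        MvPolynomial ((β × β) ⊕ (β × β)) k →ₐ[k] DualNumber k) = MvPolynomial.aeval
        (fun r => (TrivSqZeroExt.inl (e r) + TrivSqZeroExt.inr (v X r) : DualNumber k)) := by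
      apply MvPolynomial.algHom_ext
      intro r
      rcases r with r | r <;>
        simp [pairEval, he, v, dualPt, dualMat, -DualNumber.inr_eq_smul_eps]
    rw [this]
  refine ⟨{ toFun := fun X => Matrix.of fun i j => ∑ r, v X r *
              MvPolynomial.eval e (MvPolynomial.pderiv r (F i j))
            map_add' := ?_
            map_smul' := ?_ }, ?_⟩
  · intro X Y
    ext i j
    simp only [Matrix.of_apply, Matrix.add_apply, ← Finset.sum_add_distrib]
    refine Finset.sum_congr rfl fun r _ => ?_
    rcases r with r | r <;> simp [v] <;> ring
  · intro c X
    ext i j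
    simp only [Matrix.of_apply, Matrix.smul_apply, smul_eq_mul, Finset.mul_sum, RingHom.id_apply]
    refine Finset.sum_congr rfl fun r _ => ?_
    rcases r with r | r <;> simp [v] <;> ring
  · intro X i j
    exact ⟨F i j, fun x => hF i j x, hv X i j⟩

/-- Exchanging the variables for a matrix and its inverse exchanges `X` and `-X`. This gives the
differential of the inverse of a homomorphism from that of the homomorphism. -/
lemma HasD.inv_arg {ρ : Γ →* GL β k} {X : Matrix β β k} {f : Γ → k} {a b : k}
    (hf : HasD (fun x => ρ x) X f a b) : HasD (fun x => ρ x) (-X) (fun x => f x⁻¹) a b := by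
  obtain ⟨F, hF, hFX⟩ := hf
  have key : ∀ {R : Type u} [CommRing R] [Algebra k R] (x y : Matrix β β R),
      pairEval x y (MvPolynomial.rename Sum.swap F) = pairEval y x F := by
    intro R _ _ x y
    have : ((pairEval x y).comp (MvPolynomial.rename Sum.swap) :
        MvPolynomial ((β × β) ⊕ (β × β)) k →ₐ[k] R) = pairEval y x := by
      apply MvPolynomial.algHom_ext
      intro r
      rcases r with r | r <;> simp [pairEval]
    rw [← this, AlgHom.comp_apply]
  refine ⟨MvPolynomial.rename Sum.swap F, fun x => ?_, ?_⟩
  · have := hF x⁻¹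
    simp only [map_inv, inv_inv] at this
    rw [key]
    exact this
  · rw [key, neg_neg, hFX]

namespace IsDifferential

variable {ρ : Γ →* GL β k} {Φ : Γ →* GL γ k} {δ : Matrix β β k →ₗ[k] Matrix γ γ k}
  (hδ : IsDifferential ρ Φ δ)

include hδ

lemma inv (X : Matrix β β k) :
    HasDM (fun x => ρ x) X (fun x => (((Φ x)⁻¹ : GL γ k) : Matrix γ γ k)) 1 (-δ X) := by
  intro i j
  have := (hδ (-X) i j).inv_arg
  rw [neg_neg, map_neg] at this
  simpa using this

lemma isTangent {X : Matrix β β k} (hX : X ∈ tangentSpace ρ) : δ X ∈ tangentSpace Φ :=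
  IsTangent.map hX id (hδ X)

/-- The chain rule computes the differential of `ρ` with respect to itself in two ways, directly and
through `Φ`. -/
lemma left_inv {δ' : Matrix γ γ k →ₗ[k] Matrix β β k} (hδ' : IsDifferential Φ ρ δ')
    {X : Matrix β β k} (hX : X ∈ tangentSpace ρ) : δ' (δ X) = X :=
  HasDM.unique hX (fun _ => rfl) (HasDM.comp (hδ X) (hδ.inv X) (hδ' (δ X))) HasDM.base

lemma map_conj (x : Γ) {Y : Matrix β β k} (hY : Y ∈ tangentSpace ρ) :
    δ ((ρ x : Matrix β β k) * Y * (((ρ x)⁻¹ : GL β k) : Matrix β β k))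
      = (Φ x : Matrix γ γ k) * δ Y * (((Φ x)⁻¹ : GL γ k) : Matrix γ γ k) := by
  have h1 : HasDM (fun y => ρ y) Y (fun y => ((ρ (x * y * x⁻¹) : GL β k) : Matrix β β k)) 1
      ((ρ x : Matrix β β k) * Y * (((ρ x)⁻¹ : GL β k) : Matrix β β k)) :=
    (HasDM.base.mul_mul (ρ x : Matrix β β k)
      (((ρ x)⁻¹ : GL β k) : Matrix β β k)).congr
      (fun y => by simp) (by simp) rfl
  have h2 : HasDM (fun y => ρ y) Y
      (fun y => (((ρ (x * y * x⁻¹))⁻¹ : GL β k) : Matrix β β k)) 1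
      (-((ρ x : Matrix β β k) * Y * (((ρ x)⁻¹ : GL β k) : Matrix β β k))) :=
    (HasDM.base_inv.mul_mul (ρ x : Matrix β β k)
      (((ρ x)⁻¹ : GL β k) : Matrix β β k)).congr
      (fun y => by simp [Matrix.mul_assoc]) (by simp) (by simp)
  have h3 := (hδ ((ρ x : Matrix β β k) * Y * (((ρ x)⁻¹ : GL β k) : Matrix β β k))).reindex
    (fun y => x * y * x⁻¹)
  refine HasDM.unique hY (fun y => ?_) (HasDM.comp h1 h2 h3)
    ((hδ Y).mul_mul (Φ x : Matrix γ γ k)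
      (((Φ x)⁻¹ : GL γ k) : Matrix γ γ k))
  simp

/-- Differentiating `Φ(x y x⁻¹)` in `y` gives `map_conj`; differentiating that identity in `x` at
the unit gives the bracket. -/
lemma map_bracket {X Y : Matrix β β k} (hX : X ∈ tangentSpace ρ) (hY : Y ∈ tangentSpace ρ) :
    δ (X * Y - Y * X) = δ X * δ Y - δ Y * δ X := by
  have h1 : HasDM (fun x => ρ x) X
      (fun x => δ ((ρ x : Matrix β β k) * Y * (((ρ x)⁻¹ : GL β k) : Matrix β β k))) (δ Y)
      (δ (X * Y - Y * X)) := by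
    refine HasDM.congr ((((HasDM.base.mul (HasDM.const Y)).mul HasDM.base_inv)).linear δ)
      (fun _ => rfl) (by simp) ?_
    congr 1
    simp only [one_mul, mul_zero, zero_add, mul_one, mul_neg]
    abel
  have h2 : HasDM (fun x => ρ x) X
      (fun x => (Φ x : Matrix γ γ k) * δ Y * (((Φ x)⁻¹ : GL γ k) : Matrix γ γ k)) (δ Y)
      (δ X * δ Y - δ Y * δ X) := by
    refine HasDM.congr (((hδ X).mul (HasDM.const (δ Y))).mul (hδ.inv X))
      (fun _ => rfl) (by simp) ?_
    simp only [one_mul, mul_zero, zero_add, mul_one, mul_neg]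
    abel
  exact HasDM.unique hX (fun x => hδ.map_conj x hY) h1 h2

/-- `δ` need not respect matrix products, but it respects brackets, and so does the inverse `δ'`;
commuting means that the bracket vanishes. -/
lemma commute_iff {δ' : Matrix γ γ k →ₗ[k] Matrix β β k} (hδ' : IsDifferential Φ ρ δ')
    {X Y : Matrix β β k} (hX : X ∈ tangentSpace ρ) (hY : Y ∈ tangentSpace ρ) :
    δ X * δ Y = δ Y * δ X ↔ X * Y = Y * X := by
  constructor
  · intro h
    have := hδ'.map_bracket (hδ.isTangent hX) (hδ.isTangent hY)
    rw [h, sub_self, map_zero, hδ.left_inv hδ' hX, hδ.left_inv hδ' hY] at this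
    exact sub_eq_zero.1 this.symm
  · intro h
    have := hδ.map_bracket hX hY
    rw [h, sub_self, map_zero] at this
    exact sub_eq_zero.1 this.symm

/-- Regularity is transitive. -/
lemma trans {f : Γ → k} (hf : IsRegularOn (fun x => Φ x) f) : IsRegularOn (fun x => ρ x) f := by
  obtain ⟨a, b, h⟩ := (isRegularOn_iff_hasD (δ 0) f).1 hf
  exact (isRegularOn_iff_hasD 0 f).2 ⟨a, b, HasD.comp (hδ 0) (hδ.inv 0) h⟩

end IsDifferential

lemma hasDM_autHom {outer : Bool} (g : GL γ k) {p : T → GL β k} {X : Matrix β β k}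
    {q : T → GL γ k} {Z : Matrix γ γ k} (hq : HasDM p X (fun t => (q t : Matrix γ γ k)) 1 Z)
    (hq' : HasDM p X (fun t => (((q t)⁻¹ : GL γ k) : Matrix γ γ k)) 1 (-Z)) :
    HasDM p X (fun t => (autHom outer g (q t) : Matrix γ γ k)) 1 (autDiff outer g Z) ∧
    HasDM p X (fun t => (((autHom outer g (q t))⁻¹ : GL γ k) : Matrix γ γ k)) 1
      (-autDiff outer g Z) := by
  cases outer
  · refine ⟨(hq.mul_mul (g : Matrix γ γ k) ((g⁻¹ : GL γ k) : Matrix γ γ k)).congr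
      (fun t => by simp [autHom]) (by simp) rfl,
      (hq'.mul_mul (g : Matrix γ γ k) ((g⁻¹ : GL γ k) : Matrix γ γ k)).congr
      (fun t => by simp [autHom, Matrix.mul_assoc]) (by simp) (by simp [autDiff])⟩
  · have hc : ∀ t, ((contra (q t) : GL γ k) : Matrix γ γ k)
        = (((q t)⁻¹ : GL γ k) : Matrix γ γ k)ᵀ := fun _ => rfl
    have hc' : ∀ t, (((contra (q t))⁻¹ : GL γ k) : Matrix γ γ k)
        = ((q t : GL γ k) : Matrix γ γ k)ᵀ := fun _ => rfl
    have hv : ∀ t, (autHom true g (q t) : GL γ k) = g * contra (q t) * g⁻¹ := fun _ => rfl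
    refine ⟨(hq'.transpose.mul_mul (g : Matrix γ γ k) ((g⁻¹ : GL γ k) : Matrix γ γ k)).congr
      (fun t => ?_) (by simp) (by simp [autDiff]),
      (hq.transpose.mul_mul (g : Matrix γ γ k) ((g⁻¹ : GL γ k) : Matrix γ γ k)).congr
      (fun t => ?_) (by simp) (by simp [autDiff])⟩
    · rw [hv, Units.val_mul, Units.val_mul, hc]
    · rw [hv, _root_.mul_inv_rev, _root_.mul_inv_rev, inv_inv, Units.val_mul, Units.val_mul, hc',
        Matrix.mul_assoc]

end Differentials

/-! ## Tangent spaces of the classical groups -/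

section ClassicalTangent

universe u
variable {k : Type u} [Field k] [Infinite k] {N : ℕ}

lemma isTangent_top (X : Matrix (Fin N) (Fin N) k) :
    IsTangent (fun x : (⊤ : Subgroup (GL (Fin N) k)) => (x : GL (Fin N) k)) X :=
  (isTangent_lineGL X).mono fun t => ⟨⟨lineGL X t, trivial⟩, rfl⟩

omit [Infinite k] in
lemma trace_eq_zero_of_isTangent {T : Type*} {p : T → GL (Fin N) k}
    (hp : ∀ t, p t ∈ slGroup k N) {X : Matrix (Fin N) (Fin N) k} (hX : IsTangent p X) :
    X.trace = 0 := by
  refine HasD.unique hX (fun t => ?_) HasDM.base.det (HasD.const 1)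
  have : Matrix.GeneralLinearGroup.det (p t) = 1 := hp t
  simpa using congrArg Units.val this

/-- The line `1 + t X` is corrected by the diagonal matrix `D` with one entry `det (1 + t X)⁻¹`. The
derivative of the correction is a multiple of the trace of `X`, which is zero. -/
lemma isTangent_slGroup {X : Matrix (Fin N) (Fin N) k} (hX : X.trace = 0) :
    IsTangent (fun x : slGroup k N => (x : GL (Fin N) k)) X := by
  rcases Nat.eq_zero_or_pos N with hN | hN
  · subst hN
    rw [Subsingleton.elim X 0]
    exact isTangent_zero 1 rfl
  let i₀ : Fin N := ⟨0, hN⟩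
  let D : k → Matrix (Fin N) (Fin N) k := fun d => 1 + (d - 1) • Matrix.single i₀ i₀ 1
  have hD : ∀ d, (D d).det = d := by
    intro d
    have : D d = Matrix.diagonal (Function.update 1 i₀ d) := by
      ext i j
      by_cases hij : i = j
      · subst hij
        by_cases hi : i = i₀
        · subst hi
          simp [D]
        · simp [D, hi, Ne.symm hi]
      · by_cases hi : i₀ = i
        · subst hi
          simp [D, hij]
        · simp [D, hij, hi]
    rw [this, Matrix.det_diagonal, Finset.prod_update_of_mem (Finset.mem_univ _)]
    simp
  let y := lineGL X
  let d : {t : k // (1 + t • X).det ≠ 0} → k := fun t =>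
    (((y t)⁻¹ : GL (Fin N) k) : Matrix (Fin N) (Fin N) k).det
  have hyd : ∀ t, (y t : Matrix (Fin N) (Fin N) k).det * d t = 1 := by
    intro t
    rw [← Matrix.det_mul, Units.mul_inv, Matrix.det_one]
  have hd : ∀ t, (D (d t)).det ≠ 0 := by
    intro t
    rw [hD]
    exact right_ne_zero_of_mul_eq_one (hyd t)
  let φ : {t : k // (1 + t • X).det ≠ 0} → slGroup k N := fun t =>
    ⟨y t * Matrix.GeneralLinearGroup.mkOfDetNeZero (D (d t)) (hd t), by
      apply Units.ext
      simp only [Matrix.GeneralLinearGroup.val_det_apply, Units.val_mul, Matrix.det_mul,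
        Units.val_one]
      change (y t : Matrix (Fin N) (Fin N) k).det * (D (d t)).det = 1
      rw [hD, hyd]⟩
  refine (isTangent_lineGL X).map (q := fun x : slGroup k N => (x : GL (Fin N) k)) φ ?_
  have h1 : HasD (lineGL X) X (fun t => d t + -1) (1 + -1) ((-X).trace + 0) :=
    HasDM.base_inv.det.add (HasD.const (-1))
  have h2 := HasDM.base (p := lineGL X) (X := X)
  have h3 := h2.mul ((HasDM.const 1).add
    (HasDM.smul h1 (HasDM.const (Matrix.single i₀ i₀ (1 : k)))))
  refine h3.congr (fun t => ?_) (by simp) (by simp [hX])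
  change _ = (y t : Matrix (Fin N) (Fin N) k) * D (d t)
  rw [← sub_eq_add_neg]

omit [Infinite k] in
lemma skew_of_isTangent {T : Type*} {B : Matrix (Fin N) (Fin N) k} {p : T → GL (Fin N) k}
    (hp : ∀ t, p t ∈ formGroup B) {X : Matrix (Fin N) (Fin N) k} (hX : IsTangent p X) :
    Xᵀ * B + B * X = 0 := by
  have h1 : HasDM p X (fun t => (p t : Matrix (Fin N) (Fin N) k)ᵀ * B *
      (p t : Matrix (Fin N) (Fin N) k)) B (Xᵀ * B + B * X) := by
    refine ((HasDM.base.transpose.mul (HasDM.const B)).mul HasDM.base).congr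
      (fun _ => rfl) (by simp) ?_
    simp [add_comm]
  exact HasDM.unique hX (fun t => hp t) h1 (HasDM.const B)

/-- The Cayley transform `(1 + t X)(1 - t X)⁻¹` is an isometry, of determinant 1 because numerator
and denominator have equal determinants. Its derivative at 0 is `2 X`, which is where `2 ≠ 0`
enters. -/
lemma isTangent_formGroup (h2 : (2 : k) ≠ 0) {B : Matrix (Fin N) (Fin N) k} (hB : B.det ≠ 0)
    {X : Matrix (Fin N) (Fin N) k} (hX : Xᵀ * B + B * X = 0) :
    IsTangent (fun x : ↥(formGroup B ⊓ slGroup k N) => (x : GL (Fin N) k)) X := by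
  have hXB : Xᵀ * B = -(B * X) := eq_neg_of_add_eq_zero_left hX
  have hcomm : ∀ t : k, (1 + t • X)ᵀ * B = B * (1 - t • X) := by
    intro t
    rw [Matrix.transpose_add, Matrix.transpose_smul, Matrix.transpose_one, add_mul, mul_sub,
      Matrix.smul_mul, hXB, Matrix.mul_smul, one_mul, mul_one, smul_neg, sub_eq_add_neg]
  have hdet : ∀ t : k, (1 + t • X).det = (1 - t • X).det := by
    intro t
    have := congrArg Matrix.det (hcomm t)
    rw [Matrix.det_mul, Matrix.det_mul, Matrix.det_transpose, mul_comm] at this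
    exact mul_left_cancel₀ hB this
  let y := lineGL (-X)
  have hy : ∀ t, (y t : Matrix (Fin N) (Fin N) k) = 1 - (t : k) • X := by
    intro t
    change 1 + (t : k) • (-X) = _
    rw [smul_neg, sub_eq_add_neg]
  -- The numerator `1 + t X` is written as `2 - y` with `y = 1 - t X`, so that `q` is a regular
  -- function of the line `y`.
  let q : {t : k // (1 + t • (-X)).det ≠ 0} → Matrix (Fin N) (Fin N) k := fun t =>
    (2 + -(1 : k) • (y t : Matrix (Fin N) (Fin N) k)) *
      (((y t)⁻¹ : GL (Fin N) k) : Matrix (Fin N) (Fin N) k)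
  have hz : ∀ t : {t : k // (1 + t • (-X)).det ≠ 0},
      (2 + -(1 : k) • (y t : Matrix (Fin N) (Fin N) k)) = 1 + (t : k) • X := by
    intro t
    rw [hy, neg_smul, one_smul, ← one_add_one_eq_two]
    abel
  have hinv : ∀ t, (y t : Matrix (Fin N) (Fin N) k) *
      (((y t)⁻¹ : GL (Fin N) k) : Matrix (Fin N) (Fin N) k) = 1 := fun t => Units.mul_inv _
  have hqdet : ∀ t, (q t).det = 1 := by
    intro t
    change Matrix.det (_ * _) = 1
    rw [hz, Matrix.det_mul, hdet, ← hy, ← Matrix.det_mul, hinv, Matrix.det_one]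
  have hqform : ∀ t, (q t)ᵀ * B * q t = B := by
    intro t
    have hyB : (y t : Matrix (Fin N) (Fin N) k)ᵀ * B = B * (1 + (t : k) • X) := by
      have := hcomm (-(t : k))
      rw [hy]
      simpa [sub_eq_add_neg] using this
    have hyc : (1 - (t : k) • X) * (1 + (t : k) • X) = (1 + (t : k) • X) * (1 - (t : k) • X) := by
      simp only [sub_mul, mul_sub, add_mul, mul_add, one_mul, mul_one]
      abel
    have hti : ((((y t)⁻¹ : GL (Fin N) k) : Matrix (Fin N) (Fin N) k))ᵀ *
        (y t : Matrix (Fin N) (Fin N) k)ᵀ = 1 := by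
      rw [← Matrix.transpose_mul, hinv, Matrix.transpose_one]
    change (_ * _)ᵀ * B * (_ * _) = B
    rw [hz, Matrix.transpose_mul]
    calc _ = ((((y t)⁻¹ : GL (Fin N) k) : Matrix (Fin N) (Fin N) k))ᵀ *
          ((1 + (t : k) • X)ᵀ * B) * (1 + (t : k) • X) *
          (((y t)⁻¹ : GL (Fin N) k) : Matrix (Fin N) (Fin N) k) := by
            simp only [Matrix.mul_assoc]
      _ = ((((y t)⁻¹ : GL (Fin N) k) : Matrix (Fin N) (Fin N) k))ᵀ * B *
          ((1 - (t : k) • X) * (1 + (t : k) • X)) *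
          (((y t)⁻¹ : GL (Fin N) k) : Matrix (Fin N) (Fin N) k) := by
            rw [hcomm]
            simp only [Matrix.mul_assoc]
      _ = ((((y t)⁻¹ : GL (Fin N) k) : Matrix (Fin N) (Fin N) k))ᵀ *
          (B * (1 + (t : k) • X)) * ((y t : Matrix (Fin N) (Fin N) k) *
          (((y t)⁻¹ : GL (Fin N) k) : Matrix (Fin N) (Fin N) k)) := by
            rw [hyc, ← hy]
            simp only [Matrix.mul_assoc]
      _ = B := by
            rw [← hyB, hinv, mul_one, ← Matrix.mul_assoc, hti, one_mul]
  have hq0 : ∀ t, (q t).det ≠ 0 := fun t => by rw [hqdet]; exact one_ne_zero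
  let φ : {t : k // (1 + t • (-X)).det ≠ 0} → ↥(formGroup B ⊓ slGroup k N) := fun t =>
    ⟨Matrix.GeneralLinearGroup.mkOfDetNeZero (q t) (hq0 t), hqform t, by
      apply Units.ext
      simp only [Matrix.GeneralLinearGroup.val_det_apply, Units.val_one]
      exact hqdet t⟩
  have h3 : IsTangent (fun x : ↥(formGroup B ⊓ slGroup k N) => (x : GL (Fin N) k))
      ((2 : k) • X) := by
    refine (isTangent_lineGL (-X)).map
      (q := fun x : ↥(formGroup B ⊓ slGroup k N) => (x : GL (Fin N) k)) φ ?_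
    have h4 := ((HasDM.const (2 : Matrix (Fin N) (Fin N) k)).add
      (HasDM.smul (HasD.const (-1 : k)) (HasDM.base (p := lineGL (-X)) (X := -X)))).mul
      (HasDM.base_inv (p := lineGL (-X)) (X := -X))
    refine h4.congr (fun t => rfl) ?_ ?_
    · rw [mul_one, neg_smul, one_smul, ← one_add_one_eq_two]
      abel
    · simp only [neg_neg, neg_smul, one_smul, zero_smul, mul_one, zero_add, add_zero, smul_neg]
      rw [← one_add_one_eq_two, two_smul]
      noncomm_ring
  have := h3.smul (2 : k)⁻¹
  rwa [smul_smul, inv_mul_cancel₀ h2, one_smul] at this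

end ClassicalTangent

/-! ### Tangent space of a product in the representation diag(x, γ(y)) -/

section PairTangent

universe u
variable {k : Type u} [Field k] {a : ℕ}

lemma coe_pairHom (x : GL (Fin a) k × GL (Fin a) k) :
    (pairHom k a x : Matrix (Fin a ⊕ Fin a) (Fin a ⊕ Fin a) k)
      = Matrix.fromBlocks (x.1 : Matrix (Fin a) (Fin a) k) 0 0
        (((x.2)⁻¹ : GL (Fin a) k) : Matrix (Fin a) (Fin a) k)ᵀ := rfl

lemma coe_pairHom_inv (x : GL (Fin a) k × GL (Fin a) k) :
    (((pairHom k a x)⁻¹ : GL (Fin a ⊕ Fin a) k) : Matrix (Fin a ⊕ Fin a) (Fin a ⊕ Fin a) k)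
      = Matrix.fromBlocks (((x.1)⁻¹ : GL (Fin a) k) : Matrix (Fin a) (Fin a) k) 0 0
        (x.2 : Matrix (Fin a) (Fin a) k)ᵀ := rfl

lemma HasDM.fromBlocks {β : Type*} [Fintype β] [DecidableEq β] {T : Type*} {p : T → GL β k}
    {X : Matrix β β k} {n m o l : Type*} {A : T → Matrix n l k} {B : T → Matrix n m k}
    {C : T → Matrix o l k} {D : T → Matrix o m k} {A' A'' B' B'' C' C'' D' D''}
    (hA : HasDM p X A A' A'') (hB : HasDM p X B B' B'') (hC : HasDM p X C C' C'')
    (hD : HasDM p X D D' D'') : HasDM p X (fun t => Matrix.fromBlocks (A t) (B t) (C t) (D t))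
      (Matrix.fromBlocks A' B' C' D') (Matrix.fromBlocks A'' B'' C'' D'') := by
  rintro (i | i) (j | j)
  · exact hA i j
  · exact hB i j
  · exact hC i j
  · exact hD i j

/-- The tangent space of `S × S` in the representation `pairHom`. -/
lemma isTangent_pairHom_iff (S : Subgroup (GL (Fin a) k))
    (X : Matrix (Fin a ⊕ Fin a) (Fin a ⊕ Fin a) k) :
    IsTangent (fun x : S.prod S => pairHom k a x) X ↔
      ∃ A D : Matrix (Fin a) (Fin a) k, X = Matrix.fromBlocks A 0 0 (-Dᵀ) ∧
        IsTangent (fun x : S => (x : GL (Fin a) k)) A ∧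
        IsTangent (fun x : S => (x : GL (Fin a) k)) D := by
  constructor
  · intro hX
    have h12 : X.toBlocks₁₂ = 0 := by
      ext i j
      refine HasD.unique hX (fun t => ?_) (HasDM.base (Sum.inl i) (Sum.inr j)) (HasD.const 0)
      rfl
    have h21 : X.toBlocks₂₁ = 0 := by
      ext i j
      refine HasD.unique hX (fun t => ?_) (HasDM.base (Sum.inr i) (Sum.inl j)) (HasD.const 0)
      rfl
    refine ⟨X.toBlocks₁₁, -X.toBlocks₂₂ᵀ, ?_, ?_, ?_⟩
    · conv_lhs => rw [← Matrix.fromBlocks_toBlocks X, h12, h21]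
      simp
    · refine hX.map (fun x => ⟨x.1.1, x.2.1⟩) ?_
      have : HasDM (fun x : S.prod S => pairHom k a x) X
          (fun t => Matrix.toBlocks₁₁ (pairHom k a t : Matrix (Fin a ⊕ Fin a) (Fin a ⊕ Fin a) k))
          (Matrix.toBlocks₁₁ (1 : Matrix (Fin a ⊕ Fin a) (Fin a ⊕ Fin a) k)) X.toBlocks₁₁ :=
        fun i j => HasDM.base (Sum.inl i) (Sum.inl j)
      refine this.congr (fun t => ?_) ?_ rfl
      · rw [coe_pairHom, Matrix.toBlocks_fromBlocks₁₁]
      · rw [← Matrix.fromBlocks_one, Matrix.toBlocks_fromBlocks₁₁]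
    · refine hX.map (fun x => ⟨x.1.2, x.2.2⟩) ?_
      have : HasDM (fun x : S.prod S => pairHom k a x) X
          (fun t => (Matrix.toBlocks₂₂ (((pairHom k a t)⁻¹ : GL (Fin a ⊕ Fin a) k) :
            Matrix (Fin a ⊕ Fin a) (Fin a ⊕ Fin a) k))ᵀ)
          (Matrix.toBlocks₂₂ (1 : Matrix (Fin a ⊕ Fin a) (Fin a ⊕ Fin a) k))ᵀ
          ((-X).toBlocks₂₂)ᵀ :=
        HasDM.transpose fun i j => HasDM.base_inv (Sum.inr i) (Sum.inr j)
      refine this.congr (fun t => ?_) ?_ ?_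
      · rw [coe_pairHom_inv, Matrix.toBlocks_fromBlocks₂₂, Matrix.transpose_transpose]
      · rw [← Matrix.fromBlocks_one, Matrix.toBlocks_fromBlocks₂₂, Matrix.transpose_one]
      · ext i j
        rfl
  · rintro ⟨A, D, rfl, hA, hD⟩
    -- Tangent vectors add up, so each factor can be treated with the other one fixed at the
    -- identity.
    have h1 : IsTangent (fun x : S.prod S => pairHom k a x) (Matrix.fromBlocks A 0 0 0) := by
      refine hA.map (fun x => ⟨(x, 1), x.2, S.one_mem⟩) ?_
      refine (HasDM.fromBlocks HasDM.base (HasDM.const 0) (HasDM.const 0)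
        (HasDM.const 1)).congr (fun t => ?_) Matrix.fromBlocks_one rfl
      rw [coe_pairHom]
      simp
    have h2 : IsTangent (fun x : S.prod S => pairHom k a x) (Matrix.fromBlocks 0 0 0 (-Dᵀ)) := by
      refine hD.map (fun x => ⟨(1, x), S.one_mem, x.2⟩) ?_
      refine (HasDM.fromBlocks (HasDM.const 1) (HasDM.const 0) (HasDM.const 0)
        (HasDM.base_inv.transpose)).congr (fun t => ?_) (by simp) (by simp)
      rw [coe_pairHom]
      simp
    have := h1.add h2
    simpa [Matrix.fromBlocks_add] using this

end PairTangent

/-! ## Lie algebras of realized subgroups -/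

section LieModels

universe u
variable {k : Type u} [Field k] {β : Type*} [Fintype β] [DecidableEq β] {N : ℕ}

/-- The centralizer of a matrix in a space of matrices. -/
def matCentralizer (l : Submodule k (Matrix β β k)) (x : Matrix β β k) :
    Submodule k (Matrix β β k) :=
  l ⊓ LinearMap.ker
    (LinearMap.mulLeft k x - LinearMap.mulRight k x : Matrix β β k →ₗ[k] Matrix β β k)

lemma mem_matCentralizer {l : Submodule k (Matrix β β k)} {x y : Matrix β β k} :
    y ∈ matCentralizer l x ↔ y ∈ l ∧ x * y = y * x := by
  simp [matCentralizer, sub_eq_zero]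

lemma finrank_map_eq_of_forall_eq_zero {V W : Type*} [AddCommGroup V] [Module k V]
    [AddCommGroup W] [Module k W] (f : V →ₗ[k] W) (p : Submodule k V)
    (h : ∀ x ∈ p, f x = 0 → x = 0) : Module.finrank k (p.map f) = Module.finrank k p := by
  have h1 : Function.Injective (f.domRestrict p) := by
    rw [← LinearMap.ker_eq_bot, LinearMap.ker_eq_bot']
    intro x hx
    exact Subtype.ext (h x x.2 hx)
  rw [← LinearMap.finrank_range_of_inj h1, LinearMap.range_domRestrict]

/-- `δ` identifies the Lie algebra `𝔪` with `𝔩`. -/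
structure IsLieModel {γ : Type*} [Fintype γ] [DecidableEq γ] (𝔪 : Submodule k (Matrix β β k))
    (l : Submodule k (Matrix γ γ k)) (δ : Matrix β β k →ₗ[k] Matrix γ γ k) : Prop where
  mem : ∀ X ∈ 𝔪, δ X ∈ l
  surj : ∀ Z ∈ l, ∃ X ∈ 𝔪, δ X = Z
  inj : ∀ X ∈ 𝔪, δ X = 0 → X = 0
  comm : ∀ X ∈ 𝔪, ∀ Y ∈ 𝔪, δ X * δ Y = δ Y * δ X ↔ X * Y = Y * X

lemma IsLieModel.finrank_centralizer {γ : Type*} [Fintype γ] [DecidableEq γ]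
    {𝔪 : Submodule k (Matrix β β k)} {l : Submodule k (Matrix γ γ k)}
    {δ : Matrix β β k →ₗ[k] Matrix γ γ k} (h : IsLieModel 𝔪 l δ) {X : Matrix β β k}
    (hX : X ∈ 𝔪) :
    Module.finrank k (matCentralizer l (δ X)) = Module.finrank k (matCentralizer 𝔪 X) := by
  rw [← finrank_map_eq_of_forall_eq_zero δ (matCentralizer 𝔪 X)
    (fun Y hY => h.inj Y (mem_matCentralizer.1 hY).1)]
  suffices hs : matCentralizer l (δ X) = (matCentralizer 𝔪 X).map δ by rw [hs]
  ext Z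
  rw [Submodule.mem_map]
  constructor
  · intro hZ
    rw [mem_matCentralizer] at hZ
    obtain ⟨Y, hY, rfl⟩ := h.surj Z hZ.1
    exact ⟨Y, mem_matCentralizer.2 ⟨hY, (h.comm X hX Y hY).1 hZ.2⟩, rfl⟩
  · rintro ⟨Y, hY, rfl⟩
    rw [mem_matCentralizer] at hY
    exact mem_matCentralizer.2 ⟨h.mem Y hY.1, (h.comm X hX Y hY.1).2 hY.2⟩

/-- Nilpotency is required of `δ E` rather than of `E`, since a Lie algebra isomorphism alone does
not preserve nilpotency of matrices. -/
lemma IsLieModel.isNRegular {𝔪 : Submodule k (Matrix β β k)} {L : Subgroup (GL (Fin N) k)}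
    {δ : Matrix β β k →ₗ[k] Matrix (Fin N) (Fin N) k} (h : IsLieModel 𝔪 (lieAlg L) δ)
    {outer : Bool} {g : GL (Fin N) k} {ζ : k} {E : Matrix β β k} (hE : E ∈ 𝔪)
    (hθ : autDiff outer g (δ E) = ζ • δ E) (hnil : IsNilpotent (δ E))
    (hreg : ∀ Y ∈ 𝔪, Module.finrank k (matCentralizer 𝔪 E)
      ≤ Module.finrank k (matCentralizer 𝔪 Y)) : IsNRegular L outer g ζ := by
  refine ⟨δ E, h.mem E hE, hθ, hnil, h.mem E hE, fun Z hZ => ?_⟩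
  obtain ⟨Y, hY, rfl⟩ := h.surj Z hZ
  change Module.finrank k (matCentralizer (lieAlg L) (δ E))
    ≤ Module.finrank k (matCentralizer (lieAlg L) (δ Y))
  rw [h.finrank_centralizer hE, h.finrank_centralizer hY]
  exact hreg Y hY

/-- The pull-back of a Cartan subspace. -/
lemma IsLieModel.exists_pullback {𝔪 : Submodule k (Matrix β β k)} {L : Subgroup (GL (Fin N) k)}
    {δ : Matrix β β k →ₗ[k] Matrix (Fin N) (Fin N) k} (h : IsLieModel 𝔪 (lieAlg L) δ)
    {outer : Bool} {g : GL (Fin N) k} {ζ : k} {G : Subgroup (GL (Fin N) k)}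
    {c : Submodule k (Matrix (Fin N) (Fin N) k)} (hc : IsCartanSubspace G outer g ζ c)
    (hcL : c ≤ lieAlg L) {τ : Matrix β β k → Matrix β β k}
    (hτ : ∀ X ∈ 𝔪, τ X ∈ 𝔪 ∧ autDiff outer g (δ X) = δ (τ X)) :
    ∃ c' ≤ 𝔪, Module.finrank k c' = Module.finrank k c ∧ (∀ X ∈ c', ∀ Y ∈ c', X * Y = Y * X) ∧
      (∀ X ∈ c', τ X = ζ • X) ∧ ∀ X ∈ c', Module.End.IsSemisimple (Matrix.toLin' (δ X)) := by
  obtain ⟨-, hζ, hss, hcomm⟩ := hc.1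
  refine ⟨𝔪 ⊓ c.comap δ, inf_le_left, ?_, ?_, ?_, ?_⟩
  · rw [← finrank_map_eq_of_forall_eq_zero δ (𝔪 ⊓ c.comap δ) (fun Y hY => h.inj Y hY.1)]
    suffices hs : (𝔪 ⊓ c.comap δ).map δ = c by rw [hs]
    ext Z
    rw [Submodule.mem_map]
    constructor
    · rintro ⟨Y, hY, rfl⟩
      exact hY.2
    · intro hZ
      obtain ⟨Y, hY, rfl⟩ := h.surj Z (hcL hZ)
      exact ⟨Y, ⟨hY, hZ⟩, rfl⟩
  · intro X hX Y hY
    exact (h.comm X hX.1 Y hY.1).1 (hcomm _ hX.2 _ hY.2)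
  · intro X hX
    have h1 := (hτ X hX.1).2
    rw [hζ _ hX.2] at h1
    refine sub_eq_zero.1 (h.inj _ (𝔪.sub_mem (hτ X hX.1).1 (𝔪.smul_mem ζ hX.1)) ?_)
    rw [map_sub, map_smul, h1, sub_self]
  · intro X hX
    exact hss _ hX.2

lemma pow_mul_of_mul_eq_one {γ : Type*} [Fintype γ] [DecidableEq γ]
    {P : Matrix γ β k} {Q : Matrix β γ k} (hQP : Q * P = 1) (Y : Matrix β β k) (n : ℕ) :
    (P * Y * Q) ^ n * P = P * Y ^ n := by
  induction n with
  | zero => simp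
  | succ n ih =>
    rw [pow_succ, Matrix.mul_assoc, Matrix.mul_assoc (P * Y), hQP, Matrix.mul_one,
      ← Matrix.mul_assoc, ih, pow_succ, Matrix.mul_assoc]

lemma isNilpotent_standard {γ : Type*} [Fintype γ] [DecidableEq γ]
    {P : Matrix γ β k} {Q : Matrix β γ k} (hQP : Q * P = 1) {Y : Matrix β β k}
    (h : IsNilpotent Y) : IsNilpotent (P * Y * Q) := by
  obtain ⟨n, hn⟩ := h
  refine ⟨n + 1, ?_⟩
  rw [pow_succ, ← Matrix.mul_assoc, ← Matrix.mul_assoc, pow_mul_of_mul_eq_one hQP, hn,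
    Matrix.mul_zero, Matrix.zero_mul, Matrix.zero_mul]

/-- The Lie algebra of a realized subgroup. The group `M` may be represented by any `ρ'` that
defines the same variety structure as `ρ`. -/
theorem IsRealized.exists_isLieModel {H : Type*} [Group H] {β' : Type*} [Fintype β']
    [DecidableEq β'] {ρ : H →* GL β k} {M M₀ : Subgroup H} {σ : H → H} {outer : Bool}
    {g : GL (Fin N) k} {L : Subgroup (GL (Fin N) k)}
    (h : IsRealized ρ M M₀ σ (autHom outer g) L) (ρ' : H →* GL β' k)
    (h₁ : IsRegularWrt (ρ'.comp M.subtype) (ρ.comp M.subtype))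
    (h₂ : IsRegularWrt (ρ.comp M.subtype) (ρ'.comp M.subtype)) (hM : M₀ ≤ M)
    (hσ : ∀ x ∈ M, σ x ∈ M) (τ : Matrix β' β' k → Matrix β' β' k)
    (hτ : ∀ X ∈ tangentSpace (ρ'.comp M.subtype),
      HasDM (fun x : M => ρ' x) X (fun x : M => (ρ' (σ x) : Matrix β' β' k)) 1 (τ X) ∧
      HasDM (fun x : M => ρ' x) X (fun x : M => (((ρ' (σ x))⁻¹ : GL β' k) : Matrix β' β' k)) 1
        (-τ X))
    (π : Matrix β' β' k → Matrix β β k)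
    (hπ : ∀ X, IsTangent (fun x : M₀ => ρ' x) X →
      HasDM (fun x : M₀ => ρ' x) X (fun x : M₀ => (ρ x : Matrix β β k)) 1 (π X)) :
    ∃ (δ : Matrix β' β' k →ₗ[k] Matrix (Fin N) (Fin N) k) (P : Matrix (Fin N) β k)
      (Q : Matrix β (Fin N) k), Q * P = 1 ∧
      IsLieModel (tangentSpace (ρ'.comp M.subtype)) (lieAlg L) δ ∧
      (∀ X ∈ tangentSpace (ρ'.comp M.subtype), τ X ∈ tangentSpace (ρ'.comp M.subtype) ∧
        autDiff outer g (δ X) = δ (τ X)) ∧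
      ∀ X, IsTangent (fun x : M₀ => ρ' x) X → δ X = P * π X * Q := by
  obtain ⟨Φ, hΦ, hΦ', hrange, ⟨P, Q, hQP, hstd⟩, hθ⟩ := h
  obtain ⟨ε, hε⟩ := h₁.exists_isDifferential
  obtain ⟨ε', hε'⟩ := h₂.exists_isDifferential
  -- `ρ` and `ρ'` are regular in each other, hence so are `ρ'` and `Φ`, and there are differentials
  -- in both directions.
  have hr : IsRegularWrt (ρ'.comp M.subtype) Φ := fun i j => hε.trans (hΦ i j)
  obtain ⟨η, hη⟩ := (show IsRegularWrt Φ (ρ.comp M.subtype) from hΦ').exists_isDifferential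
  have hr' : IsRegularWrt Φ (ρ'.comp M.subtype) := fun i j => hη.trans (h₂ i j)
  obtain ⟨δ, hδ⟩ := hr.exists_isDifferential
  obtain ⟨δ', hδ'⟩ := hr'.exists_isDifferential
  have hmem : ∀ Z, Z ∈ lieAlg L ↔ Z ∈ tangentSpace Φ := by
    intro Z
    rw [mem_lieAlg_iff, mem_tangentSpace]
    constructor
    · intro hZ
      refine hZ.mono fun x => ?_
      have : (x : GL (Fin N) k) ∈ Φ.range := hrange.symm ▸ x.2
      exact this
    · intro hZ
      refine hZ.mono fun x => ⟨⟨Φ x, ?_⟩, rfl⟩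
      rw [← hrange]
      exact ⟨x, rfl⟩
  refine ⟨δ, P, Q, hQP, ⟨fun X hX => (hmem _).2 (hδ.isTangent hX), fun Z hZ => ?_,
    fun X hX h0 => ?_, fun X hX Y hY => hδ.commute_iff hδ' hX hY⟩, fun X hX => ?_, fun X hX => ?_⟩
  · have hZ' := (hmem Z).1 hZ
    exact ⟨δ' Z, hδ'.isTangent hZ', hδ'.left_inv hδ hZ'⟩
  · rw [← hδ.left_inv hδ' hX, h0, map_zero]
  · obtain ⟨h3, h4⟩ := hτ X hX
    let s : M → M := fun x => ⟨σ x, hσ x x.2⟩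
    refine ⟨IsTangent.map hX s h3, ?_⟩
    -- Both sides of θ ∘ Φ = Φ ∘ σ are differentiated at `X`.
    have h5 := (hasDM_autHom (outer := outer) g (hδ X) (hδ.inv X)).1
    have h6 := HasDM.comp h3 h4 ((hδ (τ X)).reindex s)
    exact HasDM.unique hX (fun x => by rw [hθ x (s x) rfl]) h5 h6
  · let s : M₀ → M := fun x => ⟨x, hM x.2⟩
    have h5 := (hδ X).reindex s
    -- On `M₀` the embedding is affine in `ρ`, so its differential is that of `ρ` between `P` and
    -- `Q`.
    have h6 := ((HasDM.const (1 : Matrix (Fin N) (Fin N) k)).add (((hπ X hX).add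
      (HasDM.const (-1 : Matrix β β k))).mul_mul P Q))
    refine HasDM.unique hX (fun x => ?_) h5 (h6.congr (fun x => ?_) (Z' := 1) ?_
      (W' := P * π X * Q) ?_) (A := fun x : M₀ => (Φ (s x) : Matrix (Fin N) (Fin N) k))
      (B := fun x : M₀ => 1 + P * ((ρ x : Matrix β β k) - 1) * Q)
    · exact hstd (s x) x.2
    · rw [← sub_eq_add_neg]
    · simp
    · simp

/-- An automorphism of finite order of the realized subgroup. -/
lemma IsRealized.iterate_eq {H : Type*} [Group H] {ρ : H →* GL β k} {M M₀ : Subgroup H}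
    {σ : H → H} {θ : GL (Fin N) k →* GL (Fin N) k} {L : Subgroup (GL (Fin N) k)}
    (h : IsRealized ρ M M₀ σ θ L) (hρ : Function.Injective ρ) (hσ : ∀ x ∈ M, σ x ∈ M) {m : ℕ}
    (hθ : ∀ x ∈ L, θ^[m] x = x) : ∀ x ∈ M, σ^[m] x = x := by
  obtain ⟨Φ, -, hΦ', hrange, -, hσθ⟩ := h
  have hinj : ∀ x y : M, Φ x = Φ y → x = y := by
    intro x y hxy
    refine Subtype.ext (hρ (Units.ext (Matrix.ext fun i j => ?_)))
    obtain ⟨F, hF⟩ := hΦ' i j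
    have h1 := hF x
    simp only [hxy] at h1
    exact h1.trans (hF y).symm
  intro x hx
  have hit : ∀ n : ℕ, ∃ hn : σ^[n] x ∈ M, Φ ⟨σ^[n] x, hn⟩ = θ^[n] (Φ ⟨x, hx⟩) := by
    intro n
    induction n with
    | zero => exact ⟨hx, rfl⟩
    | succ n ih =>
      obtain ⟨hn, e⟩ := ih
      simp only [Function.iterate_succ_apply']
      refine ⟨hσ _ hn, ?_⟩
      rw [← e]
      exact (hσθ _ _ rfl).symm
  obtain ⟨hn, e⟩ := hit m
  rw [hθ _ (hrange ▸ ⟨⟨x, hx⟩, rfl⟩)] at e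
  exact congrArg Subtype.val (hinj _ _ e)

end LieModels

/-! ## Square roots and conjugacy of isometries -/

section SquareRoots

variable {k : Type*} [Field k] {n : Type*} [Fintype n] [DecidableEq n]

/-- An invertible matrix has a square root that is a polynomial in it. -/
lemma exists_aeval_sq_eq [IsAlgClosed k] (h2 : (2 : k) ≠ 0) {S : Matrix n n k} (hS : S.det ≠ 0) :
    ∃ q : Polynomial k, Polynomial.aeval S q * Polynomial.aeval S q = S := by
  classical
  set p := S.charpoly with hp
  have hmonic : p.Monic := S.charpoly_monic
  have hp0 : p ≠ 0 := hmonic.ne_zero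
  have hcoeff : p.coeff 0 ≠ 0 := by
    intro h0
    rw [Matrix.det_eq_sign_charpoly_coeff, ← hp, h0, mul_zero] at hS
    exact hS rfl
  choose sq hsq using fun x : k => IsAlgClosed.exists_pow_nat_eq x (n := 2) (by norm_num)
  -- The interpolant takes each eigenvalue to a square root of it. So `q₀ ^ 2 - X` vanishes at all
  -- eigenvalues and is nilpotent modulo the characteristic polynomial.
  set q₀ := Lagrange.interpolate p.roots.toFinset id sq with hq₀
  have hroot : ∀ x ∈ p.roots, (Polynomial.X - Polynomial.C x) ∣ (q₀ ^ 2 - Polynomial.X) := by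
    intro x hx
    rw [Polynomial.dvd_iff_isRoot, Polynomial.IsRoot.def, Polynomial.eval_sub,
      Polynomial.eval_pow, Polynomial.eval_X]
    have : Polynomial.eval (id x) q₀ = sq x :=
      Lagrange.eval_interpolate_at_node sq (Function.injective_id.injOn)
        (Multiset.mem_toFinset.2 hx)
    rw [id] at this
    rw [this, hsq, sub_self]
  have hdvd : p ∣ (q₀ ^ 2 - Polynomial.X) ^ p.roots.card := by
    have h1 : (p.roots.map fun x => Polynomial.X - Polynomial.C x).prod = p :=
      ((IsAlgClosed.splits p).eq_prod_roots_of_monic hmonic).symm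
    rw [← Multiset.prod_replicate, ← Multiset.map_const']
    conv_lhs => rw [← h1]
    exact Multiset.prod_dvd_prod_of_dvd _ _ hroot
  set mk := AdjoinRoot.mk p
  have hnil : IsNilpotent (mk (q₀ ^ 2 - Polynomial.X)) := by
    refine ⟨p.roots.card, ?_⟩
    rw [← map_pow]
    exact AdjoinRoot.mk_eq_zero.2 hdvd
  have hXunit : IsUnit (mk Polynomial.X) := by
    have h1 := Polynomial.divX_mul_X_add p
    have h3 : mk p.divX * mk Polynomial.X + mk (Polynomial.C (p.coeff 0)) = 0 := by
      rw [← map_mul, ← map_add, h1]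
      exact AdjoinRoot.mk_self
    have h4 : IsUnit (mk (Polynomial.C (p.coeff 0))) :=
      ((isUnit_iff_ne_zero.2 hcoeff).map Polynomial.C).map mk
    have h5 : mk p.divX * mk Polynomial.X = -mk (Polynomial.C (p.coeff 0)) :=
      eq_neg_of_add_eq_zero_left h3
    exact isUnit_of_mul_isUnit_right (h5 ▸ h4.neg)
  have hsqunit : IsUnit (mk q₀) := by
    have h1 : mk q₀ ^ 2 = mk Polynomial.X + mk (q₀ ^ 2 - Polynomial.X) := by
      rw [← map_add, ← map_pow]
      congr 1
      ring
    have h3 : IsUnit (mk q₀ ^ 2) := by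
      rw [h1]
      exact hnil.isUnit_add_left_of_commute hXunit (Commute.all _ _)
    exact (isUnit_pow_iff (by norm_num)).1 h3
  have h2unit : IsUnit (2 : AdjoinRoot p) := by
    have h3 := ((isUnit_iff_ne_zero.2 h2).map Polynomial.C).map mk
    rwa [map_ofNat, map_ofNat] at h3
  set P : Polynomial (AdjoinRoot p) := Polynomial.X ^ 2 - Polynomial.C (mk Polynomial.X) with hP
  have hPe : ∀ r : AdjoinRoot p, Polynomial.aeval r P = r ^ 2 - mk Polynomial.X := by
    intro r
    rw [hP, map_sub, map_pow, Polynomial.aeval_X, Polynomial.aeval_C]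
    rfl
  have hPd : ∀ r : AdjoinRoot p, Polynomial.aeval r (Polynomial.derivative P) = 2 * r := by
    intro r
    rw [hP, Polynomial.derivative_sub, Polynomial.derivative_C, sub_zero,
      Polynomial.derivative_X_pow]
    simp
  -- Newton iteration in `k[X]/p` improves `q₀` to an exact root of `Y² - X`; the derivative `2 q₀`
  -- is a unit since `2` and `X` are, the latter because `p` has nonzero constant term.
  have hN := Polynomial.existsUnique_nilpotent_sub_and_aeval_eq_zero (P := P) (x := mk q₀)
    (by rw [hPe, ← map_pow, ← map_sub]; exact hnil) (by rw [hPd]; exact h2unit.mul hsqunit)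
  obtain ⟨r, ⟨-, hr⟩, -⟩ := hN
  obtain ⟨q, rfl⟩ := AdjoinRoot.mk_surjective r
  have h6 : p ∣ q ^ 2 - Polynomial.X := by
    rw [← AdjoinRoot.mk_eq_zero, map_sub, map_pow]
    exact (hPe _).symm.trans hr
  refine ⟨q, ?_⟩
  obtain ⟨w, hw⟩ := h6
  have h7 := congrArg (Polynomial.aeval S) hw
  rw [map_mul, hp, Matrix.aeval_self_charpoly, zero_mul, map_sub, map_pow, Polynomial.aeval_X,
    sub_eq_zero, pow_two] at h7
  exact h7

lemma aeval_mul_eq_mul_aeval {A B M : Matrix n n k} (h : A * M = M * B) (q : Polynomial k) :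
    Polynomial.aeval A q * M = M * Polynomial.aeval B q := by
  have hn : ∀ j : ℕ, A ^ j * M = M * B ^ j := by
    intro j
    induction j with
    | zero => simp
    | succ j ih => rw [pow_succ, mul_assoc, h, ← mul_assoc, ih, mul_assoc, ← pow_succ]
  induction q using Polynomial.induction_on' with
  | add p q hp hq => simp only [map_add, add_mul, mul_add, hp, hq]
  | monomial j c =>
    rw [Polynomial.aeval_monomial, Polynomial.aeval_monomial, ← Algebra.smul_def,
      ← Algebra.smul_def, Matrix.mul_smul, Matrix.smul_mul, hn]

lemma aeval_transpose (A : Matrix n n k) (q : Polynomial k) :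
    (Polynomial.aeval A q)ᵀ = Polynomial.aeval Aᵀ q := by
  induction q using Polynomial.induction_on' with
  | add p q hp hq => simp only [map_add, Matrix.transpose_add, hp, hq]
  | monomial j c =>
    rw [Polynomial.aeval_monomial, Polynomial.aeval_monomial, ← Algebra.smul_def,
      ← Algebra.smul_def, Matrix.transpose_smul, Matrix.transpose_pow]

/-- Isometries of `ε`-symmetric forms that are conjugate are conjugate by an isometry. -/
lemma exists_isometry_conj [IsAlgClosed k] (h2 : (2 : k) ≠ 0) (ε : k)
    {B₀ B h₀ h x : Matrix n n k} (hB₀ : B₀ᵀ = ε • B₀) (hB : Bᵀ = ε • B) (hB₀d : B₀.det ≠ 0)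
    (hBd : B.det ≠ 0) (hh₀ : h₀ᵀ * B₀ * h₀ = B₀) (hh : hᵀ * B * h = B) (hx : x.det ≠ 0)
    (hc : h * x = x * h₀) : ∃ y : Matrix n n k, y.det ≠ 0 ∧ yᵀ * B * y = B₀ ∧ h * y = y * h₀ := by
  have hu : IsUnit B₀.det := isUnit_iff_ne_zero.2 hB₀d
  set B₁ := xᵀ * B * x with hB₁
  have hB₁d : B₁.det ≠ 0 := by
    rw [hB₁, Matrix.det_mul, Matrix.det_mul, Matrix.det_transpose]
    exact mul_ne_zero (mul_ne_zero hx hBd) hx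
  have hB₁t : B₁ᵀ = ε • B₁ := by
    rw [hB₁, Matrix.transpose_mul, Matrix.transpose_mul, Matrix.transpose_transpose, hB]
    simp [Matrix.mul_assoc]
  have hh₁ : h₀ᵀ * B₁ * h₀ = B₁ := by
    calc h₀ᵀ * B₁ * h₀ = (x * h₀)ᵀ * B * (x * h₀) := by
          rw [hB₁, Matrix.transpose_mul]
          simp only [Matrix.mul_assoc]
      _ = xᵀ * (hᵀ * B * h) * x := by
          rw [← hc, Matrix.transpose_mul]
          simp only [Matrix.mul_assoc]
      _ = B₁ := by rw [hh]
  -- `s` compares the pulled-back form with `B₀`. It is self-adjoint for `B₀` and commutes with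
  -- `h₀`; a square root `t` that is a polynomial in `s` inherits both properties, and `x * t⁻¹` is
  -- the corrected conjugation.
  set s := B₀⁻¹ * B₁ with hs
  have hB₀s : B₀ * s = B₁ := by rw [hs, Matrix.mul_nonsing_inv_cancel_left _ _ hu]
  have hsd : s.det ≠ 0 := by
    intro h0
    apply hB₁d
    rw [← hB₀s, Matrix.det_mul, h0, mul_zero]
  have hst : sᵀ * B₀ = B₀ * s := by
    have h3 := congrArg Matrix.transpose hB₀s
    rw [Matrix.transpose_mul, hB₀, hB₁t, Matrix.mul_smul] at h3
    -- A nondegenerate form excludes `ε = 0` unless the matrices are empty.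
    have hε : ε ≠ 0 ∨ IsEmpty n := by
      by_contra! hcon
      obtain ⟨hε, hne⟩ := hcon
      rw [hε, zero_smul] at hB₀
      apply hB₀d
      rw [← Matrix.det_transpose, hB₀, Matrix.det_zero]
    rcases hε with hε | hε
    · rw [hB₀s]
      exact smul_right_injective _ hε h3
    · exact Subsingleton.elim _ _
  have hh₀d : h₀.det ≠ 0 := by
    intro h0
    apply hB₀d
    rw [← hh₀, Matrix.det_mul, h0, mul_zero]
  have hsh : s * h₀ = h₀ * s := by
    have hinj : IsUnit (h₀ᵀ * B₀).det := by
      rw [Matrix.det_mul, Matrix.det_transpose]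
      exact isUnit_iff_ne_zero.2 (mul_ne_zero hh₀d hB₀d)
    have : (h₀ᵀ * B₀) * (s * h₀) = (h₀ᵀ * B₀) * (h₀ * s) := by
      calc (h₀ᵀ * B₀) * (s * h₀) = h₀ᵀ * (B₀ * s) * h₀ := by simp only [Matrix.mul_assoc]
        _ = B₀ * s := by rw [hB₀s, hh₁]
        _ = (h₀ᵀ * B₀ * h₀) * s := by rw [hh₀]
        _ = _ := by simp only [Matrix.mul_assoc]
    have h3 := congrArg (fun M => (h₀ᵀ * B₀)⁻¹ * M) this
    simpa only [Matrix.nonsing_inv_mul_cancel_left _ _ hinj] using h3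
  obtain ⟨q, hq⟩ := exists_aeval_sq_eq h2 hsd
  set t := Polynomial.aeval s q with ht
  have htd : IsUnit t.det := by
    refine isUnit_iff_ne_zero.2 fun h0 => hsd ?_
    rw [← hq, Matrix.det_mul, h0, mul_zero]
  have htB : tᵀ * B₀ = B₀ * t := by rw [ht, aeval_transpose, aeval_mul_eq_mul_aeval hst]
  have hth : t * h₀ = h₀ * t := aeval_mul_eq_mul_aeval hsh q
  have htt : tᵀ * B₀ * t = B₁ := by rw [htB, Matrix.mul_assoc, hq, hB₀s]
  refine ⟨x * t⁻¹, ?_, ?_, ?_⟩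
  · rw [Matrix.det_mul, Matrix.det_nonsing_inv]
    refine mul_ne_zero hx ?_
    rw [Ring.inverse_eq_inv']
    exact inv_ne_zero htd.ne_zero
  · have htt' : (t⁻¹)ᵀ * tᵀ = 1 := by
      rw [← Matrix.transpose_mul, Matrix.mul_nonsing_inv _ htd, Matrix.transpose_one]
    calc (x * t⁻¹)ᵀ * B * (x * t⁻¹) = (t⁻¹)ᵀ * B₁ * t⁻¹ := by
          rw [Matrix.transpose_mul, hB₁]
          simp only [Matrix.mul_assoc]
      _ = ((t⁻¹)ᵀ * tᵀ) * B₀ * (t * t⁻¹) := by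
          rw [← htt]
          simp only [Matrix.mul_assoc]
      _ = B₀ := by rw [htt', Matrix.mul_nonsing_inv _ htd, one_mul, mul_one]
  · have h3 : h₀ * t⁻¹ = t⁻¹ * h₀ := by
      calc h₀ * t⁻¹ = t⁻¹ * (t * h₀) * t⁻¹ := by
            rw [Matrix.nonsing_inv_mul_cancel_left _ _ htd]
        _ = t⁻¹ * h₀ * (t * t⁻¹) := by
            rw [hth]
            simp only [Matrix.mul_assoc]
        _ = t⁻¹ * h₀ := by rw [Matrix.mul_nonsing_inv _ htd, mul_one]
    rw [← Matrix.mul_assoc, hc, Matrix.mul_assoc, h3, Matrix.mul_assoc]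

/-- Nondegenerate bilinear forms with conjugate asymmetries are congruent. -/
lemma exists_congruence [IsAlgClosed k] (h2 : (2 : k) ≠ 0) {h₀ h u₀ u x : Matrix n n k}
    (hh₀ : h₀.det ≠ 0) (hh : h.det ≠ 0) (hu₀ : h₀ = u₀ * h₀ᵀ) (hu : h = u * hᵀ) (hx : x.det ≠ 0)
    (hc : u * x = x * u₀) : ∃ y : Matrix n n k, y.det ≠ 0 ∧ y * h₀ * yᵀ = h := by
  have hxu : IsUnit x.det := isUnit_iff_ne_zero.2 hx
  have hxtu : IsUnit xᵀ.det := by rwa [Matrix.det_transpose]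
  have hh₀u : IsUnit h₀.det := isUnit_iff_ne_zero.2 hh₀
  have hh₀tu : IsUnit h₀ᵀ.det := by rwa [Matrix.det_transpose]
  set h₁ := x⁻¹ * h * (x⁻¹)ᵀ with hh₁
  have hxx : (x⁻¹)ᵀ * xᵀ = 1 := by
    rw [← Matrix.transpose_mul, Matrix.mul_nonsing_inv _ hxu, Matrix.transpose_one]
  have hxh : x * h₁ * xᵀ = h := by
    calc x * h₁ * xᵀ = (x * x⁻¹) * h * ((x⁻¹)ᵀ * xᵀ) := by
          rw [hh₁]
          simp only [Matrix.mul_assoc]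
      _ = h := by rw [hxx, Matrix.mul_nonsing_inv _ hxu, one_mul, mul_one]
  have hc' : x⁻¹ * u = u₀ * x⁻¹ := by
    calc x⁻¹ * u = x⁻¹ * (u * x) * x⁻¹ := by
          rw [Matrix.mul_assoc, Matrix.mul_assoc, Matrix.mul_nonsing_inv _ hxu, mul_one]
      _ = u₀ * x⁻¹ := by rw [hc, Matrix.nonsing_inv_mul_cancel_left _ _ hxu]
  have hu₁ : h₁ = u₀ * h₁ᵀ := by
    calc h₁ = x⁻¹ * (u * hᵀ) * (x⁻¹)ᵀ := by rw [← hu]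
      _ = (x⁻¹ * u) * hᵀ * (x⁻¹)ᵀ := by simp only [Matrix.mul_assoc]
      _ = u₀ * h₁ᵀ := by
        rw [hc', hh₁, Matrix.transpose_mul, Matrix.transpose_mul, Matrix.transpose_transpose]
        simp only [Matrix.mul_assoc]
  -- After conjugation by `x` both forms have the same asymmetry `u₀`, which amounts to `s * h₀ = h₀
  -- * sᵀ`. For a polynomial square root `t` of `s` this gives `t * h₀ * tᵀ = s * h₀ = h₁`.
  set s := h₁ * h₀⁻¹ with hs
  have hsh : s * h₀ = h₁ := Matrix.nonsing_inv_mul_cancel_right _ _ hh₀u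
  have hst : s * h₀ = h₀ * sᵀ := by
    rw [hsh, hs, Matrix.transpose_mul, Matrix.transpose_nonsing_inv]
    conv_rhs => rw [hu₀]
    rw [← Matrix.mul_assoc, Matrix.mul_assoc u₀, ← hu₀, Matrix.mul_nonsing_inv _ hh₀tu,
      mul_one, ← hu₁]
  have hsd : s.det ≠ 0 := by
    intro h0
    apply hh
    rw [← hxh, ← hsh]
    simp [Matrix.det_mul, h0]
  obtain ⟨q, hq⟩ := exists_aeval_sq_eq h2 hsd
  set t := Polynomial.aeval s q with ht
  have htt : t * h₀ * tᵀ = h₁ := by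
    rw [ht, aeval_transpose, Matrix.mul_assoc, ← aeval_mul_eq_mul_aeval hst, ← Matrix.mul_assoc,
      hq, hsh]
  refine ⟨x * t, ?_, ?_⟩
  · rw [Matrix.det_mul]
    refine mul_ne_zero hx fun h0 => hsd ?_
    rw [← hq, Matrix.det_mul, h0, mul_zero]
  · calc x * t * h₀ * (x * t)ᵀ = x * (t * h₀ * tᵀ) * xᵀ := by
          rw [Matrix.transpose_mul]
          simp only [Matrix.mul_assoc]
      _ = h := by rw [htt, hxh]

end SquareRoots

/-! ## Weights of commuting semisimple families -/

section Weights

variable {k : Type*} [Field k] {n : Type*} [Fintype n] [DecidableEq n]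

/-- The simultaneous eigenspace of a family of matrices. -/
def weightSpace {ι : Type*} (f : ι → Matrix n n k) (χ : ι → k) : Submodule k (n → k) where
  carrier := {v | ∀ i, f i *ᵥ v = χ i • v}
  add_mem' := by
    intro v w hv hw i
    rw [Matrix.mulVec_add, hv i, hw i, smul_add]
  zero_mem' := by
    intro i
    simp
  smul_mem' := by
    intro a v hv i
    rw [Matrix.mulVec_smul, hv i, smul_comm]

lemma mem_weightSpace {ι : Type*} {f : ι → Matrix n n k} {χ : ι → k} {v : n → k} :
    v ∈ weightSpace f χ ↔ ∀ i, f i *ᵥ v = χ i • v := Iff.rfl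

/-- Semisimplicity makes eigenspaces equal to generalized eigenspaces, whose simultaneous versions
are independent and span for a commuting family. -/
lemma weightSpace_eq {ι : Type*} (f : ι → Matrix n n k)
    (hss : ∀ i, Module.End.IsSemisimple (Matrix.toLin' (f i))) (χ : ι → k) :
    weightSpace f χ = ⨅ i, Module.End.maxGenEigenspace (Matrix.toLin' (f i)) (χ i) := by
  ext v
  rw [Submodule.mem_iInf, mem_weightSpace]
  refine forall_congr' fun i => ?_
  rw [(hss i).isFinitelySemisimple.maxGenEigenspace_eq_eigenspace, Module.End.mem_eigenspace_iff,
    Matrix.toLin'_apply]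

lemma iSup_weightSpace [IsAlgClosed k] {ι : Type*} (f : ι → Matrix n n k)
    (hss : ∀ i, Module.End.IsSemisimple (Matrix.toLin' (f i)))
    (hcomm : ∀ i j, f i * f j = f j * f i) : ⨆ χ, weightSpace f χ = ⊤ := by
  simp only [weightSpace_eq f hss]
  refine Module.End.iSup_iInf_maxGenEigenspace_eq_top_of_iSup_maxGenEigenspace_eq_top_of_commute
    (fun i => Matrix.toLin' (f i)) (fun i j _ => ?_) fun i =>
      Module.End.iSup_maxGenEigenspace_eq_top _
  change Matrix.toLin' (f i) * Matrix.toLin' (f j) = Matrix.toLin' (f j) * Matrix.toLin' (f i)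
  rw [Module.End.mul_eq_comp, Module.End.mul_eq_comp, ← Matrix.toLin'_mul, ← Matrix.toLin'_mul,
    hcomm]

lemma iSupIndep_weightSpace {ι : Type*} (f : ι → Matrix n n k)
    (hss : ∀ i, Module.End.IsSemisimple (Matrix.toLin' (f i)))
    (hcomm : ∀ i j, f i * f j = f j * f i) : iSupIndep (weightSpace f) := by
  have : weightSpace f = fun χ => ⨅ i, Module.End.maxGenEigenspace (Matrix.toLin' (f i)) (χ i) :=
    funext (weightSpace_eq f hss)
  rw [this]
  refine Module.End.independent_iInf_maxGenEigenspace_of_forall_mapsTo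
    (fun i => Matrix.toLin' (f i)) (fun i j φ => ?_)
  refine Module.End.mapsTo_maxGenEigenspace_of_comm ?_ φ
  change Matrix.toLin' (f j) * Matrix.toLin' (f i) = Matrix.toLin' (f i) * Matrix.toLin' (f j)
  rw [Module.End.mul_eq_comp, Module.End.mul_eq_comp, ← Matrix.toLin'_mul, ← Matrix.toLin'_mul,
    hcomm]

/-- A commuting family of `r` linearly independent semisimple matrices has `r` linearly
independent weights. -/
lemma exists_independent_weights [IsAlgClosed k] {r : ℕ} (f : Fin r → Matrix n n k)
    (hss : ∀ i, Module.End.IsSemisimple (Matrix.toLin' (f i)))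
    (hcomm : ∀ i j, f i * f j = f j * f i) (hli : LinearIndependent k f) :
    ∃ (χ : Fin r → Fin r → k) (v : Fin r → n → k), LinearIndependent k χ ∧
      ∀ i, v i ≠ 0 ∧ v i ∈ weightSpace f (χ i) := by
  set S : Set (Fin r → k) := {χ | weightSpace f χ ≠ ⊥} with hS
  have hspan : Submodule.span k S = ⊤ := by
    -- If the weights spanned a proper subspace, a nonzero functional `φ` would kill them all. The
    -- combination of the `f i` with coefficients `φ(e_i)` would then act by zero on every weight
    -- space, against linear independence.
    by_contra hne
    obtain ⟨φ, hφ0, hφ⟩ := Submodule.exists_le_ker_of_lt_top _ (lt_top_iff_ne_top.2 hne)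
    have hφa : ∀ χ : Fin r → k, φ χ = ∑ i, χ i * φ (Pi.single i 1) := by
      intro χ
      conv_lhs => rw [pi_eq_sum_univ χ]
      rw [map_sum]
      refine Finset.sum_congr rfl fun i _ => ?_
      rw [map_smul, smul_eq_mul]
      congr 2
      ext j
      simp [Pi.single_apply, eq_comm]
    have hzero : ∑ i, φ (Pi.single i 1) • f i = 0 := by
      have hker : (⊤ : Submodule k (n → k)) ≤
          LinearMap.ker (Matrix.toLin' (∑ i, φ (Pi.single i 1) • f i)) := by
        rw [← iSup_weightSpace f hss hcomm]
        refine iSup_le fun χ v hv => ?_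
        rw [LinearMap.mem_ker, Matrix.toLin'_apply, Matrix.sum_mulVec]
        by_cases hχ : weightSpace f χ = ⊥
        · rw [hχ, Submodule.mem_bot] at hv
          simp [hv]
        · have h1 : φ χ = 0 := hφ (Submodule.subset_span hχ)
          have h2 : ∀ i, (φ (Pi.single i 1) • f i) *ᵥ v = (χ i * φ (Pi.single i 1)) • v := by
            intro i
            rw [Matrix.smul_mulVec, hv i, smul_smul, mul_comm]
          rw [Finset.sum_congr rfl fun i _ => h2 i, ← Finset.sum_smul, ← hφa, h1, zero_smul]
      have := LinearMap.ker_eq_top.1 (top_le_iff.1 hker)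
      exact (Matrix.toLin' (R := k)).map_eq_zero_iff.1 this
    have h3 := Fintype.linearIndependent_iff.1 hli _ hzero
    exact hφ0 (LinearMap.ext fun χ => by rw [hφa]; simp [h3])
  obtain ⟨b, hbS, hbspan, hbli⟩ := exists_linearIndependent k S
  rw [hspan] at hbspan
  let B := Module.Basis.mk hbli (by rw [Subtype.range_coe]; exact hbspan.ge)
  have : Fintype b := FiniteDimensional.fintypeBasisIndex B
  have hcard : Fintype.card b = r := by
    rw [← Module.finrank_eq_card_basis B, Module.finrank_fin_fun]
  let e : Fin r ≃ b := (Fintype.equivFinOfCardEq hcard).symm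
  have hex : ∀ i, ∃ v ∈ weightSpace f (e i : Fin r → k), v ≠ 0 := fun i =>
    Submodule.exists_mem_ne_zero_of_ne_bot (hbS (e i).2)
  choose v hv hv0 using hex
  exact ⟨fun i => e i, v, hbli.comp e e.injective, fun i => ⟨hv0 i, hv i⟩⟩

/-- Weights of matrices that are skew for a nondegenerate form come in pairs. -/
lemma exists_neg_weight [IsAlgClosed k] {r : ℕ} (f : Fin r → Matrix n n k)
    (hss : ∀ i, Module.End.IsSemisimple (Matrix.toLin' (f i)))
    (hcomm : ∀ i j, f i * f j = f j * f i) {B : Matrix n n k} (hB : B.det ≠ 0)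
    (hskew : ∀ i, (f i)ᵀ * B + B * f i = 0) {χ : Fin r → k} {v : n → k} (hv0 : v ≠ 0)
    (hv : v ∈ weightSpace f χ) : ∃ w, w ≠ 0 ∧ w ∈ weightSpace f (-χ) := by
  by_contra! hcon
  apply hv0
  -- By skewness, weight spaces are orthogonal unless their weights are opposite. If `-χ` is not a
  -- weight, `v` is orthogonal to everything.
  have hker : (⊤ : Submodule k (n → k)) ≤ LinearMap.ker (dotProductBilin k k (v ᵥ* B)) := by
    rw [← iSup_weightSpace f hss hcomm]
    refine iSup_le fun ψ w hw => ?_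
    rw [LinearMap.mem_ker]
    change (v ᵥ* B) ⬝ᵥ w = 0
    by_cases hψ : ψ = -χ
    · subst hψ
      by_cases hw0 : w = 0
      · rw [hw0, dotProduct_zero]
      · exact absurd hw (hcon w hw0)
    · obtain ⟨i, hi⟩ := Function.ne_iff.1 hψ
      have h1 : (v ᵥ* ((f i)ᵀ * B + B * f i)) ⬝ᵥ w = 0 := by rw [hskew]; simp
      rw [Matrix.vecMul_add, ← Matrix.vecMul_vecMul, ← Matrix.vecMul_vecMul,
        Matrix.vecMul_transpose, hv i, add_dotProduct, ← Matrix.dotProduct_mulVec (v ᵥ* B), hw i,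
        Matrix.smul_vecMul, smul_dotProduct, dotProduct_smul, ← add_smul] at h1
      refine (smul_eq_zero.1 h1).resolve_left fun h2 => hi ?_
      rw [Pi.neg_apply]
      exact eq_neg_of_add_eq_zero_right h2
  have h0 : v ᵥ* B = 0 := by
    refine dotProduct_eq_zero _ fun w => ?_
    exact hker (Submodule.mem_top (x := w))
  exact Matrix.eq_zero_of_vecMul_eq_zero hB h0

end Weights

/-! ## Cyclic families and diagonalization -/

section Cyclic

variable {k : Type*} [Field k] {n : Type*} [Fintype n] [DecidableEq n]

/-- The relation `h * f i = ζ • (f i * h)` says that `h` multiplies weights by `ζ⁻¹`. -/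
lemma pow_mulVec_mem_weightSpace {ι : Type*} {f : ι → Matrix n n k} {h : Matrix n n k} {ζ : k}
    (hζ : ζ ≠ 0) (hf : ∀ i, h * f i = ζ • (f i * h)) {χ : ι → k} {v : n → k}
    (hv : v ∈ weightSpace f χ) (s : ℕ) : h ^ s *ᵥ v ∈ weightSpace f (ζ⁻¹ ^ s • χ) := by
  induction s with
  | zero => simpa using hv
  | succ s ih =>
    intro i
    have h1 : f i * h = ζ⁻¹ • (h * f i) := by rw [hf, smul_smul, inv_mul_cancel₀ hζ, one_smul]
    rw [pow_succ', ← Matrix.mulVec_mulVec, Matrix.mulVec_mulVec, h1, Matrix.smul_mulVec,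
      ← Matrix.mulVec_mulVec, ih i, Matrix.mulVec_smul, smul_smul]
    congr 1
    simp only [Pi.smul_apply, smul_eq_mul]
    ring

/-- Translates of weight vectors by an operator that scales the family. -/
lemma linearIndependent_pow_mulVec {r m : ℕ} {f : Fin r → Matrix n n k}
    (hss : ∀ i, Module.End.IsSemisimple (Matrix.toLin' (f i)))
    (hcomm : ∀ i j, f i * f j = f j * f i) {h : Matrix n n k} (hh : h.det ≠ 0) {ζ : k}
    (hζ : ζ ≠ 0) (hf : ∀ i, h * f i = ζ • (f i * h)) {κ : Type*} {ψ : κ → Fin r → k}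
    {v : κ → n → k} (hv0 : ∀ p, v p ≠ 0) (hv : ∀ p, v p ∈ weightSpace f (ψ p))
    (hψ : ∀ (p q : κ) (s t : Fin m), ζ⁻¹ ^ (s : ℕ) • ψ p = ζ⁻¹ ^ (t : ℕ) • ψ q → p = q ∧ s = t) :
    LinearIndependent k (fun p : κ × Fin m => h ^ (p.2 : ℕ) *ᵥ v p.1) := by
  have hinj : Function.Injective (fun p : κ × Fin m => ζ⁻¹ ^ (p.2 : ℕ) • ψ p.1) := by
    rintro ⟨p, s⟩ ⟨q, t⟩ hpq
    obtain ⟨rfl, rfl⟩ := hψ p q s t hpq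
    rfl
  refine ((iSupIndep_weightSpace f hss hcomm).comp hinj).linearIndependent _
    (fun p => pow_mulVec_mem_weightSpace hζ hf (hv p.1) p.2) fun p h0 => hv0 p.1 ?_
  refine Matrix.eq_zero_of_mulVec_eq_zero (M := h ^ (p.2 : ℕ)) ?_ h0
  rw [Matrix.det_pow]
  exact pow_ne_zero _ hh

lemma LinearIndependent.eq_and_eq_of_smul_eq_smul {ι V : Type*} [Fintype ι] [DecidableEq ι]
    [AddCommGroup V] [Module k V] {χ : ι → V} (hχ : LinearIndependent k χ) {i j : ι} {a b : k}
    (ha : a ≠ 0) (h : a • χ i = b • χ j) : i = j ∧ a = b := by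
  have h1 := Fintype.linearIndependent_iff.1 hχ (Pi.single i a - Pi.single j b) (by
    simp [sub_smul, Pi.single_apply, ite_smul, h])
  have h2 := h1 i
  by_cases hij : i = j
  · subst hij
    refine ⟨rfl, ?_⟩
    simpa [sub_eq_zero] using h2
  · simp [hij, ha] at h2

/-- For linearly independent `χ i` the weights `ζ⁻¹ ^ s • χ i` with `s < m` are pairwise distinct,
and vectors of distinct weights are independent. -/
lemma exists_cyclic_family [IsAlgClosed k] {r m : ℕ} {f : Fin r → Matrix n n k}
    (hss : ∀ i, Module.End.IsSemisimple (Matrix.toLin' (f i)))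
    (hcomm : ∀ i j, f i * f j = f j * f i) (hli : LinearIndependent k f) {h : Matrix n n k}
    (hh : h.det ≠ 0) {ζ : k} (hm : 0 < m) (hζ : IsPrimitiveRoot ζ m)
    (hf : ∀ i, h * f i = ζ • (f i * h)) :
    ∃ v : Fin r → n → k,
      LinearIndependent k (fun p : Fin r × Fin m => h ^ (p.2 : ℕ) *ᵥ v p.1) := by
  have hζ0 : ζ ≠ 0 := hζ.ne_zero hm.ne'
  obtain ⟨χ, v, hχ, hv⟩ := exists_independent_weights f hss hcomm hli
  refine ⟨v, linearIndependent_pow_mulVec hss hcomm hh hζ0 hf (fun p => (hv p).1)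
    (fun p => (hv p).2) fun p q s t hst => ?_⟩
  obtain ⟨rfl, h1⟩ := hχ.eq_and_eq_of_smul_eq_smul (pow_ne_zero _ (inv_ne_zero hζ0)) hst
  exact ⟨rfl, Fin.ext (hζ.inv.pow_inj s.2 t.2 h1)⟩

/-- For odd `m` the number -1 is not a power of `ζ`, so the opposite weights given by skewness lie
in new orbits under `ζ` and the number of cycles doubles. -/
lemma exists_cyclic_family_of_skew [IsAlgClosed k] (h2 : (2 : k) ≠ 0) {r m : ℕ}
    {f : Fin r → Matrix n n k}
    (hss : ∀ i, Module.End.IsSemisimple (Matrix.toLin' (f i)))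
    (hcomm : ∀ i j, f i * f j = f j * f i) (hli : LinearIndependent k f) {h : Matrix n n k}
    (hh : h.det ≠ 0) {ζ : k} (hm : Odd m) (hζ : IsPrimitiveRoot ζ m)
    (hf : ∀ i, h * f i = ζ • (f i * h)) {B : Matrix n n k} (hB : B.det ≠ 0)
    (hskew : ∀ i, (f i)ᵀ * B + B * f i = 0) :
    ∃ v : Fin (2 * r) → n → k,
      LinearIndependent k (fun p : Fin (2 * r) × Fin m => h ^ (p.2 : ℕ) *ᵥ v p.1) := by
  have hζ0 : ζ ≠ 0 := hζ.ne_zero hm.pos.ne'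
  obtain ⟨χ, v, hχ, hv⟩ := exists_independent_weights f hss hcomm hli
  choose w hw0 hw using fun i => exists_neg_weight f hss hcomm hB hskew (hv i).1 (hv i).2
  let sg : Fin 2 → k := ![1, -1]
  have hsg0 : ∀ b, sg b ≠ 0 := by
    intro b
    fin_cases b <;> simp [sg]
  have hne : (1 : k) ≠ -1 := fun h => h2 (by linear_combination h)
  let u : Fin 2 × Fin r → n → k := fun p => if p.1 = 0 then v p.2 else w p.2
  let ψ : Fin 2 × Fin r → Fin r → k := fun p => sg p.1 • χ p.2
  have hu : ∀ p, u p ≠ 0 ∧ u p ∈ weightSpace f (ψ p) := by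
    rintro ⟨b, i⟩
    fin_cases b
    · simpa [u, ψ, sg] using hv i
    · simpa [u, ψ, sg] using ⟨hw0 i, hw i⟩
  have hpow : ∀ s : ℕ, (ζ⁻¹ ^ s) ^ m = 1 := fun s => by
    rw [← pow_mul, mul_comm, pow_mul, hζ.inv.pow_eq_one, one_pow]
  have hmain := linearIndependent_pow_mulVec (m := m) hss hcomm hh hζ0 hf
    (fun p => (hu p).1) (fun p => (hu p).2) (fun p q s t hst => by
      obtain ⟨b, i⟩ := p
      obtain ⟨b', j⟩ := q
      simp only [ψ, smul_smul] at hst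
      obtain ⟨rfl, h1⟩ := hχ.eq_and_eq_of_smul_eq_smul
        (mul_ne_zero (pow_ne_zero _ (inv_ne_zero hζ0)) (hsg0 b)) hst
      -- Raising to the odd power `m` removes the powers of `ζ` and keeps the signs.
      have h3 : sg b = sg b' := by
        have h4 := congrArg (· ^ m) h1
        simp only [mul_pow, hpow, one_mul] at h4
        fin_cases b <;> fin_cases b' <;> simp [sg, hm.neg_one_pow] at h4 ⊢
        · exact h4
        · exact h4
      have h5 : b = b' := by
        fin_cases b <;> fin_cases b' <;> simp [sg] at h3 ⊢
        · exact hne h3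
        · exact hne h3.symm
      subst h5
      exact ⟨rfl, Fin.ext (hζ.inv.pow_inj s.2 t.2 (mul_right_cancel₀ (hsg0 b) h1))⟩)
  refine ⟨fun i => u (finProdFinEquiv.symm i), ?_⟩
  exact hmain.comp (fun p : Fin (2 * r) × Fin m => (finProdFinEquiv.symm p.1, p.2))
    (fun p q hpq => by
      simp only [Prod.mk.injEq] at hpq
      exact Prod.ext (finProdFinEquiv.symm.injective hpq.1) hpq.2)

/-- The eigenvector with eigenvalue `α` in a cyclic orbit. -/
noncomputable def orbitEigenvector (h : Matrix n n k) (m : ℕ) (α : k) (v : n → k) : n → k :=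
  ∑ j ∈ Finset.range m, α⁻¹ ^ j • (h ^ j *ᵥ v)

/-- Applying `h` shifts the index of summation and releases a factor `α`; the term at `m` closes up
with the term at 0 because `α ^ m = lam`. -/
lemma mulVec_orbitEigenvector {h : Matrix n n k} {m : ℕ} {lam α : k} (hlam : lam ≠ 0)
    (hh : h ^ m = lam • (1 : Matrix n n k)) (hα : α ^ m = lam) (hα0 : α ≠ 0) (v : n → k) :
    h *ᵥ orbitEigenvector h m α v = α • orbitEigenvector h m α v := by
  have h1 : ∀ j, h *ᵥ (α⁻¹ ^ j • (h ^ j *ᵥ v)) = α • (α⁻¹ ^ (j + 1) • (h ^ (j + 1) *ᵥ v)) := by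
    intro j
    rw [Matrix.mulVec_smul, Matrix.mulVec_mulVec, ← pow_succ', smul_smul, pow_succ' α⁻¹,
      ← mul_assoc, mul_inv_cancel₀ hα0, one_mul]
  have h3 : α⁻¹ ^ m • (h ^ m *ᵥ v) = α⁻¹ ^ 0 • (h ^ 0 *ᵥ v) := by
    rw [hh, Matrix.smul_mulVec, smul_smul, inv_pow, hα, inv_mul_cancel₀ hlam]
    simp
  have h4 := Finset.sum_range_succ (fun j => α⁻¹ ^ j • (h ^ j *ᵥ v)) m
  rw [Finset.sum_range_succ', h3] at h4
  rw [orbitEigenvector, Matrix.mulVec_sum, Finset.sum_congr rfl fun j _ => h1 j,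
    ← Finset.smul_sum, add_right_cancel h4]

/-- On each orbit the passage from translates to eigenvectors is a Vandermonde matrix in the
distinct numbers `(α s)⁻¹`. -/
lemma linearIndependent_orbitEigenvector {h : Matrix n n k} {m : ℕ} {κ : Type*} [Fintype κ]
    {v : κ → n → k}
    (hv : LinearIndependent k (fun p : κ × Fin m => h ^ (p.2 : ℕ) *ᵥ v p.1))
    {α : Fin m → k} (hα : Function.Injective α) :
    LinearIndependent k (fun p : κ × Fin m => orbitEigenvector h m (α p.2) (v p.1)) := by
  rw [Fintype.linearIndependent_iff] at hv ⊢
  intro c hc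
  have h1 : ∑ p : κ × Fin m, (∑ s, c (p.1, s) * (α s)⁻¹ ^ (p.2 : ℕ)) • (h ^ (p.2 : ℕ) *ᵥ v p.1)
      = 0 := by
    rw [← hc, Fintype.sum_prod_type, Fintype.sum_prod_type]
    refine Finset.sum_congr rfl fun i _ => ?_
    simp only [orbitEigenvector, Finset.sum_smul, Finset.smul_sum, Finset.sum_range, smul_smul]
    rw [Finset.sum_comm]
  have h2 := hv _ h1
  rintro ⟨i, s⟩
  have h3 := Matrix.eq_zero_of_forall_pow_sum_mul_pow_eq_zero
    (f := fun s => (α s)⁻¹) (v := fun s => c (i, s))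
    (fun s t hst => hα (inv_injective hst)) (fun j => h2 (i, j))
  exact congrFun h3 s

lemma exists_eq_mul_diagonal {a : ℕ} {h : Matrix (Fin a) (Fin a) k} {w : Fin a → Fin a → k}
    (hw : LinearIndependent k w) {d : Fin a → k} (hd : ∀ i, h *ᵥ w i = d i • w i) :
    ∃ x : Matrix (Fin a) (Fin a) k, x.det ≠ 0 ∧ h * x = x * Matrix.diagonal d := by
  refine ⟨Matrix.of fun i j => w j i, ?_, ?_⟩
  · have := (Matrix.linearIndependent_cols_iff_isUnit (A := Matrix.of fun i j => w j i)).1 hw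
    exact ((Matrix.isUnit_iff_isUnit_det _).1 this).ne_zero
  · ext i j
    have := congrFun (hd j) i
    rw [Matrix.mul_diagonal, Matrix.of_apply, mul_comm]
    exact this

section Diagonal

variable {a m R : ℕ} {h : Matrix (Fin a) (Fin a) k} {lam ζ : k}

lemma injective_mul_pow (hζ : IsPrimitiveRoot ζ m) {α : k} (hα : α ≠ 0) :
    Function.Injective (fun s : Fin m => α * ζ ^ (s : ℕ)) := fun s t hst =>
  Fin.ext (hζ.pow_inj s.2 t.2 (mul_left_cancel₀ hα hst))

lemma mul_pow_pow (hζ : IsPrimitiveRoot ζ m) {α : k} (hα : α ^ m = lam) (s : ℕ) :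
    (α * ζ ^ s) ^ m = lam := by
  rw [mul_pow, hα, ← pow_mul, mul_comm s, pow_mul, hζ.pow_eq_one, one_pow, mul_one]

/-- The pair (p, s) is numbered `s + m * p`, and `ζ ^ i` depends only on `i` modulo `m`; so a single
geometric progression lists the eigenvalues of all cycles. The span is recorded so that one more
vector can be added. -/
lemma eigenfamily (hm : 0 < m) (hζ : IsPrimitiveRoot ζ m) (hlam : lam ≠ 0)
    (hh : h ^ m = lam • (1 : Matrix (Fin a) (Fin a) k)) {v : Fin R → Fin a → k}
    (hv : LinearIndependent k (fun p : Fin R × Fin m => h ^ (p.2 : ℕ) *ᵥ v p.1))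
    {α : k} (hα : α ^ m = lam) :
    ∃ w : Fin (R * m) → Fin a → k, LinearIndependent k w ∧
      (∀ i, h *ᵥ w i = (α * ζ ^ (i : ℕ)) • w i) ∧
      ∀ i, w i ∈ Submodule.span k
        (Set.range (fun p : Fin R × Fin m => h ^ (p.2 : ℕ) *ᵥ v p.1)) := by
  have hα0 : α ≠ 0 := by
    rintro rfl
    rw [zero_pow hm.ne'] at hα
    exact hlam hα.symm
  have hζ0 := hζ.ne_zero hm.ne'
  have hLI := linearIndependent_orbitEigenvector hv (injective_mul_pow hζ hα0)
  refine ⟨_, hLI.comp finProdFinEquiv.symm finProdFinEquiv.symm.injective, fun i => ?_,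
    fun i => ?_⟩
  · obtain ⟨p, rfl⟩ := finProdFinEquiv.surjective i
    simp only [Function.comp, Equiv.symm_apply_apply]
    rw [mulVec_orbitEigenvector hlam hh (mul_pow_pow hζ hα _)
      (mul_ne_zero hα0 (pow_ne_zero _ hζ0))]
    congr 2
    rw [finProdFinEquiv_apply_val, pow_add, pow_mul, hζ.pow_eq_one, one_pow, mul_one]
  · simp only [Function.comp, orbitEigenvector]
    refine Submodule.sum_mem _ fun j hj => Submodule.smul_mem _ _ (Submodule.subset_span ?_)
    exact ⟨(_, ⟨j, Finset.mem_range.1 hj⟩), rfl⟩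

lemma exists_diagonal (ha : R * m = a) (hm : 0 < m) (hζ : IsPrimitiveRoot ζ m) (hlam : lam ≠ 0)
    (hh : h ^ m = lam • (1 : Matrix (Fin a) (Fin a) k)) {v : Fin R → Fin a → k}
    (hv : LinearIndependent k (fun p : Fin R × Fin m => h ^ (p.2 : ℕ) *ᵥ v p.1))
    {α : k} (hα : α ^ m = lam) :
    ∃ x : Matrix (Fin a) (Fin a) k, x.det ≠ 0 ∧
      h * x = x * Matrix.diagonal (fun i : Fin a => α * ζ ^ (i : ℕ)) := by
  subst ha
  obtain ⟨w, hw, hd, -⟩ := eigenfamily hm hζ hlam hh hv hα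
  exact exists_eq_mul_diagonal hw hd

/-- As `m` is invertible, `h` is semisimple and some eigenvector lies outside the span of the
cycles. Its eigenvalue `η` is then used as the starting point of the progression on the cycles. -/
lemma exists_diagonal_add_one [IsAlgClosed k] (ha : R * m + 1 = a) (hm : (m : k) ≠ 0)
    (hζ : IsPrimitiveRoot ζ m) (hlam : lam ≠ 0)
    (hh : h ^ m = lam • (1 : Matrix (Fin a) (Fin a) k)) {v : Fin R → Fin a → k}
    (hv : LinearIndependent k (fun p : Fin R × Fin m => h ^ (p.2 : ℕ) *ᵥ v p.1)) :
    ∃ η : k, η ^ m = lam ∧ ∃ x : Matrix (Fin a) (Fin a) k, x.det ≠ 0 ∧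
      h * x = x * Matrix.diagonal (fun i : Fin a => η * ζ ^ (i : ℕ)) := by
  subst ha
  have hm0 : 0 < m := Nat.pos_of_ne_zero (by rintro rfl; simp at hm)
  set U := Submodule.span k (Set.range (fun p : Fin R × Fin m => h ^ (p.2 : ℕ) *ᵥ v p.1)) with hU
  have hUtop : U ≠ ⊤ := by
    intro h0
    have h1 := finrank_span_eq_card hv
    rw [← hU, h0, finrank_top, Module.finrank_fin_fun, Fintype.card_prod, Fintype.card_fin,
      Fintype.card_fin] at h1
    omega
  have hss : Module.End.IsSemisimple (Matrix.toLin' h) := by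
    have hsep : (Polynomial.X ^ m - Polynomial.C lam).Separable :=
      Polynomial.separable_X_pow_sub_C lam hm hlam
    refine Module.End.isSemisimple_of_squarefree_aeval_eq_zero hsep.squarefree ?_
    rw [map_sub, map_pow, Polynomial.aeval_X, Polynomial.aeval_C, sub_eq_zero,
      ← Matrix.toLin'_pow, hh, map_smul, Matrix.toLin'_one]
    rfl
  have hex : ∃ (μ : k) (w : Fin (R * m + 1) → k), h *ᵥ w = μ • w ∧ w ∉ U := by
    by_contra! hcon
    apply hUtop
    rw [← top_le_iff, ← Module.End.iSup_maxGenEigenspace_eq_top (Matrix.toLin' h)]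
    refine iSup_le fun μ w hw => hcon μ w ?_
    rwa [hss.isFinitelySemisimple.maxGenEigenspace_eq_eigenspace, Module.End.mem_eigenspace_iff,
      Matrix.toLin'_apply] at hw
  obtain ⟨μ, w₀, hw₀, hw₀U⟩ := hex
  have hμ : μ ^ m = lam := by
    have h1 : ∀ j : ℕ, h ^ j *ᵥ w₀ = μ ^ j • w₀ := by
      intro j
      induction j with
      | zero => simp
      | succ j ih =>
        rw [pow_succ', ← Matrix.mulVec_mulVec, ih, Matrix.mulVec_smul, hw₀, smul_smul, pow_succ]
    have h3 := h1 m
    rw [hh, Matrix.smul_mulVec, Matrix.one_mulVec] at h3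
    refine smul_left_injective k (fun h0 => hw₀U ?_) h3.symm
    rw [h0]
    exact U.zero_mem
  obtain ⟨w, hw, hd, hwU⟩ := eigenfamily hm0 hζ hlam hh hv hμ
  refine ⟨μ, hμ, exists_eq_mul_diagonal (w := Fin.snoc w w₀) ?_ fun i => ?_⟩
  · refine linearIndependent_finSnoc.2 ⟨hw, fun h0 => hw₀U ?_⟩
    exact (Submodule.span_le.2 (Set.range_subset_iff.2 hwU)) h0
  · refine Fin.lastCases ?_ (fun i => ?_) i
    · simp only [Fin.snoc_last, Fin.val_last]
      -- The extra vector stands at position `R * m`, where the progression has returned to `η`.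
      rw [pow_mul', hζ.pow_eq_one, one_pow, mul_one]
      exact hw₀
    · simp only [Fin.snoc_castSucc, Fin.val_castSucc]
      exact hd i

end Diagonal

end Cyclic

/-! ## Model regular nilpotent matrices -/

section Model

variable (k : Type*) [Field k] (a b : ℕ)

/-- A nilpotent Jordan block of size `b`, extended by zero. -/
def modelNilpotent : Matrix (Fin a) (Fin a) k :=
  Matrix.of fun i j => if (i : ℕ) = j + 1 ∧ (i : ℕ) < b then 1 else 0

/-- A form for which `modelNilpotent` is skew. -/
def modelForm : Matrix (Fin a) (Fin a) k :=
  Matrix.of fun i j => if (i : ℕ) + j + 1 = b then (-1) ^ (i : ℕ) else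
    if (i : ℕ) = b ∧ (j : ℕ) = b then 1 else 0

variable {k a b}

lemma modelNilpotent_apply (i j : Fin a) : modelNilpotent k a b i j =
    if (i : ℕ) = j + 1 ∧ (i : ℕ) < b then 1 else 0 := rfl

lemma modelForm_apply (i j : Fin a) : modelForm k a b i j =
    if (i : ℕ) + j + 1 = b then (-1) ^ (i : ℕ) else
    if (i : ℕ) = b ∧ (j : ℕ) = b then 1 else 0 := rfl

lemma isNilpotent_modelNilpotent : IsNilpotent (modelNilpotent k a b) := by
  have h : ∀ (s : ℕ) (i j : Fin a), (i : ℕ) ≠ j + s → (modelNilpotent k a b ^ s) i j = 0 := by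
    intro s
    induction s with
    | zero =>
      intro i j hij
      rw [pow_zero, Matrix.one_apply_ne]
      rintro rfl
      exact hij rfl
    | succ s ih =>
      intro i j hij
      rw [pow_succ, Matrix.mul_apply]
      refine Finset.sum_eq_zero fun l _ => ?_
      by_cases hl : (i : ℕ) = l + s
      · rw [modelNilpotent_apply, if_neg, mul_zero]
        omega
      · rw [ih i l hl, zero_mul]
  refine ⟨a, ?_⟩
  ext i j
  exact h a i j (by omega)

lemma trace_modelNilpotent : (modelNilpotent k a b).trace = 0 := by
  refine Finset.sum_eq_zero fun i _ => ?_
  rw [Matrix.diag_apply, modelNilpotent_apply, if_neg]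
  omega

lemma mul_modelNilpotent_apply (X : Matrix (Fin a) (Fin a) k) {i j j' : Fin a}
    (hj : (j' : ℕ) = j + 1) (hb : (j' : ℕ) < b) : (X * modelNilpotent k a b) i j = X i j' := by
  rw [Matrix.mul_apply, Finset.sum_eq_single j']
  · rw [modelNilpotent_apply, if_pos ⟨hj, hb⟩, mul_one]
  · intro l _ hl
    rw [modelNilpotent_apply, if_neg, mul_zero]
    rintro ⟨h1, -⟩
    exact hl (Fin.ext (h1.trans hj.symm))
  · simp

lemma modelNilpotent_mul_apply (X : Matrix (Fin a) (Fin a) k) {i i' j : Fin a}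
    (hi : (i : ℕ) = i' + 1) (hb : (i : ℕ) < b) : (modelNilpotent k a b * X) i j = X i' j := by
  rw [Matrix.mul_apply, Finset.sum_eq_single i']
  · rw [modelNilpotent_apply, if_pos ⟨hi, hb⟩, one_mul]
  · intro l _ hl
    rw [modelNilpotent_apply, if_neg, zero_mul]
    rintro ⟨h1, -⟩
    exact hl (Fin.ext (by omega))
  · simp

lemma modelForm_mul_apply (X : Matrix (Fin a) (Fin a) k) {p p' q : Fin a}
    (hp : (p : ℕ) + p' + 1 = b) : (modelForm k a b * X) p q = (-1) ^ (p : ℕ) * X p' q := by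
  rw [Matrix.mul_apply, Finset.sum_eq_single p']
  · rw [modelForm_apply, if_pos hp]
  · intro l _ hl
    rw [modelForm_apply, if_neg, if_neg, zero_mul]
    · omega
    · intro h1
      exact hl (Fin.ext (by omega))
  · simp

lemma modelForm_mul_apply' (X : Matrix (Fin a) (Fin a) k) {p q : Fin a}
    (hp : (p : ℕ) = b) : (modelForm k a b * X) p q = X p q := by
  rw [Matrix.mul_apply, Finset.sum_eq_single p]
  · rw [modelForm_apply, if_neg (by omega), if_pos ⟨hp, hp⟩, one_mul]
  · intro l _ hl
    rw [modelForm_apply, if_neg (by omega), if_neg, zero_mul]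
    rintro ⟨-, h1⟩
    exact hl (Fin.ext (h1.trans hp.symm))
  · simp

lemma transpose_modelForm (hb : 0 < b) (hab : a ≤ b ∨ Odd b) :
    (modelForm k a b)ᵀ = (-1 : k) ^ (b - 1) • modelForm k a b := by
  ext i j
  rw [Matrix.transpose_apply, Matrix.smul_apply, modelForm_apply, modelForm_apply, smul_eq_mul]
  by_cases h1 : (i : ℕ) + j + 1 = b
  · rw [if_pos h1, if_pos (by omega), ← pow_add, show b - 1 + (i : ℕ) = j + 2 * i by omega, pow_add,
      pow_mul, neg_one_sq, one_pow, mul_one]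
  · rw [if_neg h1, if_neg (by omega)]
    by_cases h2 : (i : ℕ) = b ∧ (j : ℕ) = b
    · rw [if_pos h2, if_pos h2.symm]
      rcases hab with hab | ⟨c, rfl⟩
      · omega
      · rw [show 2 * c + 1 - 1 = 2 * c by omega, pow_mul, neg_one_sq, one_pow, mul_one]
    · rw [if_neg h2, if_neg (by tauto), mul_zero]

lemma det_modelForm (hab : a ≤ b + 1) (hba : b ≤ a) : (modelForm k a b).det ≠ 0 := by
  have h : modelForm k a b * (modelForm k a b)ᵀ = 1 := by
    ext p q
    by_cases hp : (p : ℕ) = b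
    · rw [modelForm_mul_apply' _ hp, Matrix.transpose_apply, modelForm_apply, if_neg (by omega),
        Matrix.one_apply]
      by_cases hq : p = q
      · subst hq
        rw [if_pos ⟨hp, hp⟩, if_pos rfl]
      · rw [if_neg hq, if_neg]
        rintro ⟨h1, -⟩
        exact hq (Fin.ext (hp.trans h1.symm))
    · have hpb : (p : ℕ) < b := by omega
      rw [modelForm_mul_apply (p' := ⟨b - 1 - p, by omega⟩) _ (by simp only; omega),
        Matrix.transpose_apply, modelForm_apply, Matrix.one_apply]
      by_cases hq : p = q
      · subst hq
        rw [if_pos (by simp only; omega), if_pos rfl, ← mul_pow, neg_one_mul, neg_neg, one_pow]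
      · rw [if_neg hq, if_neg, if_neg, mul_zero]
        · simp only
          omega
        · simp only
          intro h1
          exact hq (Fin.ext (by omega))
  intro h0
  have := congrArg Matrix.det h
  rw [Matrix.det_mul, h0, zero_mul, Matrix.det_one] at this
  exact zero_ne_one this

lemma transpose_mul_modelForm (hb : 0 < b) (hab : a ≤ b ∨ Odd b) (X : Matrix (Fin a) (Fin a) k) :
    Xᵀ * modelForm k a b = (-1 : k) ^ (b - 1) • (modelForm k a b * X)ᵀ := by
  rw [Matrix.transpose_mul, transpose_modelForm hb hab, Matrix.mul_smul, smul_smul, ← mul_pow,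
    neg_one_mul, neg_neg, one_pow, one_smul]

lemma skew_modelNilpotent (hb : 0 < b) (hab : a ≤ b ∨ Odd b) (hab' : a ≤ b + 1) (hba : b ≤ a) :
    (modelNilpotent k a b)ᵀ * modelForm k a b + modelForm k a b * modelNilpotent k a b = 0 := by
  have key : ∀ p q : Fin a, (modelForm k a b * modelNilpotent k a b) p q =
      if (p : ℕ) + q + 2 = b then (-1) ^ (p : ℕ) else 0 := by
    intro p q
    by_cases hp : (p : ℕ) = b
    · rw [modelForm_mul_apply' _ hp, modelNilpotent_apply, if_neg (by omega), if_neg (by omega)]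
    · rw [modelForm_mul_apply (p' := ⟨b - 1 - p, by omega⟩) _ (by simp only; omega),
        modelNilpotent_apply]
      by_cases h1 : (p : ℕ) + q + 2 = b
      · rw [if_pos (by simp only; omega), if_pos h1, mul_one]
      · rw [if_neg (by simp only; omega), if_neg h1, mul_zero]
  ext p q
  rw [Matrix.add_apply, transpose_mul_modelForm hb hab, Matrix.smul_apply, Matrix.transpose_apply,
    key, key, smul_eq_mul, Matrix.zero_apply]
  by_cases h1 : (p : ℕ) + q + 2 = b
  · rw [if_pos h1, if_pos (by omega), ← pow_add,
      show b - 1 + (q : ℕ) = (p + 1) + 2 * q by omega, pow_add, pow_mul, neg_one_sq, one_pow,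
      mul_one, pow_succ]
    ring
  · rw [if_neg h1, if_neg (by omega), mul_zero, add_zero]

lemma diagonal_mul_modelNilpotent (α ζ : k) :
    Matrix.diagonal (fun i : Fin a => α * ζ ^ (i : ℕ)) * modelNilpotent k a b =
      ζ • (modelNilpotent k a b * Matrix.diagonal (fun i : Fin a => α * ζ ^ (i : ℕ))) := by
  ext i j
  rw [Matrix.diagonal_mul, Matrix.smul_apply, Matrix.mul_diagonal, modelNilpotent_apply,
    smul_eq_mul]
  by_cases h : (i : ℕ) = j + 1 ∧ (i : ℕ) < b
  · rw [if_pos h, h.1, pow_succ]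
    ring
  · rw [if_neg h]
    ring

/-- The form pairs basis vectors whose indices add up to `b - 1`, which gives the first condition;
the extra vector of index `b`, if present, is paired with itself and gives the second. -/
lemma isometry_modelForm {α ζ : k} (h1 : α ^ 2 * ζ ^ (b - 1) = 1)
    (h2 : a ≤ b ∨ (α * ζ ^ b) ^ 2 = 1) :
    (Matrix.diagonal (fun i : Fin a => α * ζ ^ (i : ℕ)))ᵀ * modelForm k a b *
      Matrix.diagonal (fun i : Fin a => α * ζ ^ (i : ℕ)) = modelForm k a b := by
  ext i j
  rw [Matrix.diagonal_transpose, Matrix.mul_diagonal, Matrix.diagonal_mul, modelForm_apply]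
  by_cases hij : (i : ℕ) + j + 1 = b
  · rw [if_pos hij]
    have : b - 1 = i + j := by omega
    rw [this, pow_add] at h1
    linear_combination (-1) ^ (i : ℕ) * h1
  · rw [if_neg hij]
    by_cases hi : (i : ℕ) = b ∧ (j : ℕ) = b
    · rw [if_pos hi, hi.1, hi.2]
      rcases h2 with h2 | h2
      · omega
      · linear_combination h2
    · rw [if_neg hi]
      ring

/-- The first `b` basis vectors form one Jordan chain generated by the vector of index 0, so a
commuting matrix is determined on them by its column 0. -/
lemma col_eq_zero_of_commute {X : Matrix (Fin a) (Fin a) k}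
    (hX : modelNilpotent k a b * X = X * modelNilpotent k a b)
    (h0 : ∀ i j : Fin a, (j : ℕ) = 0 → X i j = 0) :
    ∀ (s : ℕ) (i j : Fin a), (j : ℕ) = s → s < b → X i j = 0 := by
  intro s
  induction s with
  | zero => exact fun i j hj _ => h0 i j hj
  | succ s ih =>
    intro i j hj hs
    have h1 := congrFun (congrFun hX i) ⟨s, by omega⟩
    rw [mul_modelNilpotent_apply (j' := j) X hj (by omega)] at h1
    rw [← h1, Matrix.mul_apply]
    refine Finset.sum_eq_zero fun l _ => ?_
    rw [ih l ⟨s, by omega⟩ rfl (by omega), mul_zero]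

lemma apply_add_of_commute {X : Matrix (Fin a) (Fin a) k}
    (hX : modelNilpotent k a b * X = X * modelNilpotent k a b) {i₀ j₀ : Fin a}
    (hj₀ : (j₀ : ℕ) = 0) :
    ∀ (s : ℕ) (i j : Fin a), (i : ℕ) = i₀ + s → (j : ℕ) = s → (i : ℕ) < b → (j : ℕ) < b →
      X i j = X i₀ j₀ := by
  intro s
  induction s with
  | zero =>
    intro i j hi hj _ _
    rw [Fin.ext hi, Fin.ext (hj.trans hj₀.symm)]
  | succ s ih =>
    intro i j hi hj hib hjb
    have h1 := congrFun (congrFun hX i) ⟨s, by omega⟩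
    rw [mul_modelNilpotent_apply (j' := j) X hj hjb,
      modelNilpotent_mul_apply (i' := ⟨i₀ + s, by omega⟩) X (by simp only; omega) hib] at h1
    rw [← h1]
    exact ih _ _ rfl rfl (by simp only; omega) (by simp only; omega)

/-- Odd powers of the Jordan block are skew and even powers are self-adjoint. Skewness thus leaves
only the entries of odd index in column 0 free; the hypothesis kills those too. The form then
propagates the vanishing to the column of the extra vector. -/
lemma eq_zero_of_commute_of_skew (h2 : (2 : k) ≠ 0) (hb : 0 < b) (hab : a ≤ b ∨ Odd b)
    (hab' : a ≤ b + 1) (hba : b ≤ a) {X : Matrix (Fin a) (Fin a) k}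
    (hX : modelNilpotent k a b * X = X * modelNilpotent k a b)
    (hskew : Xᵀ * modelForm k a b + modelForm k a b * X = 0)
    (h0 : ∀ i j : Fin a, Odd (i : ℕ) → (j : ℕ) = 0 → X i j = 0) : X = 0 := by
  have hsk : ∀ p q : Fin a, (-1 : k) ^ (b - 1) * (modelForm k a b * X) q p
      + (modelForm k a b * X) p q = 0 := by
    intro p q
    have := congrFun (congrFun hskew p) q
    rwa [Matrix.add_apply, transpose_mul_modelForm hb hab, Matrix.smul_apply,
      Matrix.transpose_apply, smul_eq_mul, Matrix.zero_apply] at this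
  have hdouble : ∀ x : k, x + x = 0 → x = 0 := by
    intro x hx
    rw [← two_mul] at hx
    exact (mul_eq_zero.1 hx).resolve_left h2
  have hcol0 : ∀ i j : Fin a, (j : ℕ) = 0 → X i j = 0 := by
    intro i j hj
    rcases Nat.even_or_odd (i : ℕ) with hi | hi
    · by_cases hib : (i : ℕ) < b
      -- Skewness compares the entries (i, 0) and (b-1, b-1-i), which are equal because a matrix
      -- commuting with the block is constant along diagonals. For even `i` the signs add up to
      -- twice the entry.
      · have h3 := hsk j ⟨b - 1 - i, by omega⟩
        rw [modelForm_mul_apply (p' := i) X (by simp only; omega),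
          modelForm_mul_apply (p' := ⟨b - 1, by omega⟩) X (by simp only; omega),
          apply_add_of_commute hX hj (b - 1 - i) (i₀ := i) ⟨b - 1, by omega⟩
            ⟨b - 1 - i, by omega⟩ (by simp only; omega) rfl
            (by simp only; omega) (by simp only; omega), ← mul_assoc, ← pow_add, hj, pow_zero,
          one_mul] at h3
        rw [Even.neg_one_pow, one_mul] at h3
        · exact hdouble _ h3
        · obtain ⟨c, hc⟩ := hi
          exact ⟨b - 1 - c, by simp only; omega⟩
      · have : (i : ℕ) = b := by omega
        rcases hab with hab | hab
        · omega
        · rw [this] at hi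
          exact absurd hi (Nat.not_even_iff_odd.2 hab)
    · exact h0 i j hi hj
  have hcol := col_eq_zero_of_commute hX hcol0
  ext i j
  by_cases hj : (j : ℕ) < b
  · exact hcol j i j rfl hj
  · have hjb : (j : ℕ) = b := by omega
    rw [Matrix.zero_apply]
    by_cases hi : (i : ℕ) = b
    · have hij : i = j := Fin.ext (hi.trans hjb.symm)
      subst hij
      have h3 := hsk i i
      rw [modelForm_mul_apply' X hi] at h3
      have hodd : Odd b := hab.resolve_left (by omega)
      obtain ⟨c, rfl⟩ := hodd
      rw [show 2 * c + 1 - 1 = 2 * c by omega, pow_mul, neg_one_sq, one_pow, one_mul] at h3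
      exact hdouble _ h3
    · have h3 := hsk ⟨b - 1 - i, by omega⟩ j
      rw [modelForm_mul_apply' X hjb, modelForm_mul_apply (p' := i) X (by simp only; omega),
        hcol (b - 1 - i) j _ rfl (by omega), mul_zero, zero_add] at h3
      exact (mul_eq_zero.1 h3).resolve_left (pow_ne_zero _ (by simp))

/-- The space of matrices that are skew for the form `B`. -/
def skewMatrices {n : Type*} [Fintype n] (B : Matrix n n k) : Submodule k (Matrix n n k) where
  carrier := {X | Xᵀ * B + B * X = 0}
  add_mem' := by
    intro X Y hX hY
    simp only [Set.mem_ofPred_eq] at hX hY ⊢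
    rw [Matrix.transpose_add, Matrix.add_mul, Matrix.mul_add, add_add_add_comm, hX, hY, add_zero]
  zero_mem' := by simp
  smul_mem' := by
    intro c X hX
    simp only [Set.mem_ofPred_eq] at hX ⊢
    rw [Matrix.transpose_smul, Matrix.smul_mul, Matrix.mul_smul, ← smul_add, hX, smul_zero]

lemma mem_skewMatrices {n : Type*} [Fintype n] {B X : Matrix n n k} :
    X ∈ skewMatrices B ↔ Xᵀ * B + B * X = 0 := Iff.rfl

/-- An element of the centralizer is determined by the entries of odd index in its first column, and
there are `a / 2` of these. -/
lemma finrank_centralizer_modelNilpotent_skew (h2 : (2 : k) ≠ 0) (hb : 0 < b)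
    (hab : a ≤ b ∨ Odd b) (hab' : a ≤ b + 1) (hba : b ≤ a) :
    Module.finrank k (matCentralizer (skewMatrices (modelForm k a b)) (modelNilpotent k a b))
      ≤ a / 2 := by
  let φ : matCentralizer (skewMatrices (modelForm k a b)) (modelNilpotent k a b) →ₗ[k]
      (Fin (a / 2) → k) :=
    { toFun := fun X t => (X : Matrix (Fin a) (Fin a) k) ⟨2 * t + 1, by omega⟩ ⟨0, by omega⟩
      map_add' := fun X Y => rfl
      map_smul' := fun c X => rfl }
  have hφ : Function.Injective φ := by
    rw [← LinearMap.ker_eq_bot, LinearMap.ker_eq_bot']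
    intro X hX
    have hXm := mem_matCentralizer.1 X.2
    refine Subtype.ext (eq_zero_of_commute_of_skew h2 hb hab hab' hba hXm.2 hXm.1 ?_)
    rintro i j ⟨c, hc⟩ hj
    have := congrFun hX ⟨c, by omega⟩
    change (X : Matrix (Fin a) (Fin a) k) _ _ = 0 at this
    rwa [show i = ⟨2 * c + 1, by omega⟩ from Fin.ext hc, show j = ⟨0, by omega⟩ from Fin.ext hj]
  simpa using LinearMap.finrank_le_finrank_of_injective hφ

lemma finrank_centralizer_modelNilpotent_top :
    Module.finrank k (matCentralizer ⊤ (modelNilpotent k a a)) ≤ a := by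
  rcases Nat.eq_zero_or_pos a with ha | ha
  · subst ha
    rw [Module.finrank_zero_of_subsingleton]
  let φ : matCentralizer ⊤ (modelNilpotent k a a) →ₗ[k] (Fin a → k) :=
    { toFun := fun X t => (X : Matrix (Fin a) (Fin a) k) t ⟨0, ha⟩
      map_add' := fun X Y => rfl
      map_smul' := fun c X => rfl }
  have hφ : Function.Injective φ := by
    rw [← LinearMap.ker_eq_bot, LinearMap.ker_eq_bot']
    intro X hX
    have hXm := mem_matCentralizer.1 X.2
    have hcol := col_eq_zero_of_commute hXm.2 (fun i j hj => by
      have := congrFun hX i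
      change (X : Matrix (Fin a) (Fin a) k) _ _ = 0 at this
      rwa [show j = ⟨0, ha⟩ from Fin.ext hj])
    exact Subtype.ext (Matrix.ext fun i j => hcol j i j rfl j.2)
  simpa using LinearMap.finrank_le_finrank_of_injective hφ

end Model

/-! ## Lower bounds for centralizers -/

section LowerBounds

variable {k : Type*} [Field k] {n : Type*} [Fintype n] [DecidableEq n]

lemma map_sum_single {ι : Type*} (φ : Matrix n n k →ₗ[k] (ι → k)) (A : Matrix n n k) (i : ι) :
    φ A i = ∑ a, ∑ b, A a b * φ (Matrix.single a b 1) i := by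
  conv_lhs => rw [Matrix.matrix_eq_sum_single A]
  simp only [map_sum, Finset.sum_apply]
  refine Finset.sum_congr rfl fun a _ => Finset.sum_congr rfl fun b _ => ?_
  rw [← smul_eq_mul, ← Pi.smul_apply, ← map_smul, Matrix.smul_single, smul_eq_mul, mul_one]

/-- Linear independence is an open condition along polynomial curves of matrices. -/
lemma exists_polynomial_linearIndependent {ι : Type*} [Fintype ι] [DecidableEq ι]
    (v : ι → Matrix n n (Polynomial k)) (t₀ : k)
    (h : LinearIndependent k (fun i => (v i).map (Polynomial.eval t₀))) :
    ∃ q : Polynomial k, q ≠ 0 ∧ ∀ t, q.eval t ≠ 0 →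
      LinearIndependent k (fun i => (v i).map (Polynomial.eval t)) := by
  -- A left inverse `φ` at `t₀` gives coordinates in which the family becomes a square matrix `D` of
  -- polynomials. Its determinant is 1 at `t₀`, and independence persists wherever it is nonzero.
  obtain ⟨φ, hφ⟩ := LinearMap.exists_leftInverse_of_injective
    (Fintype.linearCombination k (fun i => (v i).map (Polynomial.eval t₀)))
    (LinearMap.ker_eq_bot.2 h.fintypeLinearCombination_injective)
  let D : Matrix ι ι (Polynomial k) := Matrix.of fun i j =>
    ∑ a, ∑ b, v i a b * Polynomial.C (φ (Matrix.single a b 1) j)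
  have hD : ∀ t, D.map (Polynomial.eval t) =
      Matrix.of fun i j => φ ((v i).map (Polynomial.eval t)) j := by
    intro t
    ext i j
    rw [Matrix.of_apply, map_sum_single]
    simp [D, Polynomial.eval_finsetSum]
  have hdet : ∀ t, (D.det).eval t = (D.map (Polynomial.eval t)).det := by
    intro t
    exact RingHom.map_det (Polynomial.evalRingHom t) D
  refine ⟨D.det, fun h0 => ?_, fun t ht => ?_⟩
  · have h1 := hdet t₀
    have h2 : D.map (Polynomial.eval t₀) = 1 := by
      rw [hD]
      ext i j
      have h3 := LinearMap.congr_fun hφ (Pi.single i 1)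
      rw [LinearMap.comp_apply, Fintype.linearCombination_apply_single, one_smul,
        LinearMap.id_apply] at h3
      rw [Matrix.of_apply, h3, Matrix.one_apply, Pi.single_apply]
      simp only [eq_comm]
    rw [h0, h2, Matrix.det_one, Polynomial.eval_zero] at h1
    exact zero_ne_one h1
  · rw [hdet, hD] at ht
    have h1 : LinearIndependent k (fun i => φ ((v i).map (Polynomial.eval t))) := by
      have h2 := (Matrix.isUnit_iff_isUnit_det _).2 (isUnit_iff_ne_zero.2 ht)
      exact Matrix.linearIndependent_rows_iff_isUnit.2 h2
    exact LinearIndependent.of_comp φ h1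

/-- If the space `l` is closed under the powers `x ↦ x ^ g i`, and for some `s ∈ l` these powers are
independent, then all centralizers in `l` are at least as large as the number of these powers. -/
lemma le_finrank_centralizer [Infinite k] {l : Submodule k (Matrix n n k)} {d : ℕ}
    (g : Fin d → ℕ) (hpow : ∀ y ∈ l, ∀ i, y ^ g i ∈ l) {s : Matrix n n k} (hs : s ∈ l)
    (hli : LinearIndependent k (fun i => s ^ g i)) {y : Matrix n n k} (hy : y ∈ l) :
    d ≤ Module.finrank k (matCentralizer l y) := by
  let ad : Matrix n n k → l →ₗ[k] Matrix n n k := fun x =>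
    (LinearMap.mulLeft k x - LinearMap.mulRight k x).comp l.subtype
  have had : ∀ x (w : l), ad x w = x * w - w * x := fun x w => rfl
  have hker : ∀ x, Module.finrank k (matCentralizer l x)
      = Module.finrank k (LinearMap.ker (ad x)) := by
    intro x
    rw [← finrank_map_eq_of_forall_eq_zero l.subtype (LinearMap.ker (ad x))
      (fun w _ hw => Subtype.ext hw)]
    suffices hh : matCentralizer l x = (LinearMap.ker (ad x)).map l.subtype by rw [hh]
    ext w
    rw [mem_matCentralizer, Submodule.mem_map]
    constructor
    · rintro ⟨h1, h2⟩
      exact ⟨⟨w, h1⟩, by rw [LinearMap.mem_ker, had, sub_eq_zero]; exact h2, rfl⟩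
    · rintro ⟨w, hw, rfl⟩
      rw [LinearMap.mem_ker, had, sub_eq_zero] at hw
      exact ⟨w.2, hw⟩
  set e := Module.finrank k (LinearMap.range (ad y)) with he
  let B := Module.finBasis k (LinearMap.range (ad y))
  have hw : ∀ i, ∃ w : l, ad y w = B i := fun i => (B i).2
  choose w hw using hw
  -- The line through `y` at parameter 0 and `s` at parameter 1.
  let Y : Matrix n n (Polynomial k) := y.map Polynomial.C +
    (Polynomial.X : Polynomial k) • (s - y).map Polynomial.C
  have hY : ∀ t, Y.map (Polynomial.eval t) = y + t • (s - y) := by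
    intro t
    ext i j
    simp [Y, Polynomial.eval_add, Polynomial.eval_mul]
  have hmapmul : ∀ (t : k) (A C : Matrix n n (Polynomial k)), (A * C).map (Polynomial.eval t)
      = A.map (Polynomial.eval t) * C.map (Polynomial.eval t) := fun t A C =>
    Matrix.map_mul (f := Polynomial.evalRingHom t)
  have hmapsub : ∀ (t : k) (A C : Matrix n n (Polynomial k)), (A - C).map (Polynomial.eval t)
      = A.map (Polynomial.eval t) - C.map (Polynomial.eval t) := by
    intro t A C
    ext i j
    simp
  have hC : ∀ (t : k) (A : Matrix n n k), (A.map Polynomial.C).map (Polynomial.eval t) = A := by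
    intro t A
    ext i j
    simp
  have hmapA : ∀ t i, (Y * (w i : Matrix n n k).map Polynomial.C -
      (w i : Matrix n n k).map Polynomial.C * Y).map (Polynomial.eval t)
      = ad (y + t • (s - y)) (w i) := by
    intro t i
    rw [had, hmapsub, hmapmul, hmapmul, hY, hC]
  have hmapB : ∀ t i, (Y ^ g i).map (Polynomial.eval t) = (y + t • (s - y)) ^ g i := by
    intro t i
    rw [← hY]
    exact map_pow (Polynomial.evalRingHom t).mapMatrix Y (g i)
  obtain ⟨q₁, hq₁, h₁⟩ := exists_polynomial_linearIndependent
    (fun i => Y * (w i : Matrix n n k).map Polynomial.C - (w i : Matrix n n k).map Polynomial.C * Y)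
    0 (by
      simp only [hmapA, zero_smul, add_zero, hw]
      exact B.linearIndependent.map' (LinearMap.range (ad y)).subtype (Submodule.ker_subtype _))
  obtain ⟨q₂, hq₂, h₂⟩ := exists_polynomial_linearIndependent (fun i => Y ^ g i) 1 (by
      simp only [hmapB, one_smul, add_sub_cancel]
      exact hli)
  -- At a generic point `z` of the line the rank of `ad z` is at least that of `ad y`, as at
  -- parameter 0, and the powers of `z` are independent, as at parameter 1. Hence the centralizer of
  -- `y` is at least as large as that of `z`, which has dimension at least `d`.
  obtain ⟨t, ht⟩ : ∃ t, (q₁ * q₂).eval t ≠ 0 := by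
    by_contra! hcon
    exact mul_ne_zero hq₁ hq₂ (Polynomial.funext fun t => by rw [hcon t, Polynomial.eval_zero])
  rw [Polynomial.eval_mul] at ht
  have h₁' := h₁ t (left_ne_zero_of_mul ht)
  have h₂' := h₂ t (right_ne_zero_of_mul ht)
  simp only [hmapA] at h₁'
  simp only [hmapB] at h₂'
  set z := y + t • (s - y) with hz
  have hzl : z ∈ l := l.add_mem hy (l.smul_mem t (l.sub_mem hs hy))
  have hd : d ≤ Module.finrank k (LinearMap.ker (ad z)) := by
    rw [← hker]
    have h3 : LinearIndependent k (fun i => (⟨z ^ g i, mem_matCentralizer.2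
        ⟨hpow z hzl i, (pow_succ' z _).symm.trans (pow_succ z _)⟩⟩ : matCentralizer l z)) :=
      LinearIndependent.of_comp (matCentralizer l z).subtype h₂'
    simpa using h3.fintype_card_le_finrank
  have hr : e ≤ Module.finrank k (LinearMap.range (ad z)) := by
    have h3 : LinearIndependent k (fun i => (⟨ad z (w i), ⟨w i, rfl⟩⟩ : LinearMap.range (ad z))) :=
      LinearIndependent.of_comp (LinearMap.range (ad z)).subtype h₁'
    simpa using h3.fintype_card_le_finrank
  have h4 := LinearMap.finrank_range_add_finrank_ker (ad y)
  have h5 := LinearMap.finrank_range_add_finrank_ker (ad z)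
  rw [hker]
  omega

variable {a : ℕ}

lemma diagonal_pow' (t : Fin a → k) (j : ℕ) :
    Matrix.diagonal t ^ j = Matrix.diagonal (fun i => t i ^ j) := by
  rw [Matrix.diagonal_pow]
  rfl

/-- The powers of a diagonal matrix with distinct entries are independent by Vandermonde. -/
lemma le_finrank_centralizer_top [Infinite k] (y : Matrix (Fin a) (Fin a) k) :
    a ≤ Module.finrank k (matCentralizer ⊤ y) := by
  let t : Fin a → k := fun i => Infinite.natEmbedding k i
  have ht : Function.Injective t := fun i j h =>
    Fin.ext ((Infinite.natEmbedding k).injective h)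
  refine le_finrank_centralizer (fun i : Fin a => (i : ℕ)) (fun _ _ _ => Submodule.mem_top)
    (s := Matrix.diagonal t) Submodule.mem_top ?_ Submodule.mem_top
  rw [Fintype.linearIndependent_iff]
  intro c hc i
  refine congrFun (Matrix.eq_zero_of_forall_index_sum_mul_pow_eq_zero (v := c) ht fun j => ?_) i
  have := congrFun (congrFun hc j) j
  simpa [diagonal_pow', Matrix.sum_apply] using this

lemma transpose_pow_mul {B X : Matrix n n k} (h : Xᵀ * B + B * X = 0) (j : ℕ) :
    (X ^ j)ᵀ * B = (-1 : k) ^ j • (B * X ^ j) := by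
  have h1 : Xᵀ * B = -(B * X) := eq_neg_of_add_eq_zero_left h
  induction j with
  | zero => simp
  | succ j ih =>
    rw [pow_succ, Matrix.transpose_mul, Matrix.mul_assoc, ih, Matrix.mul_smul, ← Matrix.mul_assoc,
      h1, Matrix.neg_mul, pow_succ, mul_neg_one, neg_smul, smul_neg, Matrix.mul_assoc, ← pow_succ',
      ← pow_succ]

lemma odd_pow_mem_skewMatrices {B X : Matrix n n k} (h : X ∈ skewMatrices B) {j : ℕ}
    (hj : Odd j) : X ^ j ∈ skewMatrices B := by
  rw [mem_skewMatrices, transpose_pow_mul h, hj.neg_one_pow, neg_smul, one_smul,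
    neg_add_cancel]

/-- Centralizers in an orthogonal or symplectic Lie algebra, for an antidiagonal form. -/
lemma le_finrank_centralizer_skew [IsAlgClosed k] {B : Matrix (Fin a) (Fin a) k}
    (hB : ∀ i j, j ≠ Fin.rev i → B i j = 0) {y : Matrix (Fin a) (Fin a) k}
    (hy : y ∈ skewMatrices B) :
    a / 2 ≤ Module.finrank k (matCentralizer (skewMatrices B) y) := by
  have hinf : Infinite {x : k // x ≠ 0} := (Set.finite_singleton (0 : k)).infinite_compl.to_subtype
  let ν := Infinite.natEmbedding {x : k // x ≠ 0}
  choose sq hsq using fun x : k => IsAlgClosed.exists_pow_nat_eq x (n := 2) (by norm_num)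
  let τ : ℕ → k := fun i => sq (ν i)
  have hτ2 : ∀ i, τ i ^ 2 = ν i := fun i => hsq _
  have hτ0 : ∀ i, τ i ≠ 0 := by
    intro i h0
    have := hτ2 i
    rw [h0, zero_pow (by norm_num)] at this
    exact (ν i).2 this.symm
  -- Opposite positions carry opposite eigenvalues, with 0 in the middle for odd `a`. This is what
  -- skewness for an antidiagonal form requires.
  let t : Fin a → k := fun i => if (i : ℕ) < a / 2 then τ i else
    if a - 1 - (i : ℕ) < a / 2 then -τ (a - 1 - i) else 0
  have ht : ∀ i, t (Fin.rev i) = -t i := by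
    intro i
    have hi : ((Fin.rev i : Fin a) : ℕ) = a - 1 - i := by rw [Fin.val_rev]; omega
    simp only [t, hi]
    by_cases h1 : (i : ℕ) < a / 2
    · rw [if_neg (by omega), if_pos (by omega), if_pos h1, show a - 1 - (a - 1 - (i : ℕ)) = i by
        omega]
    · by_cases h2 : a - 1 - (i : ℕ) < a / 2
      · rw [if_pos h2, if_neg h1, if_pos h2, neg_neg]
      · rw [if_neg h2, if_neg (by omega), if_neg h1, if_neg h2, neg_zero]
  have hs : Matrix.diagonal t ∈ skewMatrices B := by
    rw [mem_skewMatrices, Matrix.diagonal_transpose]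
    ext i j
    rw [Matrix.add_apply, Matrix.diagonal_mul, Matrix.mul_diagonal, Matrix.zero_apply]
    by_cases hij : j = Fin.rev i
    · rw [hij, ht]
      ring
    · rw [hB i j hij]
      ring
  refine le_finrank_centralizer (fun i : Fin (a / 2) => 2 * (i : ℕ) + 1)
    (fun y hy i => odd_pow_mem_skewMatrices hy ⟨i, rfl⟩) hs ?_ hy
  rw [Fintype.linearIndependent_iff]
  intro c hc i
  -- On the first half of the diagonal the odd powers are τ_j (τ_j²)^i. The τ_j were chosen as
  -- square roots of distinct nonzero numbers, so this is a Vandermonde system up to nonzero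
  -- factors.
  have hinj : Function.Injective (fun j : Fin (a / 2) => τ j ^ 2) := by
    intro i j hij
    simp only [hτ2] at hij
    exact Fin.ext (ν.injective (Subtype.ext hij))
  refine congrFun (Matrix.eq_zero_of_forall_index_sum_mul_pow_eq_zero (v := c) hinj fun j => ?_) i
  let j' : Fin a := ⟨j, by omega⟩
  have h1 := congrFun (congrFun hc j') j'
  simp only [diagonal_pow', Matrix.sum_apply, Matrix.smul_apply, Matrix.diagonal_apply_eq,
    smul_eq_mul, Matrix.zero_apply] at h1
  have h2 : t j' = τ j := if_pos j.2
  rw [h2] at h1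
  refine (mul_eq_zero.1 (?_ : τ j * _ = 0)).resolve_left (hτ0 j)
  rw [← h1, Finset.mul_sum]
  refine Finset.sum_congr rfl fun l _ => ?_
  ring

end LowerBounds

/-! ## Commutants and intertwining embeddings -/

section Commutants

universe u
variable {k : Type u} [Field k] {β γ : Type*} [Fintype β] [DecidableEq β] [Fintype γ]
  [DecidableEq γ]

lemma IsTangent.commute {T : Type*} {p : T → GL β k} {X A : Matrix β β k} (hX : IsTangent p X)
    (h : ∀ t, A * (p t : Matrix β β k) = (p t : Matrix β β k) * A) : A * X = X * A := by
  have h1 : HasDM p X (fun t => A * (p t : Matrix β β k)) A (A * X) :=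
    ((HasDM.const A).mul HasDM.base).congr (fun _ => rfl) (by simp) (by simp)
  have h2 : HasDM p X (fun t => (p t : Matrix β β k) * A) A (X * A) :=
    (HasDM.base.mul (HasDM.const A)).congr (fun _ => rfl) (by simp) (by simp)
  exact HasDM.unique hX h h1 h2

lemma exists_eq_smul_one_of_commute_trace_zero {T : Matrix β β k}
    (h : ∀ X : Matrix β β k, X.trace = 0 → T * X = X * T) : ∃ μ : k, T = μ • 1 := by
  obtain ⟨μ, hμ⟩ := Matrix.mem_range_scalar_of_commute_single (M := T) fun i j hij =>
    (h _ (by rw [Matrix.trace_single_eq_of_ne _ _ _ hij])).symm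
  exact ⟨μ, by rw [← hμ, Matrix.smul_one_eq_diagonal]; rfl⟩

/-- Skew matrices for `B` are exactly `B⁻¹ * Y` with `Yᵀ = -(ε • Y)`. The condition of commuting
thus becomes a relation between `T` and its conjugate `B * T * B⁻¹` that can be tested on matrix
units. -/
lemma mul_eq_mul_of_commute_skew {B T : Matrix β β k} {ε : k} (hε : ε ^ 2 = 1) (hB : B.det ≠ 0)
    (hBt : Bᵀ = ε • B) (h : ∀ X ∈ skewMatrices B, T * X = X * T) {Y : Matrix β β k}
    (hY : Yᵀ = -(ε • Y)) : (B * T * B⁻¹) * Y = Y * T := by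
  have hu : IsUnit B.det := isUnit_iff_ne_zero.2 hB
  have h1 : B⁻¹ * Y ∈ skewMatrices B := by
    have h2 : (B⁻¹ * Y)ᵀ * B = -Y := by
      have : (B⁻¹ * Y)ᵀ * Bᵀ = Yᵀ := by
        rw [← Matrix.transpose_mul, Matrix.mul_nonsing_inv_cancel_left _ _ hu]
      rw [hBt, Matrix.mul_smul, hY] at this
      have h3 := congrArg (fun Z => ε • Z) this
      simpa only [smul_smul, smul_neg, ← sq, hε, one_smul] using h3
    rw [mem_skewMatrices, h2, Matrix.mul_nonsing_inv_cancel_left _ _ hu, neg_add_cancel]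
  have h4 := congrArg (fun Z => B * Z) (h _ h1)
  rw [← Matrix.mul_assoc B (B⁻¹ * Y), Matrix.mul_nonsing_inv_cancel_left _ _ hu] at h4
  rw [← h4]
  simp only [Matrix.mul_assoc]

lemma eq_smul_one_of_apply {T : Matrix β β k} (h1 : ∀ i j, i ≠ j → T i j = 0)
    (h2 : ∀ i j, T i i = T j j) : ∃ μ : k, T = μ • 1 := by
  rcases isEmpty_or_nonempty β with hβ | ⟨⟨i₀⟩⟩
  · exact ⟨0, Subsingleton.elim _ _⟩
  · refine ⟨T i₀ i₀, Matrix.ext fun i j => ?_⟩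
    rcases eq_or_ne i j with rfl | hij
    · simp [h2 i i₀]
    · simp [h1 i j hij, Matrix.one_apply_ne hij]

lemma exists_eq_smul_one_of_commute_symplectic {B T : Matrix β β k} (hB : B.det ≠ 0)
    (hBt : Bᵀ = (-1 : k) • B) (h : ∀ X ∈ skewMatrices B, T * X = X * T) :
    ∃ μ : k, T = μ • 1 := by
  have key := fun (Y : Matrix β β k) (hY : Yᵀ = -((-1 : k) • Y)) =>
    mul_eq_mul_of_commute_skew (by norm_num) hB hBt h hY
  set T' := B * T * B⁻¹ with hT'
  have hd : ∀ i, T' * Matrix.single i i 1 = Matrix.single i i 1 * T := fun i => key _ (by simp)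
  have ho : ∀ i j, T' * (Matrix.single i j 1 + Matrix.single j i 1)
      = (Matrix.single i j 1 + Matrix.single j i 1) * T := fun i j => key _ (by simp [add_comm])
  have hTT : ∀ i, T' i i = T i i := by
    intro i
    have := congrFun (congrFun (hd i) i) i
    simpa using this
  have hoff : ∀ i j, i ≠ j → T i j = 0 := by
    intro i j hij
    have := congrFun (congrFun (hd i) i) j
    simpa [hij.symm, hij] using this.symm
  refine eq_smul_one_of_apply hoff fun i j => ?_
  rcases eq_or_ne i j with rfl | hij
  · rfl
  have := congrFun (congrFun (ho i j) i) j
  simpa [Matrix.mul_add, Matrix.add_mul, hij, hij.symm, hTT] using this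

/-- Alternating matrix units involve two different indices; a third index is needed to compare
diagonal entries and to isolate off-diagonal ones. In size 2 the Lie algebra is commutative and the
conclusion fails. -/
lemma exists_eq_smul_one_of_commute_orthogonal {B T : Matrix β β k} (hβ : 3 ≤ Fintype.card β)
    (hB : B.det ≠ 0) (hBt : Bᵀ = (1 : k) • B) (h : ∀ X ∈ skewMatrices B, T * X = X * T) :
    ∃ μ : k, T = μ • 1 := by
  have key := fun (Y : Matrix β β k) (hY : Yᵀ = -((1 : k) • Y)) =>
    mul_eq_mul_of_commute_skew (by norm_num) hB hBt h hY
  set T' := B * T * B⁻¹ with hT'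
  have ho : ∀ i j, T' * (Matrix.single i j 1 - Matrix.single j i 1)
      = (Matrix.single i j 1 - Matrix.single j i 1) * T := fun i j => key _ (by simp)
  have hthird : ∀ i j : β, ∃ l, l ≠ i ∧ l ≠ j := by
    intro i j
    have : ({i, j} : Finset β).card < (Finset.univ : Finset β).card :=
      lt_of_le_of_lt Finset.card_le_two (by rw [Finset.card_univ]; omega)
    obtain ⟨l, -, hl⟩ := Finset.exists_mem_notMem_of_card_lt_card this
    simp only [Finset.mem_insert, Finset.mem_singleton, not_or] at hl
    exact ⟨l, hl.1, hl.2⟩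
  have hdiag : ∀ i j, i ≠ j → T' i i = T j j := by
    intro i j hij
    have := congrFun (congrFun (ho i j) i) j
    simpa [Matrix.mul_sub, Matrix.sub_mul, hij, hij.symm] using this
  refine eq_smul_one_of_apply (fun i j hij => ?_) fun i j => ?_
  · obtain ⟨l, hl, hl'⟩ := hthird i j
    have := congrFun (congrFun (ho l i) l) j
    simpa [Matrix.mul_sub, Matrix.sub_mul, hl, hl', hl.symm, hl'.symm, hij, hij.symm]
      using this.symm
  · obtain ⟨l, hl, hl'⟩ := hthird i j
    rw [← hdiag l i hl, ← hdiag l j hl']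

/-- Two embeddings of an absolutely irreducible space of matrices agree up to a scalar. -/
lemma exists_smul_of_intertwine [Nonempty β] {𝔪 : Submodule k (Matrix β β k)}
    (hcomm : ∀ T : Matrix β β k, (∀ X ∈ 𝔪, T * X = X * T) → ∃ μ : k, T = μ • 1)
    {X₀ : Matrix β β k} (hX₀ : X₀ ∈ 𝔪) (hdet : X₀.det ≠ 0) {P A : Matrix γ β k}
    {Q A' : Matrix β γ k} {h h' : Matrix β β k} (hQP : Q * P = 1) (hAA : A' * A = 1)
    (hh : h' * h = 1) (hX : ∀ X ∈ 𝔪, A * X * A' = P * (h * X * h') * Q) :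
    ∃ μ : k, μ ≠ 0 ∧ A = μ • (P * h) ∧ A' = μ⁻¹ • (h' * Q) := by
  have hu : IsUnit X₀.det := isUnit_iff_ne_zero.2 hdet
  have h1 : ∀ X ∈ 𝔪, A * X = P * h * X * (h' * Q * A) := by
    intro X hXm
    calc A * X = A * X * (A' * A) := by rw [hAA, Matrix.mul_one]
      _ = (A * X * A') * A := by simp only [Matrix.mul_assoc]
      _ = _ := by rw [hX X hXm]; simp only [Matrix.mul_assoc]
  -- Schur's lemma: the composite of one embedding with the left inverse of the other commutes with
  -- `𝔪`.
  obtain ⟨μ, hμ⟩ := hcomm (h' * Q * A) fun X hXm => by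
    calc h' * Q * A * X = h' * Q * (A * X) := by simp only [Matrix.mul_assoc]
      _ = h' * (Q * P) * h * X * (h' * Q * A) := by rw [h1 X hXm]; simp only [Matrix.mul_assoc]
      _ = X * (h' * Q * A) := by rw [hQP, Matrix.mul_one, hh, Matrix.one_mul]
  have hA : A = μ • (P * h) := by
    -- The invertible element `X₀` of `𝔪` is cancelled to compare the embeddings themselves.
    have h2 := congrArg (fun Z => Z * X₀⁻¹) (h1 X₀ hX₀)
    simp only [hμ, Matrix.mul_smul, Matrix.smul_mul, Matrix.mul_one] at h2
    rwa [Matrix.mul_nonsing_inv_cancel_right _ _ hu,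
      Matrix.mul_nonsing_inv_cancel_right _ _ hu] at h2
  have h3 : μ • (A' * (P * h)) = 1 := by rw [← Matrix.mul_smul, ← hA, hAA]
  have hμ0 : μ ≠ 0 := by
    rintro rfl
    rw [zero_smul] at h3
    exact zero_ne_one h3
  have h4 : A' * (P * h) = μ⁻¹ • 1 := by rw [← h3, smul_smul, inv_mul_cancel₀ hμ0, one_smul]
  refine ⟨μ, hμ0, hA, ?_⟩
  have h5 : X₀ * A' = X₀ * (μ⁻¹ • (h' * Q)) := by
    calc X₀ * A' = A' * A * X₀ * A' := by rw [hAA, Matrix.one_mul]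
      _ = A' * (A * X₀ * A') := by simp only [Matrix.mul_assoc]
      _ = A' * (P * h) * X₀ * h' * Q := by rw [hX X₀ hX₀]; simp only [Matrix.mul_assoc]
      _ = _ := by
        rw [h4]
        simp only [Matrix.smul_mul, Matrix.one_mul, Matrix.mul_smul, Matrix.mul_assoc]
  have h6 := congrArg (fun Z => X₀⁻¹ * Z) h5
  simpa only [Matrix.nonsing_inv_mul_cancel_left _ _ hu] using h6

lemma pow_mul_eq_mul_pow {g : Matrix γ γ k} {P : Matrix γ β k} {u : Matrix β β k}
    (h : g * P = P * u) (n : ℕ) : g ^ n * P = P * u ^ n := by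
  induction n with
  | zero => simp
  | succ n ih => rw [pow_succ, Matrix.mul_assoc, h, ← Matrix.mul_assoc, ih, Matrix.mul_assoc,
      ← pow_succ]

lemma pow_eq_smul_one_of_mul_eq {g : Matrix γ γ k} {P : Matrix γ β k} {Q : Matrix β γ k}
    {u : Matrix β β k} (hQP : Q * P = 1) (h : g * P = P * u) {n : ℕ} {c : k}
    (hg : g ^ n = c • 1) : u ^ n = c • 1 := by
  have h1 := pow_mul_eq_mul_pow h n
  have h2 := congrArg (fun Z => Q * Z) h1
  simp only [← Matrix.mul_assoc, hQP, Matrix.one_mul] at h2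
  rw [← h2, hg, Matrix.mul_smul, Matrix.mul_one, Matrix.smul_mul, hQP]

/-- The action of `g γ(g)` on a subspace on which `Int g ∘ γ` restricts to an inner or an outer
automorphism. -/
lemma mul_contra_mul_eq {g : GL γ k} {P : Matrix γ β k} {Q : Matrix β γ k} {h h' K K' : Matrix β β k}
    (hK : K * K' = 1) {μ : k} (hμ : μ ≠ 0)
    (h₁ : (g : Matrix γ γ k) * Qᵀ * K = μ • (P * h))
    (h₂ : K' * Pᵀ * ((g⁻¹ : GL γ k) : Matrix γ γ k) = μ⁻¹ • (h' * Q)) :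
    ((g : Matrix γ γ k) * (contra g : Matrix γ γ k)) * P = P * (h * K' * h'ᵀ * Kᵀ) := by
  have e1 : (contra g : Matrix γ γ k) = (((g⁻¹ : GL γ k) : Matrix γ γ k))ᵀ := rfl
  have hKt : K'ᵀ * Kᵀ = 1 := by rw [← Matrix.transpose_mul, hK, Matrix.transpose_one]
  have h3 : (contra g : Matrix γ γ k) * P * K'ᵀ = μ⁻¹ • (Qᵀ * h'ᵀ) := by
    rw [← Matrix.transpose_mul, ← Matrix.transpose_smul, ← h₂, e1, Matrix.transpose_mul,
      Matrix.transpose_mul, Matrix.transpose_transpose, Matrix.mul_assoc]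
  have h4 : (contra g : Matrix γ γ k) * P = μ⁻¹ • (Qᵀ * h'ᵀ * Kᵀ) := by
    have := congrArg (fun Z => Z * Kᵀ) h3
    simpa only [Matrix.mul_assoc, hKt, Matrix.mul_one, Matrix.smul_mul] using this
  have h5 : (g : Matrix γ γ k) * Qᵀ = μ • (P * h * K') := by
    have := congrArg (fun Z => Z * K') h₁
    simpa only [Matrix.mul_assoc, hK, Matrix.mul_one, Matrix.smul_mul] using this
  calc ((g : Matrix γ γ k) * (contra g : Matrix γ γ k)) * P
      = μ⁻¹ • (((g : Matrix γ γ k) * Qᵀ) * h'ᵀ * Kᵀ) := by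
        rw [Matrix.mul_assoc, h4, Matrix.mul_smul]
        simp only [Matrix.mul_assoc]
    _ = _ := by
        rw [h5]
        simp only [Matrix.smul_mul, smul_smul, inv_mul_cancel₀ hμ, one_smul, Matrix.mul_assoc]

/-- A standard embedding of an irreducible Lie algebra preserving a form rescales the forms. -/
lemma exists_form_scale [Nonempty β] {B : Matrix β β k} {C : Matrix γ γ k} (hB : B.det ≠ 0)
    (hcomm : ∀ T : Matrix β β k, (∀ X ∈ skewMatrices B, T * X = X * T) → ∃ μ : k, T = μ • 1)
    {X₀ : Matrix β β k} (hX₀ : X₀ ∈ skewMatrices B) (hdet : X₀.det ≠ 0)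
    {P : Matrix γ β k} {Q : Matrix β γ k} (hQP : Q * P = 1)
    (hC : C.det ≠ 0) (h : ∀ X ∈ skewMatrices B, P * X * Q ∈ skewMatrices C) :
    ∃ ν : k, ν ≠ 0 ∧ Pᵀ * C * P = ν • B := by
  have hu : IsUnit B.det := isUnit_iff_ne_zero.2 hB
  have hskew : ∀ X ∈ skewMatrices B, Xᵀ = -(B * X * B⁻¹) := by
    intro X hX
    have h1 : Xᵀ * B = -(B * X) := eq_neg_of_add_eq_zero_left (mem_skewMatrices.1 hX)
    rw [← Matrix.neg_mul, ← h1, Matrix.mul_nonsing_inv_cancel_right _ _ hu]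
  have hCP : ∀ X ∈ skewMatrices B, C * P * X = -(Qᵀ * (Xᵀ * (Pᵀ * C * P))) := by
    intro X hX
    have h1 := eq_neg_of_add_eq_zero_right (mem_skewMatrices.1 (h X hX))
    have h2 := congrArg (fun Z => Z * P) h1
    simp only [Matrix.transpose_mul, Matrix.neg_mul] at h2
    calc C * P * X = C * (P * X * Q) * P := by
          simp only [Matrix.mul_assoc, hQP, Matrix.mul_one]
      _ = _ := by rw [h2]; simp only [Matrix.mul_assoc]
  -- Both `B` and the restriction of `C` are invariant under the irreducible Lie algebra, so their
  -- quotient is a scalar by Schur's lemma.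
  obtain ⟨ν, hν⟩ := hcomm (B⁻¹ * (Pᵀ * C * P)) fun X hX => by
    have h1 := congrArg (fun Z => Pᵀ * Z) (hCP X hX)
    have hPQ : Pᵀ * Qᵀ = 1 := by rw [← Matrix.transpose_mul, hQP, Matrix.transpose_one]
    simp only [Matrix.mul_neg, ← Matrix.mul_assoc Pᵀ Qᵀ, hPQ, Matrix.one_mul] at h1
    rw [hskew X hX, Matrix.neg_mul, neg_neg] at h1
    calc B⁻¹ * (Pᵀ * C * P) * X = B⁻¹ * (Pᵀ * (C * P * X)) := by simp only [Matrix.mul_assoc]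
      _ = B⁻¹ * B * X * B⁻¹ * (Pᵀ * C * P) := by rw [h1]; simp only [Matrix.mul_assoc]
      _ = _ := by rw [Matrix.nonsing_inv_mul _ hu, Matrix.one_mul, Matrix.mul_assoc]
  have hS : Pᵀ * C * P = ν • B := by
    have := congrArg (fun Z => B * Z) hν
    simpa only [Matrix.mul_nonsing_inv_cancel_left _ _ hu, Matrix.mul_smul, Matrix.mul_one]
      using this
  refine ⟨ν, ?_, hS⟩
  -- If `C` vanished on the image of `P`, then `C * P * X₀` would be zero, although `C` and `X₀` are
  -- invertible and `P` is injective.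
  rintro rfl
  have h1 := hCP X₀ hX₀
  rw [hS, zero_smul, Matrix.mul_zero, Matrix.mul_zero, neg_zero] at h1
  have h2 := congrArg (fun Z => Q * (C⁻¹ * Z) * X₀⁻¹) h1
  simp only [Matrix.mul_assoc, Matrix.nonsing_inv_mul_cancel_left _ _ (isUnit_iff_ne_zero.2 hC),
    Matrix.mul_zero, Matrix.zero_mul, Matrix.mul_nonsing_inv _ (isUnit_iff_ne_zero.2 hdet),
    Matrix.mul_one, hQP] at h2
  exact one_ne_zero h2

/-- Conjugation by `y` carries matrices skew for `yᵀ B y` to matrices skew for `B`. -/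
lemma isLieModel_conj_skew {B y : Matrix β β k} (hy : y.det ≠ 0) :
    IsLieModel (skewMatrices (yᵀ * B * y)) (skewMatrices B)
      (LinearMap.mulLeft k y ∘ₗ LinearMap.mulRight k y⁻¹) ∧
    IsLieModel (⊤ : Submodule k (Matrix β β k)) ⊤
      (LinearMap.mulLeft k y ∘ₗ LinearMap.mulRight k y⁻¹) := by
  have hu : IsUnit y.det := isUnit_iff_ne_zero.2 hy
  have hyt : IsUnit yᵀ.det := by rwa [Matrix.det_transpose]
  set δ : Matrix β β k →ₗ[k] Matrix β β k := LinearMap.mulLeft k y ∘ₗ LinearMap.mulRight k y⁻¹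
    with hδ
  have hδa : ∀ X, δ X = y * (X * y⁻¹) := fun X => rfl
  have hinv : ∀ Z, δ (y⁻¹ * Z * y) = Z := by
    intro Z
    rw [hδa, Matrix.mul_nonsing_inv_cancel_right _ _ hu, Matrix.mul_nonsing_inv_cancel_left _ _ hu]
  have hinv' : ∀ X, y⁻¹ * δ X * y = X := by
    intro X
    rw [hδa, Matrix.nonsing_inv_mul_cancel_left _ _ hu, Matrix.nonsing_inv_mul_cancel_right _ _ hu]
  have hmul : ∀ X Y, δ X * δ Y = δ (X * Y) := by
    intro X Y
    rw [hδa, hδa, hδa]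
    simp only [Matrix.mul_assoc, Matrix.nonsing_inv_mul_cancel_left _ _ hu]
  have hinj : ∀ X Y, δ X = δ Y → X = Y := by
    intro X Y h
    rw [← hinv' X, h, hinv']
  have hskew : ∀ Z, yᵀ * (Zᵀ * B + B * Z) * y
      = (y⁻¹ * Z * y)ᵀ * (yᵀ * B * y) + (yᵀ * B * y) * (y⁻¹ * Z * y) := by
    intro Z
    have e1 : (y⁻¹)ᵀ * yᵀ = 1 := by
      rw [← Matrix.transpose_mul, Matrix.mul_nonsing_inv _ hu, Matrix.transpose_one]
    have e2 : ∀ W : Matrix β β k, (y⁻¹)ᵀ * (yᵀ * W) = W := by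
      intro W
      rw [← Matrix.mul_assoc, e1, Matrix.one_mul]
    simp only [Matrix.transpose_mul, Matrix.mul_assoc, Matrix.mul_add, Matrix.add_mul, e2,
      Matrix.mul_nonsing_inv_cancel_left _ _ hu]
  have hmem : ∀ Z, Z ∈ skewMatrices B ↔ y⁻¹ * Z * y ∈ skewMatrices (yᵀ * B * y) := by
    intro Z
    rw [mem_skewMatrices, mem_skewMatrices, ← hskew]
    constructor
    · intro h
      rw [h, Matrix.mul_zero, Matrix.zero_mul]
    · intro h
      have h1 := congrArg (fun W => yᵀ⁻¹ * (W * y⁻¹)) h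
      simpa only [Matrix.mul_assoc, Matrix.mul_nonsing_inv _ hu, Matrix.mul_one, Matrix.zero_mul,
        Matrix.mul_zero, Matrix.nonsing_inv_mul_cancel_left _ _ hyt] using h1
  refine ⟨⟨fun X hX => ?_, fun Z hZ => ⟨_, (hmem Z).1 hZ, hinv Z⟩, fun X _ h => ?_,
    fun X _ Y _ => ?_⟩, ⟨fun X hX => trivial, fun Z _ => ⟨_, trivial, hinv Z⟩, fun X _ h => ?_,
    fun X _ Y _ => ?_⟩⟩
  · rwa [hmem, hinv']
  · exact hinj _ _ (by rw [h, map_zero])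
  · rw [hmul, hmul]
    exact ⟨hinj _ _, fun h => by rw [h]⟩
  · exact hinj _ _ (by rw [h, map_zero])
  · rw [hmul, hmul]
    exact ⟨hinj _ _, fun h => by rw [h]⟩

end Commutants

/-! ## Antidiagonal forms and the Lie algebras of the classical groups -/

section ClassicalLieAlgebras

universe u
variable {k : Type u} [Field k] {a N : ℕ}

lemma det_ne_zero_of_antidiagonal {B : Matrix (Fin a) (Fin a) k}
    (h0 : ∀ i j, j ≠ Fin.rev i → B i j = 0) (h1 : ∀ i, B i (Fin.rev i) ≠ 0) : B.det ≠ 0 := by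
  have h2 : B.submatrix id Fin.revPerm = Matrix.diagonal fun i => B i (Fin.rev i) := by
    ext i j
    rcases eq_or_ne i j with rfl | hij
    · simp
    · rw [Matrix.diagonal_apply_ne _ hij]
      exact h0 _ _ fun h => hij (Fin.rev_injective h).symm
  have h3 := Matrix.det_permute' Fin.revPerm B
  rw [h2, Matrix.det_diagonal] at h3
  intro h4
  rw [h4, mul_zero] at h3
  exact Finset.prod_ne_zero_iff.2 (fun i _ => h1 i) h3

lemma antidiag_apply_of_ne (i j : Fin a) (h : j ≠ Fin.rev i) : antidiag k a i j = 0 := if_neg h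

lemma skewAntidiag_apply_of_ne (i j : Fin a) (h : j ≠ Fin.rev i) : skewAntidiag k a i j = 0 :=
  if_neg h

lemma det_antidiag : (antidiag k a).det ≠ 0 :=
  det_ne_zero_of_antidiagonal antidiag_apply_of_ne fun i => by simp [antidiag]

lemma det_skewAntidiag : (skewAntidiag k a).det ≠ 0 :=
  det_ne_zero_of_antidiagonal skewAntidiag_apply_of_ne fun i => by
    simp only [skewAntidiag, if_true]
    split_ifs <;> simp

lemma transpose_antidiag : (antidiag k a)ᵀ = (1 : k) • antidiag k a := by
  ext i j
  rw [one_smul, Matrix.transpose_apply, antidiag, antidiag]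
  exact if_congr ⟨fun h => by rw [h, Fin.rev_rev], fun h => by rw [h, Fin.rev_rev]⟩ rfl rfl

lemma ne_rev_of_even (ha : Even a) (i : Fin a) : i ≠ Fin.rev i := by
  intro h
  have := congrArg Fin.val h
  rw [Fin.val_rev] at this
  obtain ⟨c, hc⟩ := ha
  omega

lemma transpose_skewAntidiag (ha : Even a) :
    (skewAntidiag k a)ᵀ = (-1 : k) • skewAntidiag k a := by
  ext i j
  rw [Matrix.transpose_apply, Matrix.smul_apply, skewAntidiag, skewAntidiag]
  by_cases h : j = Fin.rev i
  · have h' : i = Fin.rev j := by rw [h, Fin.rev_rev]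
    have hij : i ≠ j := h ▸ ne_rev_of_even ha i
    rw [if_pos h, if_pos h']
    rcases lt_or_gt_of_ne hij with h3 | h3
    · simp [h3, h3.not_gt]
    · simp [h3, h3.not_gt]
  · have h' : i ≠ Fin.rev j := fun h' => h (by rw [h', Fin.rev_rev])
    simp [h, h']

/-- An invertible skew matrix. -/
lemma exists_skew_det_ne_zero (ha : Even a) {B : Matrix (Fin a) (Fin a) k}
    (hB : ∀ i j, j ≠ Fin.rev i → B i j = 0) :
    ∃ X₀ ∈ skewMatrices B, X₀.det ≠ 0 := by
  refine ⟨Matrix.diagonal fun i => if i < Fin.rev i then 1 else -1, ?_, ?_⟩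
  · rw [mem_skewMatrices, Matrix.diagonal_transpose]
    ext i j
    rw [Matrix.add_apply, Matrix.diagonal_mul, Matrix.mul_diagonal, Matrix.zero_apply]
    by_cases h : j = Fin.rev i
    · subst h
      rw [Fin.rev_rev]
      rcases lt_or_gt_of_ne (ne_rev_of_even ha i) with h3 | h3
      · simp [h3, h3.not_gt]
      · simp [h3, h3.not_gt]
    · simp [hB i j h]
  · rw [Matrix.det_diagonal]
    refine Finset.prod_ne_zero_iff.2 fun i _ => ?_
    split_ifs <;> simp

/-- A cyclic permutation matrix; it supplies the invertible element required in
`exists_smul_of_intertwine`. -/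
lemma exists_trace_eq_zero_det_ne_zero (ha : 2 ≤ a) :
    ∃ X₀ : Matrix (Fin a) (Fin a) k, X₀.trace = 0 ∧ X₀.det ≠ 0 := by
  obtain ⟨b, rfl⟩ := Nat.exists_eq_add_of_le' ha
  refine ⟨(finRotate (b + 2)).permMatrix k, ?_, ?_⟩
  · refine Finset.sum_eq_zero fun i _ => ?_
    simp [Matrix.diag, Equiv.Perm.permMatrix, PEquiv.toMatrix_apply]
  · rw [Matrix.det_permutation]
    rcases Int.units_eq_one_or (Equiv.Perm.sign (finRotate (b + 2))) with h | h <;> simp [h]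

/-- The traceless matrices. -/
abbrev traceless (k : Type*) [Field k] (a : ℕ) : Submodule k (Matrix (Fin a) (Fin a) k) :=
  LinearMap.ker (Matrix.traceLinearMap (Fin a) k k)

variable [Infinite k]

lemma isTangent_slOrGl_iff (full : Bool) {X : Matrix (Fin a) (Fin a) k} :
    IsTangent (fun x : slOrGl k full a => (x : GL (Fin a) k)) X ↔
      X ∈ (if full then ⊤ else traceless k a) := by
  cases full
  · exact ⟨fun h => trace_eq_zero_of_isTangent (fun x => x.2) h, fun h => isTangent_slGroup h⟩
  · exact ⟨fun _ => trivial, fun _ => isTangent_top X⟩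

lemma isTangent_soGroup_iff (h2 : (2 : k) ≠ 0) {X : Matrix (Fin a) (Fin a) k} :
    IsTangent (fun x : soGroup k a => (x : GL (Fin a) k)) X ↔ X ∈ skewMatrices (antidiag k a) :=
  ⟨fun h => skew_of_isTangent (fun x => x.2.1) h, fun h => isTangent_formGroup h2 det_antidiag h⟩

lemma isTangent_spGroup_iff (h2 : (2 : k) ≠ 0) {X : Matrix (Fin a) (Fin a) k} :
    IsTangent (fun x : spGroup k a => (x : GL (Fin a) k)) X ↔
      X ∈ skewMatrices (skewAntidiag k a) :=
  ⟨fun h => skew_of_isTangent (fun x => x.2) h, fun h =>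
    (isTangent_formGroup h2 det_skewAntidiag h).mono fun x => ⟨⟨x, x.2.1⟩, rfl⟩⟩

lemma traceless_le (full : Bool) : traceless k a ≤ if full then ⊤ else traceless k a := by
  cases full
  · exact le_rfl
  · exact le_top

/-- A nilpotent matrix with a single Jordan block is regular in `𝔤𝔩_a`, and in `𝔰𝔩_a` if `a ≠ 0`
in `k`. -/
lemma finrank_centralizer_le_of_le (full : Bool) (ha : full = false → (a : k) ≠ 0)
    {E : Matrix (Fin a) (Fin a) k} (hE : Module.finrank k (matCentralizer ⊤ E) ≤ a)
    (Y : Matrix (Fin a) (Fin a) k) :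
    Module.finrank k (matCentralizer (if full then ⊤ else traceless k a) E)
      ≤ Module.finrank k (matCentralizer (if full then ⊤ else traceless k a) Y) := by
  cases full
  · change Module.finrank k (matCentralizer (traceless k a) E)
      ≤ Module.finrank k (matCentralizer (traceless k a) Y)
    -- The identity commutes with `E` and has trace `a ≠ 0`, so the centralizer of `E` becomes
    -- strictly smaller on passing to traceless matrices.
    have h1 : Module.finrank k (matCentralizer (traceless k a) E)
        < Module.finrank k (matCentralizer ⊤ E) := by
      refine Submodule.finrank_lt_finrank_of_lt (lt_of_le_of_ne ?_ ?_)
      · exact inf_le_inf_right _ le_top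
      · intro h
        have h3 : (1 : Matrix (Fin a) (Fin a) k) ∈ matCentralizer (traceless k a) E := by
          rw [h, mem_matCentralizer]
          exact ⟨trivial, by simp⟩
        have h4 : (1 : Matrix (Fin a) (Fin a) k).trace = 0 := (mem_matCentralizer.1 h3).1
        rw [Matrix.trace_one, Fintype.card_fin] at h4
        exact ha rfl h4
    have h2 := le_finrank_centralizer_top Y
    -- The centralizer of any `Y` loses at most one dimension, as the trace is a single linear
    -- condition.
    have h3 := Submodule.finrank_sup_add_finrank_inf_eq (traceless k a) (matCentralizer ⊤ Y)
    have h4 : traceless k a ⊓ matCentralizer ⊤ Y = matCentralizer (traceless k a) Y := by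
      ext Z
      rw [Submodule.mem_inf, mem_matCentralizer, mem_matCentralizer]
      simp
    have h5 := LinearMap.finrank_range_add_finrank_ker (Matrix.traceLinearMap (Fin a) k k)
    have h6 := Submodule.finrank_le (LinearMap.range (Matrix.traceLinearMap (Fin a) k k))
    have h7 := Submodule.finrank_le (traceless k a ⊔ matCentralizer ⊤ Y)
    rw [Module.finrank_self] at h6
    rw [h4] at h3
    change _ + Module.finrank k (traceless k a) = _ at h5
    omega
  · exact hE.trans (le_finrank_centralizer_top Y)

lemma conj_modelNilpotent {x : Matrix (Fin a) (Fin a) k} (hx : x.det ≠ 0) :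
    (x * (modelNilpotent k a a * x⁻¹)).trace = 0 ∧ IsNilpotent (x * (modelNilpotent k a a * x⁻¹)) ∧
      Module.finrank k (matCentralizer ⊤ (x * (modelNilpotent k a a * x⁻¹))) ≤ a := by
  have hu : IsUnit x.det := isUnit_iff_ne_zero.2 hx
  refine ⟨?_, ?_, ?_⟩
  · rw [Matrix.trace_mul_comm, Matrix.mul_assoc, Matrix.nonsing_inv_mul _ hu, Matrix.mul_one,
      trace_modelNilpotent]
  · rw [← Matrix.mul_assoc]
    exact isNilpotent_standard (Matrix.nonsing_inv_mul _ hu) isNilpotent_modelNilpotent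
  · exact le_trans (le_of_eq ((isLieModel_conj_skew (B := 0) hx).2.finrank_centralizer
      (X := modelNilpotent k a a) trivial)) finrank_centralizer_modelNilpotent_top

/-- Regular nilpotent eigenvectors in `𝔤𝔩_a`. -/
lemma exists_regular_nilpotent_top {h x : Matrix (Fin a) (Fin a) k} {α ζ : k} (hx : x.det ≠ 0)
    (hhx : h * x = x * Matrix.diagonal fun i : Fin a => α * ζ ^ (i : ℕ)) :
    ∃ E : Matrix (Fin a) (Fin a) k, E.trace = 0 ∧ IsNilpotent E ∧ h * E = ζ • (E * h) ∧
      Module.finrank k (matCentralizer ⊤ E) ≤ a := by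
  have hu : IsUnit x.det := isUnit_iff_ne_zero.2 hx
  obtain ⟨h1, h2, h3⟩ := conj_modelNilpotent hx
  refine ⟨x * (modelNilpotent k a a * x⁻¹), h1, h2, ?_, h3⟩
  have hxh : x⁻¹ * h = (Matrix.diagonal fun i : Fin a => α * ζ ^ (i : ℕ)) * x⁻¹ := by
    rw [← Matrix.mul_nonsing_inv_cancel_right x h hu, hhx, Matrix.mul_assoc,
      Matrix.nonsing_inv_mul_cancel_left _ _ hu]
  calc h * (x * (modelNilpotent k a a * x⁻¹))
      = x * ((Matrix.diagonal fun i : Fin a => α * ζ ^ (i : ℕ)) * modelNilpotent k a a) * x⁻¹ := by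
        rw [← Matrix.mul_assoc, hhx]
        simp only [Matrix.mul_assoc]
    _ = _ := by
        rw [diagonal_mul_modelNilpotent]
        simp only [Matrix.mul_assoc, hxh, Matrix.mul_smul, Matrix.smul_mul]

/-- Regular nilpotent eigenvectors in an orthogonal or symplectic Lie algebra. -/
lemma exists_regular_nilpotent_skew [IsAlgClosed k] (h2 : (2 : k) ≠ 0) {ε : k}
    {B h x : Matrix (Fin a) (Fin a) k} (hB0 : ∀ i j, j ≠ Fin.rev i → B i j = 0)
    (hBd : B.det ≠ 0) (hBt : Bᵀ = ε • B) (hh : hᵀ * B * h = B)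
    {b : ℕ} (hb : 0 < b) (hab : a ≤ b ∨ Odd b) (hab' : a ≤ b + 1) (hba : b ≤ a)
    (hε : (-1) ^ (b - 1) = ε) {α ζ : k} (h1 : α ^ 2 * ζ ^ (b - 1) = 1)
    (h3 : a ≤ b ∨ (α * ζ ^ b) ^ 2 = 1) (hx : x.det ≠ 0)
    (hhx : h * x = x * Matrix.diagonal fun i : Fin a => α * ζ ^ (i : ℕ)) :
    ∃ E ∈ skewMatrices B, IsNilpotent E ∧ h * E = ζ • (E * h) ∧
      ∀ Y ∈ skewMatrices B, Module.finrank k (matCentralizer (skewMatrices B) E)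
        ≤ Module.finrank k (matCentralizer (skewMatrices B) Y) := by
  obtain ⟨y, hy, hyB, hhy⟩ := exists_isometry_conj h2 ε
    (B₀ := modelForm k a b) (B := B) (h₀ := Matrix.diagonal fun i : Fin a => α * ζ ^ (i : ℕ))
    (by rw [transpose_modelForm hb hab, hε]) hBt (det_modelForm hab' hba) hBd
    (isometry_modelForm h1 h3) hh hx hhx
  have hu : IsUnit y.det := isUnit_iff_ne_zero.2 hy
  have hmodel := (isLieModel_conj_skew (B := B) hy).1
  rw [hyB] at hmodel
  have hE₀ : modelNilpotent k a b ∈ skewMatrices (modelForm k a b) :=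
    skew_modelNilpotent hb hab hab' hba
  have hyh : y⁻¹ * h = (Matrix.diagonal fun i : Fin a => α * ζ ^ (i : ℕ)) * y⁻¹ := by
    rw [← Matrix.mul_nonsing_inv_cancel_right y h hu, hhy, Matrix.mul_assoc,
      Matrix.nonsing_inv_mul_cancel_left _ _ hu]
  refine ⟨y * (modelNilpotent k a b * y⁻¹), hmodel.mem _ hE₀, ?_, ?_, fun Y hY => ?_⟩
  · rw [← Matrix.mul_assoc]
    exact isNilpotent_standard (Matrix.nonsing_inv_mul _ hu) isNilpotent_modelNilpotent
  · calc h * (y * (modelNilpotent k a b * y⁻¹))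
        = y * ((Matrix.diagonal fun i : Fin a => α * ζ ^ (i : ℕ)) * modelNilpotent k a b) * y⁻¹ := by
          rw [← Matrix.mul_assoc, hhy]
          simp only [Matrix.mul_assoc]
      _ = _ := by
          rw [diagonal_mul_modelNilpotent]
          simp only [Matrix.mul_assoc, hyh, Matrix.mul_smul, Matrix.smul_mul]
  · refine le_trans (le_of_eq (hmodel.finrank_centralizer hE₀)) ?_
    exact (finrank_centralizer_modelNilpotent_skew h2 hb hab hab' hba).trans
      (le_finrank_centralizer_skew hB0 hY)

end ClassicalLieAlgebras

/-! ## Special linear groups with inner automorphisms -/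

section Realized

universe u
variable {k : Type u} [Field k] {β γ : Type*} [Fintype β] [DecidableEq β] [Fintype γ]
  [DecidableEq γ] {a N : ℕ}

/-- `P` identifies `Y` with the restriction of `D` to an invariant subspace, so the squarefree
minimal polynomial of `D` annihilates `Y`. -/
lemma isSemisimple_of_intertwine [PerfectField k] {D : Matrix γ γ k} {Y : Matrix β β k}
    {P : Matrix γ β k} {Q : Matrix β γ k} (hQP : Q * P = 1) (hDP : D * P = P * Y)
    (h : Module.End.IsSemisimple (Matrix.toLin' D)) :
    Module.End.IsSemisimple (Matrix.toLin' Y) := by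
  set q := minpoly k (Matrix.toLin' D) with hq
  refine Module.End.isSemisimple_of_squarefree_aeval_eq_zero h.minpoly_squarefree ?_
  have h1 : Polynomial.aeval D q = 0 := by
    apply (Matrix.toLinAlgEquiv' (R := k) (n := γ)).injective
    rw [map_zero]
    exact (Polynomial.aeval_algHom_apply
      (Matrix.toLinAlgEquiv' (R := k) (n := γ)).toAlgHom D q).symm.trans (minpoly.aeval k _)
  have hpow : ∀ f : Polynomial k, Polynomial.aeval D f * P = P * Polynomial.aeval Y f := by
    intro f
    induction f using Polynomial.induction_on' with
    | add p q hp hq => simp only [map_add, Matrix.mul_add, Matrix.add_mul, hp, hq]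
    | monomial n c =>
      rw [Polynomial.aeval_monomial, Polynomial.aeval_monomial, ← Algebra.smul_def,
        ← Algebra.smul_def, Matrix.mul_smul, Matrix.smul_mul, pow_mul_eq_mul_pow hDP]
  have h3 : Polynomial.aeval Y q = 0 := by
    have h4 := congrArg (fun Z => Q * Z) (hpow q)
    simp only [h1, Matrix.zero_mul, Matrix.mul_zero, ← Matrix.mul_assoc, hQP,
      Matrix.one_mul] at h4
    exact h4.symm
  refine (Polynomial.aeval_algHom_apply
    (Matrix.toLinAlgEquiv' (R := k) (n := β)).toAlgHom Y q).trans ?_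
  rw [h3, map_zero]

lemma isRegularWrt_refl {Γ : Type*} [Group Γ] (ρ : Γ →* GL β k) : IsRegularWrt ρ ρ :=
  fun i j => (isRegularOn_iff_hasD 0 _).2 ⟨_, _, HasDM.base i j⟩

lemma HasOrderOn.iterate_eq {X : Type*} [Group X] {G : Subgroup X} {θ : X →* X} {m : ℕ}
    (h : HasOrderOn G θ m) {L : Subgroup X} (hL : L ≤ G) : ∀ x ∈ L, θ^[m] x = x :=
  fun x hx => (h.2 m).2 dvd_rfl x (hL hx)

lemma iterate_conj (h x : GL β k) (m : ℕ) :
    (fun y => autHom false h y)^[m] x = h ^ m * x * (h ^ m)⁻¹ := by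
  induction m with
  | zero => simp
  | succ m ih =>
    rw [Function.iterate_succ_apply', ih]
    change h * (h ^ m * x * (h ^ m)⁻¹) * h⁻¹ = _
    rw [pow_succ']
    group

lemma coe_autHom_false (h x : GL β k) : autHom false h x = h * x * h⁻¹ := rfl

/-- A standard model of a realized subgroup. -/
lemma exists_isLieModel_standard {M M₀ : Subgroup (GL (Fin a) k)} {o outer : Bool}
    {h : GL (Fin a) k} {g : GL (Fin N) k} {L : Subgroup (GL (Fin N) k)}
    (hr : IsRealized (MonoidHom.id _) M M₀ (fun x => autHom o h x) (autHom outer g) L)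
    (hM : M₀ ≤ M) (hσ : ∀ x ∈ M, autHom o h x ∈ M)
    {𝔪 : Submodule k (Matrix (Fin a) (Fin a) k)}
    (h𝔪 : ∀ X, IsTangent (fun x : M => (x : GL (Fin a) k)) X ↔ X ∈ 𝔪) :
    ∃ (δ : Matrix (Fin a) (Fin a) k →ₗ[k] Matrix (Fin N) (Fin N) k) (P : Matrix (Fin N) (Fin a) k)
      (Q : Matrix (Fin a) (Fin N) k), Q * P = 1 ∧ IsLieModel 𝔪 (lieAlg L) δ ∧
      (∀ X ∈ 𝔪, autDiff o h X ∈ 𝔪 ∧ autDiff outer g (δ X) = δ (autDiff o h X)) ∧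
      ∀ X, IsTangent (fun x : M₀ => (x : GL (Fin a) k)) X → δ X = P * X * Q := by
  obtain rfl : tangentSpace ((MonoidHom.id _).comp M.subtype) = 𝔪 :=
    Submodule.ext fun X => mem_tangentSpace.trans (h𝔪 X)
  exact hr.exists_isLieModel (MonoidHom.id _) (isRegularWrt_refl _) (isRegularWrt_refl _) hM hσ
    (autDiff o h) (fun X _ => hasDM_autHom h HasDM.base HasDM.base_inv) id
    (fun X _ => HasDM.base)

lemma autHom_mem_slOrGl (full o : Bool) (h : GL (Fin a) k) {x : GL (Fin a) k}
    (hx : x ∈ slOrGl k full a) : autHom o h x ∈ slOrGl k full a := by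
  cases full
  · have hx' : Matrix.GeneralLinearGroup.det x = 1 := hx
    change Matrix.GeneralLinearGroup.det (autHom o h x) = 1
    cases o
    · rw [coe_autHom_false, map_mul, map_mul, hx', mul_one, map_inv, mul_inv_cancel]
    · have h1 : Matrix.GeneralLinearGroup.det (contra x) = 1 := by
        ext
        have h2 : ((contra x : GL (Fin a) k) : Matrix (Fin a) (Fin a) k)
          = (((x⁻¹ : GL (Fin a) k) : Matrix (Fin a) (Fin a) k))ᵀ := rfl
        have h3 : Matrix.GeneralLinearGroup.det x⁻¹ = 1 := by rw [map_inv, hx', inv_one]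
        rw [Matrix.GeneralLinearGroup.val_det_apply, h2, Matrix.det_transpose,
          ← Matrix.GeneralLinearGroup.val_det_apply, h3]
      change Matrix.GeneralLinearGroup.det (h * contra x * h⁻¹) = 1
      rw [map_mul, map_mul, h1, mul_one, map_inv, mul_inv_cancel]
  · trivial

lemma slGroup_le_slOrGl (full : Bool) : slGroup k a ≤ slOrGl k full a := by
  cases full
  · exact le_rfl
  · exact le_top

/-- The action of `GL_a` on the sum of the natural module and its dual. -/
lemma exists_isLieModel_dual [Infinite k] {full outer : Bool}
    {h : GL (Fin a) k} {g : GL (Fin N) k} {L : Subgroup (GL (Fin N) k)}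
    (hr : IsRealized (dualHom k a) (slOrGl k full a) (slGroup k a) (fun x => autHom false h x)
      (autHom outer g) L) :
    ∃ (δ : Matrix (Fin a) (Fin a) k →ₗ[k] Matrix (Fin N) (Fin N) k)
      (P : Matrix (Fin N) (Fin a ⊕ Fin a) k) (Q : Matrix (Fin a ⊕ Fin a) (Fin N) k), Q * P = 1 ∧
      IsLieModel (if full then ⊤ else traceless k a) (lieAlg L) δ ∧
      (∀ X ∈ (if full then ⊤ else traceless k a), autDiff false h X ∈
        (if full then ⊤ else traceless k a) ∧ autDiff outer g (δ X) = δ (autDiff false h X)) ∧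
      ∀ X ∈ traceless k a, δ X = P * Matrix.fromBlocks X 0 0 (-Xᵀ) * Q := by
  have h𝔪 : tangentSpace ((MonoidHom.id _).comp (slOrGl k full a).subtype) =
      if full then ⊤ else traceless k a :=
    Submodule.ext fun X => mem_tangentSpace.trans (isTangent_slOrGl_iff full)
  rw [← h𝔪]
  have key : ∀ {T : Type u} (p : T → GL (Fin a) k) (X : Matrix (Fin a) (Fin a) k),
      HasDM p X (fun t => (dualHom k a (p t) : Matrix (Fin a ⊕ Fin a) (Fin a ⊕ Fin a) k)) 1
        (Matrix.fromBlocks X 0 0 (-Xᵀ)) := by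
    intro T p X
    refine (HasDM.fromBlocks HasDM.base (HasDM.const 0) (HasDM.const 0)
      (HasDM.base_inv.transpose)).congr (fun t => rfl) ?_ ?_
    · rw [Matrix.transpose_one, Matrix.fromBlocks_one]
    · rw [Matrix.transpose_neg]
  obtain ⟨δ, P, Q, h1, h2, h3, h4⟩ := hr.exists_isLieModel (MonoidHom.id _)
    (fun i j => (isRegularOn_iff_hasD 0 _).2 ⟨_, _, key _ 0 i j⟩)
    (fun i j => (isRegularOn_iff_hasD 0 _).2 ⟨_, _, HasDM.base (Sum.inl i) (Sum.inl j)⟩)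
    (slGroup_le_slOrGl full) (fun x hx => autHom_mem_slOrGl full false h hx)
    (autDiff false h) (fun X _ => hasDM_autHom (outer := false)
      (q := fun x : slOrGl k full a => (x : GL (Fin a) k)) h HasDM.base HasDM.base_inv)
    (fun X => Matrix.fromBlocks X 0 0 (-Xᵀ)) (fun X _ => key _ X)
  exact ⟨δ, P, Q, h1, h2, h3, fun X hX => h4 X (isTangent_slGroup hX)⟩

/-- The scalar can vanish only when the matrices are empty, and then any other scalar serves. -/
lemma exists_ne_zero_eq_smul_one {h : GL β k} {μ : k} (hμ : (h : Matrix β β k) = μ • 1) :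
    ∃ lam : k, lam ≠ 0 ∧ (h : Matrix β β k) = lam • 1 := by
  by_cases h0 : μ = 0
  · refine ⟨1, one_ne_zero, ?_⟩
    rw [h0, zero_smul] at hμ
    have h1 : (1 : Matrix β β k) = 0 := by rw [← Units.mul_inv h, hμ, Matrix.zero_mul]
    rw [hμ, one_smul, h1]
  · exact ⟨μ, h0, hμ⟩

/-- What commutes with the group commutes with its tangent vectors, and only scalars commute with
all traceless matrices. -/
lemma exists_pow_eq_smul_one_of_commute_sl [Infinite k] {h : GL (Fin a) k} {m : ℕ}
    (hc : ∀ x ∈ slGroup k a, h ^ m * x = x * h ^ m) :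
    ∃ lam : k, lam ≠ 0 ∧ (h : Matrix (Fin a) (Fin a) k) ^ m = lam • 1 := by
  obtain ⟨μ, hμ⟩ := exists_eq_smul_one_of_commute_trace_zero
    (T := (h : Matrix (Fin a) (Fin a) k) ^ m) fun X hX =>
    (isTangent_slGroup hX).commute fun x => by
      simpa using congrArg Units.val (hc x x.2)
  rw [← Units.val_pow_eq_pow_val] at hμ ⊢
  exact exists_ne_zero_eq_smul_one hμ

lemma mul_eq_smul_of_conj_eq {h : GL β k} {X Y : Matrix β β k} {ζ : k}
    (hX : (h : Matrix β β k) * X * ((h⁻¹ : GL β k) : Matrix β β k) = ζ • Y) :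
    (h : Matrix β β k) * X = ζ • (Y * h) := by
  have := congrArg (fun Z => Z * (h : Matrix β β k)) hX
  simpa only [Matrix.mul_assoc, Units.inv_mul, Matrix.mul_one, Matrix.smul_mul] using this

lemma conj_eq_of_mul_eq_smul {h : GL β k} {X Y : Matrix β β k} {ζ : k}
    (hX : (h : Matrix β β k) * X = ζ • (Y * h)) :
    (h : Matrix β β k) * X * ((h⁻¹ : GL β k) : Matrix β β k) = ζ • Y := by
  rw [hX, Matrix.smul_mul, Matrix.mul_assoc, Units.mul_inv, Matrix.mul_one]

lemma det_coe_ne_zero (h : GL β k) : (h : Matrix β β k).det ≠ 0 :=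
  ((Matrix.isUnit_iff_isUnit_det _).1 h.isUnit).ne_zero

/-- A basis of a finite dimensional space of matrices. -/
lemma exists_linearIndependent_fin {c : Submodule k (Matrix β β k)} {r : ℕ}
    (hr : Module.finrank k c = r) :
    ∃ f : Fin r → Matrix β β k, LinearIndependent k f ∧ ∀ i, f i ∈ c := by
  let B := Module.finBasisOfFinrankEq k c hr
  exact ⟨fun i => B i, B.linearIndependent.map' c.subtype (Submodule.ker_subtype c),
    fun i => (B i).2⟩

/-- Diagonalization of a matrix of finite order that acts by a primitive root of unity on a
commutative space of semisimple matrices. -/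
lemma exists_diagonal_of_pow_eq_smul_one [IsAlgClosed k] {m R : ℕ} (hm : 0 < m) {ζ : k}
    (hζ : IsPrimitiveRoot ζ m) {h : Matrix (Fin (R * m)) (Fin (R * m)) k} (hh : h.det ≠ 0)
    {lam : k} (hlam : lam ≠ 0) (hpow : h ^ m = lam • 1)
    {c : Submodule k (Matrix (Fin (R * m)) (Fin (R * m)) k)} (hR : m ≠ 1 → Module.finrank k c = R)
    (hcomm : ∀ X ∈ c, ∀ Y ∈ c, X * Y = Y * X)
    (hζc : ∀ X ∈ c, h * X = ζ • (X * h))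
    (hss : m ≠ 1 → ∀ X ∈ c, Module.End.IsSemisimple (Matrix.toLin' X))
    {α : k} (hα : α ^ m = lam) :
    ∃ (x : Matrix (Fin (R * m)) (Fin (R * m)) k), x.det ≠ 0 ∧
      h * x = x * Matrix.diagonal fun i : Fin (R * m) => α * ζ ^ (i : ℕ) := by
  -- For `m = 1` the matrix `h` is itself a scalar and `ζ = 1`, so the dimension of `c` plays no
  -- role. This absorbs the shift by one in the count for SL.
  by_cases hm1 : m = 1
  · subst hm1
    have h1 : ζ = 1 := by simpa using hζ.pow_eq_one
    refine ⟨1, by simp, ?_⟩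
    rw [pow_one] at hpow hα
    rw [Matrix.mul_one, Matrix.one_mul, hpow, Matrix.smul_one_eq_diagonal]
    simp [h1, hα]
  · obtain ⟨f, hli, hf⟩ := exists_linearIndependent_fin (hR hm1)
    obtain ⟨v, hv⟩ := exists_cyclic_family (fun i => hss hm1 _ (hf i))
      (fun i j => hcomm _ (hf i) _ (hf j)) hli hh hm hζ (fun i => hζc _ (hf i))
    exact exists_diagonal rfl hm hζ hlam hpow hv hα

/-- Type `A` with inner automorphism. -/
lemma IsLieModel.isNRegular_of_inner [IsAlgClosed k] {m R : ℕ} (hm : 0 < m) (hmk : (m : k) ≠ 0)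
    {ζ : k} (hζ : IsPrimitiveRoot ζ m) {full outer : Bool} {L : Subgroup (GL (Fin N) k)}
    {δ : Matrix (Fin (R * m)) (Fin (R * m)) k →ₗ[k] Matrix (Fin N) (Fin N) k}
    (hδ : IsLieModel (if full then ⊤ else traceless k (R * m)) (lieAlg L) δ)
    {h : GL (Fin (R * m)) k} {g : GL (Fin N) k}
    (hτ : ∀ X ∈ (if full then ⊤ else traceless k (R * m)), autDiff false h X ∈
        (if full then ⊤ else traceless k (R * m)) ∧ autDiff outer g (δ X) = δ (autDiff false h X))
    (hc : ∀ x ∈ slGroup k (R * m), h ^ m * x = x * h ^ m)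
    {P : Matrix (Fin N) (Fin (R * m)) k} {Q : Matrix (Fin (R * m)) (Fin N) k} (hQP : Q * P = 1)
    (hδP : ∀ X ∈ traceless k (R * m), δ X * P = P * X)
    (hnil : ∀ X ∈ traceless k (R * m), IsNilpotent X → IsNilpotent (δ X))
    {G : Subgroup (GL (Fin N) k)} {c : Submodule k (Matrix (Fin N) (Fin N) k)}
    (hcar : IsCartanSubspace G outer g ζ c) (hcL : c ≤ lieAlg L)
    (hR : m ≠ 1 → Module.finrank k c = R) (hfull : full = false → (R : k) ≠ 0) :
    IsNRegular L outer g ζ := by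
  obtain ⟨lam, hlam, hpow⟩ := exists_pow_eq_smul_one_of_commute_sl hc
  obtain ⟨c', hc', hdim, hcomm, hζc, hss⟩ := hδ.exists_pullback hcar hcL hτ
  have hζc' : ∀ X ∈ c', (h : Matrix (Fin (R * m)) (Fin (R * m)) k) * X = ζ • (X * h) :=
    fun X hX => mul_eq_smul_of_conj_eq (hζc X hX)
  -- Conjugation preserves the trace, so an eigenvector for `ζ ≠ 1` is traceless. On traceless
  -- matrices the embedding is standard, and semisimplicity can be pulled back.
  have htr : m ≠ 1 → ∀ X ∈ c', X ∈ traceless k (R * m) := by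
    intro hm1 X hX
    have h1 := congrArg Matrix.trace (hζc X hX)
    change ((h : Matrix (Fin (R * m)) (Fin (R * m)) k) * X *
      ((h⁻¹ : GL (Fin (R * m)) k) : Matrix (Fin (R * m)) (Fin (R * m)) k)).trace = _ at h1
    rw [Matrix.trace_mul_comm, ← Matrix.mul_assoc, Units.inv_mul, Matrix.one_mul,
      Matrix.trace_smul, smul_eq_mul] at h1
    have h2 : (1 - ζ) * X.trace = 0 := by rw [sub_mul, one_mul, ← h1, sub_self]
    refine (mul_eq_zero.1 h2).resolve_left fun h3 => hm1 ?_
    rw [hζ.eq_orderOf, ← sub_eq_zero.1 h3, orderOf_one]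
  obtain ⟨α, hα⟩ := IsAlgClosed.exists_pow_nat_eq lam hm
  obtain ⟨x, hx, hhx⟩ := exists_diagonal_of_pow_eq_smul_one hm hζ (det_coe_ne_zero h) hlam hpow
    (fun h1 => hdim.trans (hR h1)) hcomm hζc'
    (fun h1 X hX => isSemisimple_of_intertwine hQP (hδP X (htr h1 X hX)) (hss X hX)) hα
  obtain ⟨E, hE0, hEn, hhE, hEr⟩ := exists_regular_nilpotent_top hx hhx
  have hE : E ∈ if full then ⊤ else traceless k (R * m) := traceless_le full hE0
  refine hδ.isNRegular hE ?_ (hnil E hE0 hEn) fun Y _ =>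
    finrank_centralizer_le_of_le full (fun h1 => ?_) hEr Y
  · rw [(hτ E hE).2, ← map_smul]
    exact congrArg δ (conj_eq_of_mul_eq_smul hhE)
  · rw [Nat.cast_mul]
    exact mul_ne_zero (hfull h1) hmk

lemma IsRealized.pow_mul_eq_mul_pow {ρ : GL (Fin a) k →* GL β k} {M M₀ : Subgroup (GL (Fin a) k)}
    {h : GL (Fin a) k} {θ : GL (Fin N) k →* GL (Fin N) k} {L : Subgroup (GL (Fin N) k)}
    (hr : IsRealized ρ M M₀ (fun x => autHom false h x) θ L) (hρ : Function.Injective ρ)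
    (hσ : ∀ x ∈ M, autHom false h x ∈ M) {m : ℕ} (hθ : ∀ x ∈ L, θ^[m] x = x) :
    ∀ x ∈ M, h ^ m * x = x * h ^ m := by
  intro x hx
  have h1 := hr.iterate_eq hρ hσ hθ x hx
  rw [iterate_conj] at h1
  exact mul_inv_eq_iff_eq_mul.1 h1

theorem isNRegular_sl [IsAlgClosed k] {m R : ℕ} (hmk : (m : k) ≠ 0) {ζ : k}
    (hζ : IsPrimitiveRoot ζ m) {full outer : Bool} {G L : Subgroup (GL (Fin N) k)}
    {g : GL (Fin N) k} (hord : HasOrderOn G (autHom outer g) m) (hLG : L ≤ G)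
    {c : Submodule k (Matrix (Fin N) (Fin N) k)}
    (hcar : IsCartanSubspace G outer g ζ c) (hcL : c ≤ lieAlg L)
    (hR : m ≠ 1 → Module.finrank k c = R) (hfull : full = false → (R : k) ≠ 0)
    (hL : HasForm (autHom outer g) L (LForm.sl full (R * m))) : IsNRegular L outer g ζ := by
  obtain ⟨h, hr⟩ := hL
  have hσ : ∀ x ∈ slOrGl k full (R * m), autHom false h x ∈ slOrGl k full (R * m) :=
    fun x hx => autHom_mem_slOrGl full false h hx
  obtain ⟨δ, P, Q, hQP, hδ, hτ, hstd⟩ := exists_isLieModel_standard hr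
    (slGroup_le_slOrGl full) hσ (fun X => isTangent_slOrGl_iff full)
  refine hδ.isNRegular_of_inner hord.1 hmk hζ hτ (fun x hx => ?_) hQP (fun X hX => ?_)
    (fun X hX hn => ?_) hcar hcL hR hfull
  · exact hr.pow_mul_eq_mul_pow Function.injective_id hσ (hord.iterate_eq hLG) x
      (slGroup_le_slOrGl full hx)
  · rw [hstd X (isTangent_slGroup hX), Matrix.mul_assoc, hQP, Matrix.mul_one]
  · rw [hstd X (isTangent_slGroup hX)]
    exact isNilpotent_standard hQP hn

lemma isNilpotent_fromBlocks {A D : Matrix (Fin a) (Fin a) k} (hA : IsNilpotent A)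
    (hD : IsNilpotent D) : IsNilpotent (Matrix.fromBlocks A 0 0 D) := by
  obtain ⟨p, hp⟩ := hA
  obtain ⟨q, hq⟩ := hD
  have key : ∀ n : ℕ, (Matrix.fromBlocks A 0 0 D) ^ n = Matrix.fromBlocks (A ^ n) 0 0 (D ^ n) := by
    intro n
    induction n with
    | zero => simp
    | succ n ih => rw [pow_succ, ih, Matrix.fromBlocks_multiply]; simp [pow_succ]
  refine ⟨p + q, ?_⟩
  rw [key, pow_add, pow_add, hp, hq, Matrix.zero_mul, Matrix.mul_zero, Matrix.fromBlocks_zero]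

lemma isNilpotent_transpose {A : Matrix β β k} (hA : IsNilpotent A) : IsNilpotent Aᵀ := by
  obtain ⟨p, hp⟩ := hA
  exact ⟨p, by rw [← Matrix.transpose_pow, hp, Matrix.transpose_zero]⟩

lemma dualHom_injective : Function.Injective (dualHom k a) := by
  intro x y hxy
  have h1 := congrArg (fun z : GL (Fin a ⊕ Fin a) k =>
    (z : Matrix (Fin a ⊕ Fin a) (Fin a ⊕ Fin a) k).toBlocks₁₁) hxy
  exact Units.ext h1

lemma exists_fromBlocks_intertwine (k : Type u) [Field k] (a : ℕ) :
    ∃ (I : Matrix (Fin a ⊕ Fin a) (Fin a) k) (I' : Matrix (Fin a) (Fin a ⊕ Fin a) k), I' * I = 1 ∧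
      ∀ X D : Matrix (Fin a) (Fin a) k, Matrix.fromBlocks X 0 0 D * I = I * X :=
  ⟨Matrix.fromRows 1 0, Matrix.fromCols 1 0, by simp [Matrix.fromCols_mul_fromRows], fun X D => by
    simp [Matrix.fromBlocks_mul_fromRows, Matrix.fromRows_mul]⟩

theorem isNRegular_slDual [IsAlgClosed k] {m R : ℕ} (hmk : (m : k) ≠ 0) {ζ : k}
    (hζ : IsPrimitiveRoot ζ m) {full outer : Bool} {G L : Subgroup (GL (Fin N) k)}
    {g : GL (Fin N) k} (hord : HasOrderOn G (autHom outer g) m) (hLG : L ≤ G)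
    {c : Submodule k (Matrix (Fin N) (Fin N) k)}
    (hcar : IsCartanSubspace G outer g ζ c) (hcL : c ≤ lieAlg L)
    (hR : m ≠ 1 → Module.finrank k c = R) (hfull : full = false → (R : k) ≠ 0)
    (hL : HasForm (autHom outer g) L (LForm.slDual full (R * m))) : IsNRegular L outer g ζ := by
  obtain ⟨h, hr⟩ := hL
  have hσ : ∀ x ∈ slOrGl k full (R * m), autHom false h x ∈ slOrGl k full (R * m) :=
    fun x hx => autHom_mem_slOrGl full false h hx
  obtain ⟨δ, P, Q, hQP, hδ, hτ, hstd⟩ := exists_isLieModel_dual hr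
  obtain ⟨I, I', hI, hXI⟩ := exists_fromBlocks_intertwine k (R * m)
  refine hδ.isNRegular_of_inner hord.1 hmk hζ hτ (fun x hx => ?_)
    -- Only the natural summand of the sum with the dual is needed to recover `X` from its image.
    (P := P * I) (Q := I' * Q) ?_ (fun X hX => ?_)
    (fun X hX hn => ?_) hcar hcL hR hfull
  · exact hr.pow_mul_eq_mul_pow dualHom_injective hσ (hord.iterate_eq hLG) x
      (slGroup_le_slOrGl full hx)
  · rw [Matrix.mul_assoc, ← Matrix.mul_assoc Q, hQP, Matrix.one_mul, hI]
  · rw [hstd X hX, Matrix.mul_assoc, ← Matrix.mul_assoc Q, hQP, Matrix.one_mul, Matrix.mul_assoc,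
      Matrix.mul_assoc P, hXI]
  · rw [hstd X hX]
    exact isNilpotent_standard hQP (isNilpotent_fromBlocks hn (isNilpotent_transpose hn).neg)

end Realized

/-! ## Special linear groups with outer automorphisms -/

section OuterSpecialLinear

universe u
variable {k : Type u} [Field k] {a N : ℕ}

/-- The model of a bilinear form with an asymmetry of finite order. -/
def outerForm (ζ : k) (a : ℕ) : Matrix (Fin a) (Fin a) k :=
  fun i j => if j = Fin.rev i then (-ζ) ^ (i : ℕ) else 0

lemma rev_eq_iff {i j : Fin a} : j = Fin.rev i ↔ (i : ℕ) + j + 1 = a := by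
  rw [Fin.ext_iff, Fin.val_rev]
  omega

lemma det_outerForm {ζ : k} (hζ : ζ ≠ 0) : (outerForm ζ a).det ≠ 0 :=
  det_ne_zero_of_antidiagonal (fun _ _ h => if_neg h) fun i => by
    rw [outerForm, if_pos rfl]
    exact pow_ne_zero _ (neg_ne_zero.2 hζ)

/-- The asymmetry of the model form is a diagonal matrix in geometric progression with ratio `ζ ^
2`, the shape to which the asymmetry `u` of `h` is brought. -/
lemma outerForm_eq_diagonal_mul {ζ : k} (hζ : ζ ≠ 0) :
    outerForm ζ a = (Matrix.diagonal fun i : Fin a => ((-ζ)⁻¹) ^ (a - 1) * (ζ ^ 2) ^ (i : ℕ)) *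
      (outerForm ζ a)ᵀ := by
  ext i j
  have hz : -ζ ≠ 0 := neg_ne_zero.2 hζ
  rw [Matrix.diagonal_mul, Matrix.transpose_apply, outerForm, outerForm]
  by_cases h : j = Fin.rev i
  · have h' : i = Fin.rev j := by rw [h, Fin.rev_rev]
    rw [if_pos h, if_pos h', ← neg_sq ζ, ← pow_mul]
    have h1 : a - 1 = i + j := by
      have := rev_eq_iff.1 h
      omega
    rw [h1, inv_pow, eq_comm, mul_assoc, ← pow_add, inv_mul_eq_iff_eq_mul₀ (pow_ne_zero _ hz),
      ← pow_add]
    congr 1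
    omega
  · have h' : i ≠ Fin.rev j := fun h' => h (by rw [h', Fin.rev_rev])
    rw [if_neg h, if_neg h', mul_zero]

/-- The differential of the outer automorphism attached to the model form multiplies the Jordan
block by `ζ`. -/
lemma outerForm_mul_transpose_modelNilpotent (ζ : k) :
    outerForm ζ a * (modelNilpotent k a a)ᵀ = -(ζ • (modelNilpotent k a a * outerForm ζ a)) := by
  ext i j
  rw [Matrix.neg_apply, Matrix.smul_apply, Matrix.mul_apply, Matrix.mul_apply]
  simp only [Matrix.transpose_apply, modelNilpotent_apply, outerForm, rev_eq_iff]
  by_cases h : (i : ℕ) + j = a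
  · rw [Finset.sum_eq_single_of_mem (⟨j - 1, by omega⟩ : Fin a) (Finset.mem_univ _),
      Finset.sum_eq_single_of_mem (⟨i - 1, by omega⟩ : Fin a) (Finset.mem_univ _)]
    · rw [if_pos (by simp only; omega), if_pos (by simp only; omega), if_pos (by simp only; omega),
        if_pos (by simp only; omega)]
      obtain ⟨b, hb⟩ : ∃ b, (i : ℕ) = b + 1 := ⟨i - 1, by omega⟩
      simp only [hb, Nat.add_sub_cancel, pow_succ, smul_eq_mul]
      ring
    · intro p _ hp
      rw [if_neg, zero_mul]
      rintro ⟨h1, -⟩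
      exact hp (Fin.ext (by simp only; omega))
    · intro p _ hp
      rw [if_neg, zero_mul]
      intro h1
      exact hp (Fin.ext (by simp only; omega))
  · rw [Finset.sum_eq_zero, Finset.sum_eq_zero, smul_zero, neg_zero]
    · intro p _
      by_cases h1 : (i : ℕ) = p + 1 ∧ (i : ℕ) < a
      · rw [if_neg (show ¬ ((p : ℕ) + j + 1 = a) by omega), mul_zero]
      · rw [if_neg h1, zero_mul]
    · intro p _
      by_cases h1 : (i : ℕ) + p + 1 = a
      · rw [if_neg (show ¬ ((j : ℕ) = p + 1 ∧ (j : ℕ) < a) by omega), mul_zero]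
      · rw [if_neg h1, zero_mul]

lemma pow_half_eq_neg_one {l : ℕ} (hl : 0 < l) {ζ : k} (hζ : IsPrimitiveRoot ζ (2 * l)) :
    ζ ^ l = -1 := by
  have h1 : (ζ ^ l) ^ 2 = 1 := by rw [← pow_mul, mul_comm, hζ.pow_eq_one]
  rw [sq] at h1
  rcases mul_self_eq_one_iff.1 h1 with h | h
  · exact absurd (hζ.pow_eq_one_iff_dvd l |>.1 h) (Nat.not_dvd_of_pos_of_lt hl (by omega))
  · exact h

/-- The asymmetry `h γ(h)` of an outer automorphism `Int h ∘ γ` of `SL_a`. -/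
lemma asymmetry_pow_eq_one [Infinite k] {g : GL (Fin N) k} {h : GL (Fin a) k} {l : ℕ}
    (hg : (g * contra g) ^ l = 1) {P : Matrix (Fin N) (Fin a) k} {Q : Matrix (Fin a) (Fin N) k}
    (hQP : Q * P = 1)
    (hτ : ∀ X ∈ traceless k a, autDiff true g (P * X * Q) = P * autDiff true h X * Q) :
    ((h * contra h : GL (Fin a) k) : Matrix (Fin a) (Fin a) k) ^ l = 1 := by
  -- In size at most 1 there is no invertible traceless matrix to cancel in general, but there
  -- `contra h` is simply `h⁻¹`.
  rcases Nat.lt_or_ge a 2 with ha | ha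
  · have : Subsingleton (Fin a) := Fin.subsingleton_iff_le_one.2 (by omega)
    have h1 : contra h = h⁻¹ := by
      ext i j
      change ((h⁻¹ : GL (Fin a) k) : Matrix (Fin a) (Fin a) k) j i = _
      rw [Subsingleton.elim i j]
    rw [h1, mul_inv_cancel, Units.val_one, one_pow]
  · have : Nonempty (Fin a) := ⟨⟨0, by omega⟩⟩
    obtain ⟨X₀, hX₀, hdet⟩ := exists_trace_eq_zero_det_ne_zero (k := k) ha
    have hPQ : Pᵀ * Qᵀ = 1 := by rw [← Matrix.transpose_mul, hQP, Matrix.transpose_one]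
    -- Int g ∘ γ uses the transposed embedding, with `Qᵀ` in place of `P`. Comparison with Int h ∘ γ
    -- on the image shows that `g * Qᵀ` and `P * h` are proportional.
    obtain ⟨μ, hμ, h1, h2⟩ := exists_smul_of_intertwine (𝔪 := traceless k a)
      (fun T hT => exists_eq_smul_one_of_commute_trace_zero hT) hX₀ hdet (P := P) (Q := Q)
      (A := (g : Matrix (Fin N) (Fin N) k) * Qᵀ)
      (A' := Pᵀ * ((g⁻¹ : GL (Fin N) k) : Matrix (Fin N) (Fin N) k))
      (h := (h : Matrix (Fin a) (Fin a) k))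
      (h' := ((h⁻¹ : GL (Fin a) k) : Matrix (Fin a) (Fin a) k)) hQP (by
        rw [Matrix.mul_assoc, ← Matrix.mul_assoc _ (g : Matrix (Fin N) (Fin N) k), Units.inv_mul,
          Matrix.one_mul, hPQ]) (Units.inv_mul h) (fun X hX => by
        have h3 := hτ Xᵀ (by
          rw [LinearMap.mem_ker, Matrix.traceLinearMap_apply, Matrix.trace_transpose]
          exact hX)
        simp only [autDiff, Matrix.transpose_mul, Matrix.transpose_transpose, Matrix.mul_neg,
          Matrix.neg_mul, neg_inj] at h3
        rw [← h3]
        simp only [Matrix.mul_assoc])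
    have h3 := mul_contra_mul_eq (g := g) (P := P) (Q := Q)
      (h := (h : Matrix (Fin a) (Fin a) k))
      (h' := ((h⁻¹ : GL (Fin a) k) : Matrix (Fin a) (Fin a) k)) (K := 1) (K' := 1) (mul_one 1) hμ
      (by rw [Matrix.mul_one, h1]) (by rw [Matrix.one_mul, h2])
    rw [Matrix.transpose_one, Matrix.mul_one, Matrix.mul_one] at h3
    have h4 := pow_eq_smul_one_of_mul_eq hQP h3 (n := l) (c := 1) (by
      rw [one_smul]
      simpa using congrArg Units.val hg)
    rw [one_smul] at h4
    exact h4

/-- The asymmetry `u = h * contra h` satisfies `u ^ l = 1` and scales the pulled-back Cartan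
subspace by the primitive `l`-th root `ζ ^ 2`. This diagonalizes `u`; then `h`, as a form with that
asymmetry, is congruent to `outerForm`. -/
theorem isNRegular_slOuter [IsAlgClosed k] (h2 : (2 : k) ≠ 0) {l R : ℕ}
    (hlk : (l : k) ≠ 0) (hl : Odd l) {ζ : k}
    (hζ : IsPrimitiveRoot ζ (2 * l)) {full : Bool} {G L : Subgroup (GL (Fin N) k)}
    {g : GL (Fin N) k} (hg : (g * contra g) ^ l = 1)
    {c : Submodule k (Matrix (Fin N) (Fin N) k)}
    (hcar : IsCartanSubspace G true g ζ c) (hcL : c ≤ lieAlg L)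
    (hR : l ≠ 1 → Module.finrank k c = R) (hfull : full = false → (R : k) ≠ 0)
    (hL : HasForm (autHom true g) L (LForm.slOuter full (R * l))) : IsNRegular L true g ζ := by
  obtain ⟨h, hr⟩ := hL
  obtain ⟨δ, P, Q, hQP, hδ, hτ, hstd⟩ := exists_isLieModel_standard hr
    (slGroup_le_slOrGl full) (fun x hx => autHom_mem_slOrGl full true h hx)
    (fun X => isTangent_slOrGl_iff full)
  have hstd' : ∀ X ∈ traceless k (R * l), δ X = P * X * Q := fun X hX =>
    hstd X (isTangent_slGroup hX)
  have htrace : ∀ X : Matrix (Fin (R * l)) (Fin (R * l)) k,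
      (autDiff true h X).trace = -X.trace := by
    intro X
    rw [autDiff, Matrix.trace_neg, Matrix.trace_mul_comm, ← Matrix.mul_assoc, Units.inv_mul,
      Matrix.one_mul, Matrix.trace_transpose]
  have hu := asymmetry_pow_eq_one hg hQP fun X hX => by
    rw [← hstd' X hX, (hτ X (traceless_le full hX)).2, hstd']
    rw [LinearMap.mem_ker, Matrix.traceLinearMap_apply, htrace,
      show X.trace = 0 from hX, neg_zero]
  set u := h * contra h with hudef
  have hl0 : 0 < l := hl.pos
  have hζ0 : ζ ≠ 0 := hζ.ne_zero (by omega)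
  have hζl := pow_half_eq_neg_one hl0 hζ
  have hζ2 : IsPrimitiveRoot (ζ ^ 2) l := hζ.pow (by omega) rfl
  have hcoe : (u : Matrix (Fin (R * l)) (Fin (R * l)) k)
      = (h : Matrix (Fin (R * l)) (Fin (R * l)) k) *
        ((h⁻¹ : GL (Fin (R * l)) k) : Matrix (Fin (R * l)) (Fin (R * l)) k)ᵀ := rfl
  have hht : ((h⁻¹ : GL (Fin (R * l)) k) : Matrix (Fin (R * l)) (Fin (R * l)) k)ᵀ *
      (h : Matrix (Fin (R * l)) (Fin (R * l)) k)ᵀ = 1 := by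
    rw [← Matrix.transpose_mul, Units.mul_inv, Matrix.transpose_one]
  have hht' : (h : Matrix (Fin (R * l)) (Fin (R * l)) k)ᵀ *
      ((h⁻¹ : GL (Fin (R * l)) k) : Matrix (Fin (R * l)) (Fin (R * l)) k)ᵀ = 1 := by
    rw [← Matrix.transpose_mul, Units.inv_mul, Matrix.transpose_one]
  obtain ⟨c', hc', hdim, hcomm, hζc, hss⟩ := hδ.exists_pullback hcar hcL hτ
  -- The differential of an outer automorphism changes the sign of the trace, so eigenvectors for `ζ
  -- ≠ -1` are traceless; `ζ = -1` happens only for `l = 1`.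
  have htr : l ≠ 1 → ∀ X ∈ c', X ∈ traceless k (R * l) := by
    intro hl1 X hX
    have h1 := htrace X
    rw [hζc X hX, Matrix.trace_smul, smul_eq_mul] at h1
    have h3 : (1 + ζ) * X.trace = 0 := by rw [add_mul, one_mul, h1, add_neg_cancel]
    refine (mul_eq_zero.1 h3).resolve_left fun h4 => hl1 ?_
    have h5 : ζ ^ 2 = 1 := by rw [eq_neg_of_add_eq_zero_right h4, neg_one_sq]
    have := Nat.le_of_dvd (by norm_num) ((hζ.pow_eq_one_iff_dvd 2).1 h5)
    omega
  have hζu : ∀ X ∈ c', (u : Matrix (Fin (R * l)) (Fin (R * l)) k) * X = ζ ^ 2 • (X * u) := by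
    intro X hX
    have h1 : -((h : Matrix (Fin (R * l)) (Fin (R * l)) k) * Xᵀ *
      ((h⁻¹ : GL (Fin (R * l)) k) : Matrix (Fin (R * l)) (Fin (R * l)) k)) = ζ • X := hζc X hX
    have h3 : (h : Matrix (Fin (R * l)) (Fin (R * l)) k) * Xᵀ = -(ζ • (X * h)) := by
      have := congrArg (fun Z => -(Z * (h : Matrix (Fin (R * l)) (Fin (R * l)) k))) h1
      simpa only [Matrix.neg_mul, neg_neg, Matrix.mul_assoc, Units.inv_mul, Matrix.mul_one,
        Matrix.smul_mul] using this
    have h4 : X = -(ζ • ((h : Matrix (Fin (R * l)) (Fin (R * l)) k)ᵀ * Xᵀ *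
        ((h⁻¹ : GL (Fin (R * l)) k) : Matrix (Fin (R * l)) (Fin (R * l)) k)ᵀ)) := by
      have h5 := congrArg (fun Z => Zᵀ *
        ((h⁻¹ : GL (Fin (R * l)) k) : Matrix (Fin (R * l)) (Fin (R * l)) k)ᵀ) h3
      simp only [Matrix.transpose_mul, Matrix.transpose_transpose, Matrix.transpose_neg,
        Matrix.transpose_smul, Matrix.mul_assoc, hht', Matrix.mul_one, Matrix.neg_mul,
        Matrix.smul_mul] at h5
      rwa [Matrix.mul_assoc]
    have h6 : ((h⁻¹ : GL (Fin (R * l)) k) : Matrix (Fin (R * l)) (Fin (R * l)) k)ᵀ * X =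
        -(ζ • (Xᵀ * ((h⁻¹ : GL (Fin (R * l)) k) : Matrix (Fin (R * l)) (Fin (R * l)) k)ᵀ)) := by
      have h7 := congrArg (fun Z =>
        ((h⁻¹ : GL (Fin (R * l)) k) : Matrix (Fin (R * l)) (Fin (R * l)) k)ᵀ * Z) h4
      simpa only [Matrix.mul_neg, Matrix.mul_smul, ← Matrix.mul_assoc, hht, Matrix.one_mul]
        using h7
    rw [hcoe, Matrix.mul_assoc, h6, Matrix.mul_neg, Matrix.mul_smul, ← Matrix.mul_assoc, h3,
      Matrix.neg_mul, smul_neg, neg_neg, Matrix.smul_mul, smul_smul, sq, Matrix.mul_assoc]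
  obtain ⟨x, hx, hhx⟩ := exists_diagonal_of_pow_eq_smul_one hl0 hζ2 (det_coe_ne_zero u)
    one_ne_zero (by rw [hu, one_smul]) (fun h1 => hdim.trans (hR h1)) hcomm hζu
    (fun h1 X hX => isSemisimple_of_intertwine hQP (by
      rw [hstd' X (htr h1 X hX), Matrix.mul_assoc, hQP, Matrix.mul_one]) (hss X hX))
    -- This is the leading entry of the asymmetry of `outerForm`. Its `l`-th power is 1, as `(-ζ) ^
    -- l = 1` for odd `l`.
    (α := ((-ζ)⁻¹) ^ (R * l - 1)) (by
      rw [← pow_mul, mul_comm, pow_mul, inv_pow, hl.neg_pow, hζl, neg_neg, inv_one, one_pow])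
  obtain ⟨y, hy, hyh⟩ := exists_congruence h2 (det_outerForm (a := R * l) hζ0) (det_coe_ne_zero h)
    (outerForm_eq_diagonal_mul hζ0) (u := u) (by
      rw [hcoe, Matrix.mul_assoc, hht, Matrix.mul_one]) hx hhx
  obtain ⟨hE0, hEn, hEr⟩ := conj_modelNilpotent hy
  have hyu : IsUnit y.det := isUnit_iff_ne_zero.2 hy
  set E := y * (modelNilpotent k (R * l) (R * l) * y⁻¹) with hEdef
  have hE : E ∈ if full then ⊤ else traceless k (R * l) := traceless_le full hE0
  refine hδ.isNRegular hE ?_ (by rw [hstd' E hE0]; exact isNilpotent_standard hQP hEn) fun Y _ =>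
    finrank_centralizer_le_of_le full (fun h1 => ?_) hEr Y
  · rw [(hτ E hE).2, ← map_smul]
    refine congrArg δ ?_
    have h3 : (h : Matrix (Fin (R * l)) (Fin (R * l)) k) * Eᵀ = -(ζ • (E * h)) := by
      have e1 : yᵀ * (y⁻¹)ᵀ = 1 := by
        rw [← Matrix.transpose_mul, Matrix.nonsing_inv_mul _ hyu, Matrix.transpose_one]
      calc (h : Matrix (Fin (R * l)) (Fin (R * l)) k) * Eᵀ
          = y * outerForm ζ (R * l) * (yᵀ * (y⁻¹)ᵀ) * (modelNilpotent k (R * l) (R * l))ᵀ * yᵀ := by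
            rw [← hyh, hEdef]
            simp only [Matrix.transpose_mul, Matrix.mul_assoc]
        _ = y * (outerForm ζ (R * l) * (modelNilpotent k (R * l) (R * l))ᵀ) * yᵀ := by
            rw [e1, Matrix.mul_one]
            simp only [Matrix.mul_assoc]
        _ = _ := by
            rw [outerForm_mul_transpose_modelNilpotent, ← hyh, hEdef]
            simp only [Matrix.mul_neg, Matrix.neg_mul, Matrix.mul_smul, Matrix.smul_mul,
              Matrix.mul_assoc, Matrix.nonsing_inv_mul_cancel_left _ _ hyu]
    rw [autDiff, h3, Matrix.neg_mul, neg_neg, Matrix.smul_mul, Matrix.mul_assoc, Units.mul_inv,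
      Matrix.mul_one]
  · rw [Nat.cast_mul]
    exact mul_ne_zero (hfull h1) hlk

end OuterSpecialLinear

/-! ## Pairs of special linear groups -/

section PairSpecialLinear

universe u
variable {k : Type u} [Field k] {a N : ℕ}

/-- The differential of `(x, y) ↦ diag(x, γ(y))`. -/
def pairDiff (k : Type*) [Field k] (a : ℕ) :
    Matrix (Fin a) (Fin a) k × Matrix (Fin a) (Fin a) k →ₗ[k]
      Matrix (Fin a ⊕ Fin a) (Fin a ⊕ Fin a) k where
  toFun p := Matrix.fromBlocks p.1 0 0 (-p.2ᵀ)
  map_add' p q := by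
    rw [Matrix.fromBlocks_add, Prod.fst_add, Prod.snd_add, Matrix.transpose_add, neg_add]
    simp
  map_smul' c p := by
    rw [RingHom.id_apply, Matrix.fromBlocks_smul, Prod.smul_fst, Prod.smul_snd,
      Matrix.transpose_smul]
    simp

lemma pairDiff_apply (A D : Matrix (Fin a) (Fin a) k) :
    pairDiff k a (A, D) = Matrix.fromBlocks A 0 0 (-Dᵀ) := rfl

lemma pairDiff_injective : Function.Injective (pairDiff k a) := by
  rintro ⟨A, D⟩ ⟨A', D'⟩ h
  rw [pairDiff_apply, pairDiff_apply, Matrix.fromBlocks_inj, neg_inj, Matrix.transpose_inj] at h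
  exact Prod.ext h.1 h.2.2.2

lemma pairDiff_commute_iff {A D A' D' : Matrix (Fin a) (Fin a) k} :
    pairDiff k a (A, D) * pairDiff k a (A', D') = pairDiff k a (A', D') * pairDiff k a (A, D) ↔
      A * A' = A' * A ∧ D * D' = D' * D := by
  have h1 : ∀ A D A' D' : Matrix (Fin a) (Fin a) k, pairDiff k a (A, D) * pairDiff k a (A', D')
      = Matrix.fromBlocks (A * A') 0 0 (D' * D)ᵀ := by
    intro A D A' D'
    rw [pairDiff_apply, pairDiff_apply, Matrix.fromBlocks_multiply, Matrix.transpose_mul]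
    simp
  rw [h1, h1, Matrix.fromBlocks_inj, Matrix.transpose_inj]
  exact ⟨fun h => ⟨h.1, h.2.2.2.symm⟩, fun h => ⟨h.1, rfl, rfl, h.2.symm⟩⟩

lemma finrank_centralizer_pairDiff {𝔰 : Submodule k (Matrix (Fin a) (Fin a) k)}
    (A D : Matrix (Fin a) (Fin a) k) :
    Module.finrank k (matCentralizer ((𝔰.prod 𝔰).map (pairDiff k a)) (pairDiff k a (A, D)))
      = Module.finrank k (matCentralizer 𝔰 A) + Module.finrank k (matCentralizer 𝔰 D) := by
  have h1 : matCentralizer ((𝔰.prod 𝔰).map (pairDiff k a)) (pairDiff k a (A, D))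
      = ((matCentralizer 𝔰 A).prod (matCentralizer 𝔰 D)).map (pairDiff k a) := by
    ext Z
    rw [mem_matCentralizer, Submodule.mem_map, Submodule.mem_map]
    constructor
    · rintro ⟨⟨⟨A', D'⟩, ⟨hA, hD⟩, rfl⟩, h⟩
      rw [pairDiff_commute_iff] at h
      exact ⟨(A', D'), ⟨mem_matCentralizer.2 ⟨hA, h.1⟩, mem_matCentralizer.2 ⟨hD, h.2⟩⟩, rfl⟩
    · rintro ⟨⟨A', D'⟩, ⟨hA, hD⟩, rfl⟩
      have hA := mem_matCentralizer.1 hA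
      have hD := mem_matCentralizer.1 hD
      exact ⟨⟨(A', D'), ⟨hA.1, hD.1⟩, rfl⟩, pairDiff_commute_iff.2 ⟨hA.2, hD.2⟩⟩
  rw [h1, finrank_map_eq_of_forall_eq_zero _ _ fun x _ h =>
    pairDiff_injective (h.trans (map_zero _).symm), ← Module.finrank_prod]
  rw [show (matCentralizer 𝔰 A).prod (matCentralizer 𝔰 D) = LinearMap.range
    ((matCentralizer 𝔰 A).subtype.prodMap (matCentralizer 𝔰 D).subtype) by
      rw [LinearMap.range_prodMap, Submodule.range_subtype, Submodule.range_subtype]]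
  exact LinearMap.finrank_range_of_inj
    (Function.Injective.prodMap Subtype.val_injective Subtype.val_injective)

lemma matCentralizer_smul {β : Type*} [Fintype β] [DecidableEq β]
    (𝔰 : Submodule k (Matrix β β k)) {c : k} (hc : c ≠ 0) (X : Matrix β β k) :
    matCentralizer 𝔰 (c • X) = matCentralizer 𝔰 X := by
  ext Z
  rw [mem_matCentralizer, mem_matCentralizer, Matrix.smul_mul, Matrix.mul_smul,
    (smul_right_injective _ hc).eq_iff]

lemma tangentSpace_pairHom [Infinite k] (full : Bool) :
    tangentSpace ((pairHom k a).comp ((slOrGl k full a).prod (slOrGl k full a)).subtype) =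
      (Submodule.prod (if full then ⊤ else traceless k a)
        (if full then ⊤ else traceless k a)).map (pairDiff k a) := by
  ext Z
  rw [mem_tangentSpace, Submodule.mem_map]
  refine (isTangent_pairHom_iff (slOrGl k full a) Z).trans ⟨?_, ?_⟩
  · rintro ⟨A, D, rfl, hA, hD⟩
    exact ⟨(A, D), ⟨(isTangent_slOrGl_iff full).1 hA, (isTangent_slOrGl_iff full).1 hD⟩, rfl⟩
  · rintro ⟨⟨A, D⟩, ⟨hA, hD⟩, rfl⟩
    exact ⟨A, D, rfl, (isTangent_slOrGl_iff full).2 hA, (isTangent_slOrGl_iff full).2 hD⟩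

lemma pairHom_injective : Function.Injective (pairHom k a) := by
  intro x y hxy
  have h1 := congrArg (fun z : GL (Fin a ⊕ Fin a) k =>
    (z : Matrix (Fin a ⊕ Fin a) (Fin a ⊕ Fin a) k).toBlocks₁₁) hxy
  have h2 := congrArg (fun z : GL (Fin a ⊕ Fin a) k =>
    ((z⁻¹ : GL (Fin a ⊕ Fin a) k) : Matrix (Fin a ⊕ Fin a) (Fin a ⊕ Fin a) k).toBlocks₂₂) hxy
  simp only [coe_pairHom, coe_pairHom_inv, Matrix.toBlocks_fromBlocks₁₁,
    Matrix.toBlocks_fromBlocks₂₂, Matrix.transpose_inj] at h1 h2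
  exact Prod.ext (Units.ext h1) (Units.ext h2)

/-- The differential of `(x, y) ↦ (h y h⁻¹, x)`. -/
def swapDiff (h : GL (Fin a) k) (Z : Matrix (Fin a ⊕ Fin a) (Fin a ⊕ Fin a) k) :
    Matrix (Fin a ⊕ Fin a) (Fin a ⊕ Fin a) k :=
  pairDiff k a ((h : Matrix (Fin a) (Fin a) k) * (-Z.toBlocks₂₂ᵀ) *
    ((h⁻¹ : GL (Fin a) k) : Matrix (Fin a) (Fin a) k), Z.toBlocks₁₁)

lemma swapDiff_pairDiff (h : GL (Fin a) k) (A D : Matrix (Fin a) (Fin a) k) :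
    swapDiff h (pairDiff k a (A, D)) = pairDiff k a ((h : Matrix (Fin a) (Fin a) k) * D *
      ((h⁻¹ : GL (Fin a) k) : Matrix (Fin a) (Fin a) k), A) := by
  rw [swapDiff, pairDiff_apply A D, Matrix.toBlocks_fromBlocks₁₁, Matrix.toBlocks_fromBlocks₂₂,
    Matrix.transpose_neg, Matrix.transpose_transpose, neg_neg]

/-- In the representation `pairHom` the blocks give `x` and the transpose of `y⁻¹`; the other two
matrices are read off from the blocks of the inverse. -/
lemma hasDM_swap {T : Type u} (p : T → GL (Fin a) k × GL (Fin a) k) (h : GL (Fin a) k)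
    (Z : Matrix (Fin a ⊕ Fin a) (Fin a ⊕ Fin a) k) :
    HasDM (fun t => pairHom k a (p t)) Z (fun t =>
      (pairHom k a (autHom false h (p t).2, (p t).1) :
        Matrix (Fin a ⊕ Fin a) (Fin a ⊕ Fin a) k)) 1 (swapDiff h Z) ∧
    HasDM (fun t => pairHom k a (p t)) Z (fun t =>
      (((pairHom k a (autHom false h (p t).2, (p t).1))⁻¹ : GL (Fin a ⊕ Fin a) k) :
        Matrix (Fin a ⊕ Fin a) (Fin a ⊕ Fin a) k)) 1 (-swapDiff h Z) := by
  have h1 : HasDM (fun t => pairHom k a (p t)) Z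
      (fun t => ((p t).1 : Matrix (Fin a) (Fin a) k)) 1 Z.toBlocks₁₁ :=
    HasDM.congr (A := fun t => (pairHom k a (p t) :
      Matrix (Fin a ⊕ Fin a) (Fin a ⊕ Fin a) k).toBlocks₁₁) (Z := (1 : Matrix (Fin a ⊕ Fin a) (Fin a ⊕ Fin a) k).toBlocks₁₁)
      (fun i j => HasDM.base (Sum.inl i) (Sum.inl j)) (fun t => rfl)
      (by rw [← Matrix.fromBlocks_one, Matrix.toBlocks_fromBlocks₁₁]) rfl
  have h2 : HasDM (fun t => pairHom k a (p t)) Z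
      (fun t => (((p t).1⁻¹ : GL (Fin a) k) : Matrix (Fin a) (Fin a) k)) 1 (-Z.toBlocks₁₁) :=
    HasDM.congr (A := fun t => (((pairHom k a (p t))⁻¹ : GL (Fin a ⊕ Fin a) k) :
      Matrix (Fin a ⊕ Fin a) (Fin a ⊕ Fin a) k).toBlocks₁₁) (Z := (1 : Matrix (Fin a ⊕ Fin a) (Fin a ⊕ Fin a) k).toBlocks₁₁)
      (fun i j => HasDM.base_inv (Sum.inl i) (Sum.inl j)) (fun t => rfl)
      (by rw [← Matrix.fromBlocks_one, Matrix.toBlocks_fromBlocks₁₁]) rfl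
  have h3 : HasDM (fun t => pairHom k a (p t)) Z
      (fun t => (((p t).2⁻¹ : GL (Fin a) k) : Matrix (Fin a) (Fin a) k)) 1 Z.toBlocks₂₂ᵀ :=
    HasDM.congr (A := fun t => (pairHom k a (p t) :
      Matrix (Fin a ⊕ Fin a) (Fin a ⊕ Fin a) k).toBlocks₂₂ᵀ) (Z := (1 : Matrix (Fin a ⊕ Fin a) (Fin a ⊕ Fin a) k).toBlocks₂₂ᵀ)
      (fun i j => HasDM.base (Sum.inr j) (Sum.inr i)) (fun t => rfl)
      (by rw [← Matrix.fromBlocks_one, Matrix.toBlocks_fromBlocks₂₂, Matrix.transpose_one]) rfl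
  have h4 : HasDM (fun t => pairHom k a (p t)) Z
      (fun t => ((p t).2 : Matrix (Fin a) (Fin a) k)) 1 (-Z.toBlocks₂₂ᵀ) :=
    HasDM.congr (A := fun t => (((pairHom k a (p t))⁻¹ : GL (Fin a ⊕ Fin a) k) :
      Matrix (Fin a ⊕ Fin a) (Fin a ⊕ Fin a) k).toBlocks₂₂ᵀ)
      (Z := (1 : Matrix (Fin a ⊕ Fin a) (Fin a ⊕ Fin a) k).toBlocks₂₂ᵀ)
      (fun i j => HasDM.base_inv (Sum.inr j) (Sum.inr i)) (fun t => rfl)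
      (by rw [← Matrix.fromBlocks_one, Matrix.toBlocks_fromBlocks₂₂, Matrix.transpose_one]) rfl
  obtain ⟨h5, h6⟩ := hasDM_autHom (outer := false) h (q := fun t => (p t).2) h4 (by rwa [neg_neg])
  constructor
  · refine (HasDM.fromBlocks h5 (HasDM.const 0) (HasDM.const 0) h2.transpose).congr
      (fun t => rfl) ?_ rfl
    rw [Matrix.transpose_one, Matrix.fromBlocks_one]
  · refine (HasDM.fromBlocks h6 (HasDM.const 0) (HasDM.const 0) h1.transpose).congr
      (fun t => rfl) ?_ ?_
    · rw [Matrix.transpose_one, Matrix.fromBlocks_one]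
    · rw [swapDiff, pairDiff_apply, Matrix.fromBlocks_neg]
      simp [autDiff]

lemma iterate_swap (h : GL (Fin a) k) (l : ℕ) (p : GL (Fin a) k × GL (Fin a) k) :
    (fun p : GL (Fin a) k × GL (Fin a) k => (autHom false h p.2, p.1))^[2 * l] p =
      (h ^ l * p.1 * (h ^ l)⁻¹, h ^ l * p.2 * (h ^ l)⁻¹) := by
  rw [Function.iterate_mul]
  have h1 : (fun p : GL (Fin a) k × GL (Fin a) k => (autHom false h p.2, p.1))^[2] =
      Prod.map (fun x => autHom false h x) (fun x => autHom false h x) := rfl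
  rw [h1, Prod.map_iterate, Prod.map_apply', iterate_conj, iterate_conj]

lemma exists_isLieModel_pair [Infinite k] {full outer : Bool}
    {h : GL (Fin a) k} {g : GL (Fin N) k} {L : Subgroup (GL (Fin N) k)}
    (hr : IsRealized (pairHom k a) ((slOrGl k full a).prod (slOrGl k full a))
        ((slGroup k a).prod (slGroup k a)) (fun p => (autHom false h p.2, p.1))
        (autHom outer g) L) :
    ∃ (δ : Matrix (Fin a ⊕ Fin a) (Fin a ⊕ Fin a) k →ₗ[k] Matrix (Fin N) (Fin N) k)
      (P : Matrix (Fin N) (Fin a ⊕ Fin a) k) (Q : Matrix (Fin a ⊕ Fin a) (Fin N) k), Q * P = 1 ∧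
      IsLieModel ((Submodule.prod (if full then ⊤ else traceless k a)
        (if full then ⊤ else traceless k a)).map (pairDiff k a)) (lieAlg L) δ ∧
      (∀ X ∈ (Submodule.prod (if full then ⊤ else traceless k a)
        (if full then ⊤ else traceless k a)).map (pairDiff k a),
        swapDiff h X ∈ (Submodule.prod (if full then ⊤ else traceless k a)
          (if full then ⊤ else traceless k a)).map (pairDiff k a) ∧
        autDiff outer g (δ X) = δ (swapDiff h X)) ∧
      ∀ A ∈ traceless k a, ∀ D ∈ traceless k a,
        δ (pairDiff k a (A, D)) = P * pairDiff k a (A, D) * Q := by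
  have hσ : ∀ x ∈ (slOrGl k full a).prod (slOrGl k full a),
      (autHom false h x.2, x.1) ∈ (slOrGl k full a).prod (slOrGl k full a) :=
    fun x hx => ⟨autHom_mem_slOrGl full false h hx.2, hx.1⟩
  have hle : (slGroup k a).prod (slGroup k a) ≤ (slOrGl k full a).prod (slOrGl k full a) :=
    Subgroup.prod_mono (slGroup_le_slOrGl full) (slGroup_le_slOrGl full)
  have hsw := fun Z => hasDM_swap
    (fun x : (slOrGl k full a).prod (slOrGl k full a) => (x : GL (Fin a) k × GL (Fin a) k)) h Z
  rw [← tangentSpace_pairHom full]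
  obtain ⟨δ, P, Q, hQP, hδ, hτ, hstd⟩ := hr.exists_isLieModel (pairHom k a)
    (isRegularWrt_refl _) (isRegularWrt_refl _) hle hσ (swapDiff h)
    (fun Z _ => hsw Z) (fun Z => Z) (fun Z _ => HasDM.base)
  exact ⟨δ, P, Q, hQP, hδ, hτ, fun A hA D hD => hstd _
    ((isTangent_pairHom_iff (slGroup k a) _).2
      ⟨A, D, rfl, isTangent_slGroup hA, isTangent_slGroup hD⟩)⟩

/-- The square of the automorphism is Int h on both factors. Eigenvectors of the differential are
pairs (ζD, D) with Ad h (D) = ζ² D, so the problem reduces to an inner automorphism of one factor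
with the primitive `l`-th root `ζ ^ 2`. -/
theorem isNRegular_slPair [IsAlgClosed k] {l R : ℕ}
    (hlk : (l : k) ≠ 0) {ζ : k}
    (hζ : IsPrimitiveRoot ζ (2 * l)) {full outer : Bool} {G L : Subgroup (GL (Fin N) k)}
    {g : GL (Fin N) k} (hord : HasOrderOn G (autHom outer g) (2 * l)) (hLG : L ≤ G)
    {c : Submodule k (Matrix (Fin N) (Fin N) k)}
    (hcar : IsCartanSubspace G outer g ζ c) (hcL : c ≤ lieAlg L)
    (hR : l ≠ 1 → Module.finrank k c = R) (hfull : full = false → (R : k) ≠ 0)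
    (hL : HasForm (autHom outer g) L (LForm.slPair full (R * l))) : IsNRegular L outer g ζ := by
  obtain ⟨h, hr⟩ := hL
  have hl0 : 0 < l := Nat.pos_of_ne_zero (by rintro rfl; simp at hlk)
  have hζ0 : ζ ≠ 0 := hζ.ne_zero (by omega)
  have hζ2 : IsPrimitiveRoot (ζ ^ 2) l := hζ.pow (by omega) rfl
  have hσ : ∀ x ∈ (slOrGl k full (R * l)).prod (slOrGl k full (R * l)),
      (autHom false h x.2, x.1) ∈ (slOrGl k full (R * l)).prod (slOrGl k full (R * l)) :=
    fun x hx => ⟨autHom_mem_slOrGl full false h hx.2, hx.1⟩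
  have hle : (slGroup k (R * l)).prod (slGroup k (R * l)) ≤
      (slOrGl k full (R * l)).prod (slOrGl k full (R * l)) :=
    Subgroup.prod_mono (slGroup_le_slOrGl full) (slGroup_le_slOrGl full)
  obtain ⟨δ, P, Q, hQP, hδ, hτ, hstd'⟩ := exists_isLieModel_pair hr
  set 𝔰 : Submodule k (Matrix (Fin (R * l)) (Fin (R * l)) k) :=
    if full then ⊤ else traceless k (R * l) with h𝔰
  obtain ⟨lam, hlam, hpow⟩ := exists_pow_eq_smul_one_of_commute_sl (h := h) (m := l)
    fun x hx => by
      have h1 := hr.iterate_eq pairHom_injective hσ (hord.iterate_eq hLG) (x, x) (hle ⟨hx, hx⟩)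
      rw [iterate_swap] at h1
      exact mul_inv_eq_iff_eq_mul.1 (congrArg Prod.fst h1)
  obtain ⟨c', hc', hdim, hcomm, hζc, hss⟩ := hδ.exists_pullback hcar hcL hτ
  have hpair : ∀ A D : Matrix (Fin (R * l)) (Fin (R * l)) k, pairDiff k (R * l) (A, D) ∈ c' →
      A = ζ • D ∧ (h : Matrix (Fin (R * l)) (Fin (R * l)) k) * A = ζ ^ 2 • (A * h) := by
    intro A D hAD
    have h1 := hζc _ hAD
    rw [swapDiff_pairDiff, ← map_smul] at h1
    have h2 := pairDiff_injective h1
    have h3 : A = ζ • D := congrArg Prod.snd h2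
    have h4 : (h : Matrix (Fin (R * l)) (Fin (R * l)) k) * D = ζ • (A * h) :=
      mul_eq_smul_of_conj_eq (congrArg Prod.fst h2)
    refine ⟨h3, ?_⟩
    conv_lhs => rw [h3]
    rw [Matrix.mul_smul, h4, smul_smul, sq]
  -- Projection to the first factor, injective on `c'` because the second component is determined by
  -- the first.
  let φ : Matrix (Fin (R * l) ⊕ Fin (R * l)) (Fin (R * l) ⊕ Fin (R * l)) k →ₗ[k]
      Matrix (Fin (R * l)) (Fin (R * l)) k :=
    { toFun := fun Z => Z.toBlocks₁₁
      map_add' := fun _ _ => rfl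
      map_smul' := fun _ _ => rfl }
  have hmem : ∀ Z ∈ c', ∃ A D, Z = pairDiff k (R * l) (A, D) ∧ A = ζ • D ∧
      (h : Matrix (Fin (R * l)) (Fin (R * l)) k) * A = ζ ^ 2 • (A * h) ∧ φ Z = A := by
    intro Z hZ
    obtain ⟨⟨A, D⟩, -, rfl⟩ := hc' hZ
    exact ⟨A, D, rfl, (hpair A D hZ).1, (hpair A D hZ).2, rfl⟩
  have htr : l ≠ 1 → ∀ X : Matrix (Fin (R * l)) (Fin (R * l)) k,
      (h : Matrix (Fin (R * l)) (Fin (R * l)) k) * X = ζ ^ 2 • (X * h) →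
      X ∈ traceless k (R * l) := by
    intro hl1 X hX
    have h1 := congrArg Matrix.trace (conj_eq_of_mul_eq_smul hX)
    rw [Matrix.trace_mul_comm, ← Matrix.mul_assoc, Units.inv_mul, Matrix.one_mul,
      Matrix.trace_smul, smul_eq_mul] at h1
    have h2 : (1 - ζ ^ 2) * X.trace = 0 := by rw [sub_mul, one_mul, ← h1, sub_self]
    refine (mul_eq_zero.1 h2).resolve_left fun h3 => hl1 ?_
    rw [hζ2.eq_orderOf, ← sub_eq_zero.1 h3, orderOf_one]
  obtain ⟨I, I', hI, hXI⟩ := exists_fromBlocks_intertwine k (R * l)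
  obtain ⟨α, hα⟩ := IsAlgClosed.exists_pow_nat_eq lam hl0
  obtain ⟨x, hx, hhx⟩ := exists_diagonal_of_pow_eq_smul_one (c := c'.map φ) hl0 hζ2
    (det_coe_ne_zero h) hlam hpow (fun h1 => by
      rw [finrank_map_eq_of_forall_eq_zero, hdim, hR h1]
      intro Z hZ h0
      obtain ⟨A, D, rfl, hA, -, hφ⟩ := hmem Z hZ
      rw [hφ] at h0
      subst h0
      rw [(smul_eq_zero.1 hA.symm).resolve_left hζ0]
      exact map_zero (pairDiff k (R * l))) (by
      rintro _ ⟨Z, hZ, rfl⟩ _ ⟨Z', hZ', rfl⟩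
      have h1 := hcomm Z hZ Z' hZ'
      obtain ⟨A, D, rfl, -, -, hφ⟩ := hmem Z hZ
      obtain ⟨A', D', rfl, -, -, hφ'⟩ := hmem Z' hZ'
      rw [hφ, hφ']
      exact (pairDiff_commute_iff.1 h1).1) (by
      rintro _ ⟨Z, hZ, rfl⟩
      obtain ⟨A, D, rfl, -, hA, hφ⟩ := hmem Z hZ
      rw [hφ, hA]) (by
      rintro h1 _ ⟨Z, hZ, rfl⟩
      obtain ⟨A, D, rfl, hAD, hA, hφ⟩ := hmem Z hZ
      rw [hφ]
      have htA := htr h1 A hA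
      have htD : D ∈ traceless k (R * l) := by
        rw [hAD] at htA
        rwa [Submodule.smul_mem_iff _ hζ0] at htA
      have h3 := hss _ hZ
      rw [hstd' A htA D htD] at h3
      refine isSemisimple_of_intertwine (P := P * I) (Q := I' * Q) ?_ ?_ h3
      · rw [Matrix.mul_assoc, ← Matrix.mul_assoc Q, hQP, Matrix.one_mul, hI]
      · rw [Matrix.mul_assoc, ← Matrix.mul_assoc Q, hQP, Matrix.one_mul, Matrix.mul_assoc,
          Matrix.mul_assoc P, pairDiff_apply, hXI]) hα
  obtain ⟨E, hE0, hEn, hhE, hEr⟩ := exists_regular_nilpotent_top hx hhx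
  have hE0' : ζ • E ∈ traceless k (R * l) := Submodule.smul_mem _ _ hE0
  have hEs : E ∈ 𝔰 := traceless_le full hE0
  have hE : pairDiff k (R * l) (ζ • E, E) ∈ (𝔰.prod 𝔰).map (pairDiff k (R * l)) :=
    ⟨(ζ • E, E), ⟨Submodule.smul_mem _ _ hEs, hEs⟩, rfl⟩
  have ha : full = false → ((R * l : ℕ) : k) ≠ 0 := fun h1 => by
    rw [Nat.cast_mul]
    exact mul_ne_zero (hfull h1) hlk
  refine hδ.isNRegular hE ?_ ?_ ?_
  · rw [(hτ _ hE).2, swapDiff_pairDiff, ← map_smul, ← map_smul]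
    refine congrArg δ (congrArg _ (Prod.ext ?_ rfl))
    change _ = ζ • (ζ • E)
    rw [smul_smul, ← sq]
    exact conj_eq_of_mul_eq_smul hhE
  · rw [hstd' _ hE0' _ hE0]
    refine isNilpotent_standard hQP (isNilpotent_fromBlocks ?_ (isNilpotent_transpose hEn).neg)
    exact hEn.smul ζ
  · rintro _ ⟨⟨A, D⟩, -, rfl⟩
    rw [finrank_centralizer_pairDiff, finrank_centralizer_pairDiff, matCentralizer_smul _ hζ0]
    exact Nat.add_le_add (finrank_centralizer_le_of_le full ha hEr A)
      (finrank_centralizer_le_of_le full ha hEr D)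

end PairSpecialLinear

/-! ## Orthogonal and symplectic groups -/

section OrthogonalSymplectic

universe u
variable {k : Type u} [Field k] {a N m : ℕ}

lemma lieAlg_le_skewMatrices {L : Subgroup (GL (Fin N) k)} {C : Matrix (Fin N) (Fin N) k}
    (hL : L ≤ formGroup C) : lieAlg L ≤ skewMatrices C := fun _ hX =>
  skew_of_isTangent (fun x : L => hL x.2) ((mem_lieAlg_iff L _).1 hX)

/-- The `m`-th power of an element inducing `θ` is the scalar `c`: for `θ = Int g` acting on a
classical group this is `g ^ m`, and for `θ = Int g ∘ γ` it is `(g γ(g)) ^ (m / 2)`. -/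
def HasScalarPower (outer : Bool) (g : GL (Fin N) k) (L : Subgroup (GL (Fin N) k)) (m : ℕ)
    (c : k) : Prop :=
  match outer with
  | false => Even m ∧ ∃ C : Matrix (Fin N) (Fin N) k, C.det ≠ 0 ∧ g ∈ formGroup C ∧
      L ≤ formGroup C ∧ (g : Matrix (Fin N) (Fin N) k) ^ m = c • 1
  | true => ∃ l, m = 2 * l ∧ Even l ∧
      ((g : Matrix (Fin N) (Fin N) k) * (contra g : Matrix (Fin N) (Fin N) k)) ^ l = c • 1

lemma transpose_eq_of_mem_skewMatrices {B X : Matrix (Fin a) (Fin a) k} (hB : B.det ≠ 0)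
    (hX : X ∈ skewMatrices B) : Xᵀ = -(B * X * B⁻¹) := by
  have h1 : Xᵀ * B = -(B * X) := eq_neg_of_add_eq_zero_left (mem_skewMatrices.1 hX)
  rw [← Matrix.neg_mul, ← h1, Matrix.mul_nonsing_inv_cancel_right _ _ (isUnit_iff_ne_zero.2 hB)]

/-- By Schur's lemma `g * P = μ • (P * h)`. Both `g` and `h` are isometries and the forms agree on
the summand up to a nonzero scalar, so `μ ^ 2 = 1`; the even exponent removes the sign. -/
lemma pow_eq_smul_one_of_inner [Nonempty (Fin a)] {B : Matrix (Fin a) (Fin a) k}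
    (hB : B.det ≠ 0)
    (hcomm : ∀ T : Matrix (Fin a) (Fin a) k, (∀ X ∈ skewMatrices B, T * X = X * T) →
      ∃ μ : k, T = μ • 1)
    {X₀ : Matrix (Fin a) (Fin a) k} (hX₀ : X₀ ∈ skewMatrices B) (hdet : X₀.det ≠ 0)
    {P : Matrix (Fin N) (Fin a) k} {Q : Matrix (Fin a) (Fin N) k} (hQP : Q * P = 1)
    {C : Matrix (Fin N) (Fin N) k} (hC : C.det ≠ 0) {g : GL (Fin N) k} (hg : g ∈ formGroup C)
    {h : GL (Fin a) k} (hh : h ∈ formGroup B)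
    (hPQ : ∀ X ∈ skewMatrices B, P * X * Q ∈ skewMatrices C)
    (hτ : ∀ X ∈ skewMatrices B, autDiff false g (P * X * Q) = P * autDiff false h X * Q)
    (hm : Even m) {c : k} (hgm : (g : Matrix (Fin N) (Fin N) k) ^ m = c • 1) :
    (h : Matrix (Fin a) (Fin a) k) ^ m = c • 1 := by
  obtain ⟨ν, hν, hS⟩ := exists_form_scale hB hcomm hX₀ hdet hQP hC hPQ
  obtain ⟨μ, hμ, h1, -⟩ := exists_smul_of_intertwine hcomm hX₀ hdet (P := P) (Q := Q)
    (A := (g : Matrix (Fin N) (Fin N) k) * P)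
    (A' := Q * ((g⁻¹ : GL (Fin N) k) : Matrix (Fin N) (Fin N) k))
    (h := (h : Matrix (Fin a) (Fin a) k))
    (h' := ((h⁻¹ : GL (Fin a) k) : Matrix (Fin a) (Fin a) k)) hQP (by
      rw [Matrix.mul_assoc, ← Matrix.mul_assoc _ (g : Matrix (Fin N) (Fin N) k), Units.inv_mul,
        Matrix.one_mul, hQP]) (Units.inv_mul h) (fun X hX => by
      have h3 := hτ X hX
      simp only [autDiff] at h3
      rw [← h3]
      simp only [Matrix.mul_assoc])
  have hg' : (g : Matrix (Fin N) (Fin N) k)ᵀ * C * (g : Matrix (Fin N) (Fin N) k) = C := hg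
  have hh' : (h : Matrix (Fin a) (Fin a) k)ᵀ * B * (h : Matrix (Fin a) (Fin a) k) = B := hh
  have h2 : ν • B = (μ ^ 2 * ν) • B := by
    calc ν • B = Pᵀ * ((g : Matrix (Fin N) (Fin N) k)ᵀ * C * (g : Matrix (Fin N) (Fin N) k)) * P := by
          rw [hg', hS]
      _ = ((g : Matrix (Fin N) (Fin N) k) * P)ᵀ * C * ((g : Matrix (Fin N) (Fin N) k) * P) := by
          simp only [Matrix.transpose_mul, Matrix.mul_assoc]
      _ = (μ * μ) • ((h : Matrix (Fin a) (Fin a) k)ᵀ * (Pᵀ * C * P) *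
          (h : Matrix (Fin a) (Fin a) k)) := by
          rw [h1]
          simp only [Matrix.transpose_smul, Matrix.smul_mul, Matrix.mul_smul, smul_smul,
            Matrix.transpose_mul, Matrix.mul_assoc]
      _ = _ := by
          rw [hS, Matrix.mul_smul, Matrix.smul_mul, hh', smul_smul, sq]
  have hB0 : B ≠ 0 := by
    rintro rfl
    exact hB Matrix.det_zero
  have h3 : μ ^ 2 = 1 := by
    have h4 := smul_left_injective k hB0 h2
    exact (mul_right_cancel₀ hν ((one_mul ν).trans h4)).symm
  have h5 := pow_eq_smul_one_of_mul_eq (u := μ • (h : Matrix (Fin a) (Fin a) k)) hQP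
    (by rw [h1, Matrix.mul_smul]) hgm
  obtain ⟨t, rfl⟩ := hm
  rwa [smul_pow, ← two_mul, pow_mul μ, h3, one_pow, one_smul, two_mul] at h5

/-- On skew matrices transposition is minus conjugation by `B`, so Int g ∘ γ can be compared with
Int h. As a result gγ(g) acts on the summand as `ε • h ^ 2`, and the even exponent `l` removes `ε`.
-/
lemma pow_eq_smul_one_of_outer [Nonempty (Fin a)] {B : Matrix (Fin a) (Fin a) k}
    (hB : B.det ≠ 0) {ε : k} (hε : ε ^ 2 = 1) (hBt : Bᵀ = ε • B)
    (hcomm : ∀ T : Matrix (Fin a) (Fin a) k, (∀ X ∈ skewMatrices B, T * X = X * T) →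
      ∃ μ : k, T = μ • 1)
    {X₀ : Matrix (Fin a) (Fin a) k} (hX₀ : X₀ ∈ skewMatrices B) (hdet : X₀.det ≠ 0)
    {P : Matrix (Fin N) (Fin a) k} {Q : Matrix (Fin a) (Fin N) k} (hQP : Q * P = 1)
    {g : GL (Fin N) k} {h : GL (Fin a) k} (hh : h ∈ formGroup B)
    (hτ : ∀ X ∈ skewMatrices B, autDiff true g (P * X * Q) = P * autDiff false h X * Q)
    {l : ℕ} (hl : Even l) {c : k}
    (hgl : ((g : Matrix (Fin N) (Fin N) k) * (contra g : Matrix (Fin N) (Fin N) k)) ^ l = c • 1) :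
    (h : Matrix (Fin a) (Fin a) k) ^ (2 * l) = c • 1 := by
  have hu : IsUnit B.det := isUnit_iff_ne_zero.2 hB
  have hPQ : Pᵀ * Qᵀ = 1 := by rw [← Matrix.transpose_mul, hQP, Matrix.transpose_one]
  have hh' : (h : Matrix (Fin a) (Fin a) k)ᵀ * B * (h : Matrix (Fin a) (Fin a) k) = B := hh
  obtain ⟨μ, hμ, h1, h2⟩ := exists_smul_of_intertwine hcomm hX₀ hdet (P := P) (Q := Q)
    (A := (g : Matrix (Fin N) (Fin N) k) * Qᵀ * B)
    (A' := B⁻¹ * Pᵀ * ((g⁻¹ : GL (Fin N) k) : Matrix (Fin N) (Fin N) k))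
    (h := (h : Matrix (Fin a) (Fin a) k))
    (h' := ((h⁻¹ : GL (Fin a) k) : Matrix (Fin a) (Fin a) k)) hQP (by
      calc B⁻¹ * Pᵀ * ((g⁻¹ : GL (Fin N) k) : Matrix (Fin N) (Fin N) k) *
            ((g : Matrix (Fin N) (Fin N) k) * Qᵀ * B)
          = B⁻¹ * (Pᵀ * ((((g⁻¹ : GL (Fin N) k) : Matrix (Fin N) (Fin N) k) *
            (g : Matrix (Fin N) (Fin N) k)) * Qᵀ)) * B := by simp only [Matrix.mul_assoc]
        _ = 1 := by
          rw [Units.inv_mul, Matrix.one_mul, hPQ, Matrix.mul_one, Matrix.nonsing_inv_mul _ hu])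
    (Units.inv_mul h) (fun X hX => by
      have h3 := hτ X hX
      simp only [autDiff, Matrix.transpose_mul, transpose_eq_of_mem_skewMatrices hB hX,
        Matrix.mul_neg, Matrix.neg_mul, neg_neg] at h3
      rw [← h3]
      simp only [Matrix.mul_assoc])
  have h3 := mul_contra_mul_eq (g := g) (P := P) (Q := Q) (h := (h : Matrix (Fin a) (Fin a) k))
    (h' := ((h⁻¹ : GL (Fin a) k) : Matrix (Fin a) (Fin a) k)) (K := B) (K' := B⁻¹)
    (Matrix.mul_nonsing_inv _ hu) hμ h1 h2
  have h4 : B⁻¹ * ((h⁻¹ : GL (Fin a) k) : Matrix (Fin a) (Fin a) k)ᵀ * B = h := by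
    have e1 : ((h⁻¹ : GL (Fin a) k) : Matrix (Fin a) (Fin a) k)ᵀ *
        (h : Matrix (Fin a) (Fin a) k)ᵀ = 1 := by
      rw [← Matrix.transpose_mul, Units.mul_inv, Matrix.transpose_one]
    have e2 : ((h⁻¹ : GL (Fin a) k) : Matrix (Fin a) (Fin a) k)ᵀ * B = B * h := by
      conv_lhs => rw [← hh']
      rw [Matrix.mul_assoc, ← Matrix.mul_assoc, e1, Matrix.one_mul]
    rw [Matrix.mul_assoc, e2, Matrix.nonsing_inv_mul_cancel_left _ _ hu]
  have h5 : (h : Matrix (Fin a) (Fin a) k) * B⁻¹ *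
      ((h⁻¹ : GL (Fin a) k) : Matrix (Fin a) (Fin a) k)ᵀ * Bᵀ
      = ε • (h : Matrix (Fin a) (Fin a) k) ^ 2 := by
    rw [hBt, Matrix.mul_smul, Matrix.mul_assoc, Matrix.mul_assoc, ← Matrix.mul_assoc B⁻¹, h4, sq]
  rw [h5] at h3
  have h6 := pow_eq_smul_one_of_mul_eq hQP h3 hgl
  obtain ⟨t, rfl⟩ := hl
  rw [← two_mul t] at h6 ⊢
  rwa [smul_pow, pow_mul ε, hε, one_pow, one_smul, ← pow_mul] at h6

lemma HasScalarPower.pow_eq_smul_one [Nonempty (Fin a)] {outer : Bool} {g : GL (Fin N) k}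
    {L : Subgroup (GL (Fin N) k)} {c : k} (hs : HasScalarPower outer g L m c)
    {B : Matrix (Fin a) (Fin a) k} (hB : B.det ≠ 0) {ε : k} (hε : ε ^ 2 = 1) (hBt : Bᵀ = ε • B)
    (hB0 : ∀ i j, j ≠ Fin.rev i → B i j = 0) (ha : Even a)
    (hcomm : ∀ T : Matrix (Fin a) (Fin a) k, (∀ X ∈ skewMatrices B, T * X = X * T) →
      ∃ μ : k, T = μ • 1)
    {P : Matrix (Fin N) (Fin a) k} {Q : Matrix (Fin a) (Fin N) k} (hQP : Q * P = 1)
    {h : GL (Fin a) k} (hh : h ∈ formGroup B)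
    (hPQ : ∀ X ∈ skewMatrices B, P * X * Q ∈ lieAlg L)
    (hτ : ∀ X ∈ skewMatrices B, autDiff outer g (P * X * Q) = P * autDiff false h X * Q) :
    (h : Matrix (Fin a) (Fin a) k) ^ m = c • 1 := by
  obtain ⟨X₀, hX₀, hdet⟩ := exists_skew_det_ne_zero ha hB0
  cases outer
  · obtain ⟨hm, C, hC, hg, hL, hgm⟩ := hs
    exact pow_eq_smul_one_of_inner hB hcomm hX₀ hdet hQP hC hg hh
      (fun X hX => lieAlg_le_skewMatrices hL (hPQ X hX)) hτ hm hgm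
  · obtain ⟨l, rfl, hl, hgl⟩ := hs
    exact pow_eq_smul_one_of_outer hB hε hBt hcomm hX₀ hdet hQP hh hτ hl hgl

/-- In a commutative Lie algebra `0` is regular. -/
lemma IsLieModel.isNRegular_of_commute {𝔪 : Submodule k (Matrix (Fin a) (Fin a) k)}
    {L : Subgroup (GL (Fin N) k)}
    {δ : Matrix (Fin a) (Fin a) k →ₗ[k] Matrix (Fin N) (Fin N) k}
    (hδ : IsLieModel 𝔪 (lieAlg L) δ) {outer : Bool} {g : GL (Fin N) k} {ζ : k}
    (hcomm : ∀ X ∈ 𝔪, ∀ Y ∈ 𝔪, X * Y = Y * X) : IsNRegular L outer g ζ := by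
  refine hδ.isNRegular (Submodule.zero_mem 𝔪) ?_ (by rw [map_zero]; exact IsNilpotent.zero) ?_
  · rw [map_zero, smul_zero]
    cases outer <;> simp [autDiff]
  · intro Y hY
    refine Submodule.finrank_mono fun Z hZ => ?_
    have hZ' := (mem_matCentralizer.1 hZ).1
    exact mem_matCentralizer.2 ⟨hZ', hcomm Y hY Z hZ'⟩

/-- For `a ≤ 2` every off-diagonal position has the form (rev j, j), and skewness kills twice that
entry. These sizes must be treated apart because Schur's lemma for the orthogonal Lie algebra needs
`a ≥ 3`. -/
lemma commute_of_mem_skewMatrices_antidiag (h2 : (2 : k) ≠ 0) (ha : a ≤ 2)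
    {X Y : Matrix (Fin a) (Fin a) k} (hX : X ∈ skewMatrices (antidiag k a))
    (hY : Y ∈ skewMatrices (antidiag k a)) : X * Y = Y * X := by
  have key : ∀ X ∈ skewMatrices (antidiag k a), X = Matrix.diagonal fun i => X i i := by
    intro X hX
    ext i j
    rcases eq_or_ne i j with rfl | hij
    · simp
    · rw [Matrix.diagonal_apply_ne _ hij]
      have hi : i = Fin.rev j := by
        refine Fin.ext ?_
        have := Fin.val_ne_of_ne hij
        rw [Fin.val_rev]
        omega
      have h1 := congrFun (congrFun (mem_skewMatrices.1 hX) j) j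
      rw [Matrix.add_apply, Matrix.mul_apply, Matrix.mul_apply] at h1
      rw [Finset.sum_eq_single_of_mem (Fin.rev j) (Finset.mem_univ _),
        Finset.sum_eq_single_of_mem (Fin.rev j) (Finset.mem_univ _)] at h1
      · rw [Matrix.transpose_apply, antidiag, antidiag, if_pos rfl, if_pos (Fin.rev_rev j).symm,
          mul_one, one_mul, ← two_mul, Matrix.zero_apply] at h1
        rw [hi]
        exact (mul_eq_zero.1 h1).resolve_left h2
      · intro p _ hp
        rw [antidiag_apply_of_ne _ _ hp, zero_mul]
      · intro p _ hp
        rw [antidiag_apply_of_ne p j (fun h => hp (by rw [h, Fin.rev_rev])), mul_zero]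
  rw [key X hX, key Y hY, Matrix.diagonal_mul_diagonal, Matrix.diagonal_mul_diagonal]
  exact congrArg _ (funext fun i => mul_comm _ _)

/-- The cyclic family coming from a Cartan subspace. -/
lemma IsLieModel.exists_cyclic_family [IsAlgClosed k] (h2 : (2 : k) ≠ 0) {R : ℕ} (hm : 0 < m)
    {ζ : k} (hζ : IsPrimitiveRoot ζ m) {outer : Bool} {L : Subgroup (GL (Fin N) k)}
    {B : Matrix (Fin a) (Fin a) k} (hB : B.det ≠ 0)
    {δ : Matrix (Fin a) (Fin a) k →ₗ[k] Matrix (Fin N) (Fin N) k}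
    (hδ : IsLieModel (skewMatrices B) (lieAlg L) δ) {h : GL (Fin a) k} {g : GL (Fin N) k}
    (hτ : ∀ X ∈ skewMatrices B, autDiff false h X ∈ skewMatrices B ∧
      autDiff outer g (δ X) = δ (autDiff false h X))
    {P : Matrix (Fin N) (Fin a) k} {Q : Matrix (Fin a) (Fin N) k} (hQP : Q * P = 1)
    (hstd : ∀ X ∈ skewMatrices B, δ X = P * X * Q)
    {G : Subgroup (GL (Fin N) k)} {c : Submodule k (Matrix (Fin N) (Fin N) k)}
    (hcar : IsCartanSubspace G outer g ζ c) (hcL : c ≤ lieAlg L)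
    (hR : Module.finrank k c = R ∨ Odd m ∧ 2 * Module.finrank k c = R) :
    ∃ v : Fin R → Fin a → k, LinearIndependent k
      (fun p : Fin R × Fin m => (h : Matrix (Fin a) (Fin a) k) ^ (p.2 : ℕ) *ᵥ v p.1) := by
  obtain ⟨c', hc', hdim, hcomm, hζc, hss⟩ := hδ.exists_pullback hcar hcL hτ
  obtain ⟨f, hli, hf⟩ := exists_linearIndependent_fin hdim
  have hss' : ∀ i, Module.End.IsSemisimple (Matrix.toLin' (f i)) := fun i =>
    isSemisimple_of_intertwine hQP (by
      rw [hstd _ (hc' (hf i)), Matrix.mul_assoc, hQP, Matrix.mul_one]) (hss _ (hf i))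
  have hζf : ∀ i, (h : Matrix (Fin a) (Fin a) k) * f i = ζ • (f i * h) := fun i =>
    mul_eq_smul_of_conj_eq (hζc _ (hf i))
  -- For odd `m` the opposite weights give twice as many cycles.
  rcases hR with rfl | ⟨hodd, rfl⟩
  · exact _root_.exists_cyclic_family hss' (fun i j => hcomm _ (hf i) _ (hf j)) hli
      (det_coe_ne_zero h) hm hζ hζf
  · exact exists_cyclic_family_of_skew h2 hss' (fun i j => hcomm _ (hf i) _ (hf j)) hli
      (det_coe_ne_zero h) hodd hζ hζf hB (fun i => hc' (hf i))

lemma IsLieModel.isNRegular_skew [IsAlgClosed k] (h2 : (2 : k) ≠ 0) {ε : k}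
    {B : Matrix (Fin a) (Fin a) k} (hB0 : ∀ i j, j ≠ Fin.rev i → B i j = 0)
    (hBd : B.det ≠ 0) (hBt : Bᵀ = ε • B) {h : GL (Fin a) k} (hh : h ∈ formGroup B)
    {outer : Bool} {L : Subgroup (GL (Fin N) k)}
    {δ : Matrix (Fin a) (Fin a) k →ₗ[k] Matrix (Fin N) (Fin N) k}
    (hδ : IsLieModel (skewMatrices B) (lieAlg L) δ) {g : GL (Fin N) k}
    (hτ : ∀ X ∈ skewMatrices B, autDiff false h X ∈ skewMatrices B ∧
      autDiff outer g (δ X) = δ (autDiff false h X))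
    {P : Matrix (Fin N) (Fin a) k} {Q : Matrix (Fin a) (Fin N) k} (hQP : Q * P = 1)
    (hstd : ∀ X ∈ skewMatrices B, δ X = P * X * Q)
    {b : ℕ} (hb : 0 < b) (hab : a ≤ b ∨ Odd b) (hab' : a ≤ b + 1) (hba : b ≤ a)
    (hε : (-1) ^ (b - 1) = ε) {α ζ : k} (h1 : α ^ 2 * ζ ^ (b - 1) = 1)
    (h3 : a ≤ b ∨ (α * ζ ^ b) ^ 2 = 1) {x : Matrix (Fin a) (Fin a) k} (hx : x.det ≠ 0)
    (hhx : (h : Matrix (Fin a) (Fin a) k) * x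
      = x * Matrix.diagonal fun i : Fin a => α * ζ ^ (i : ℕ)) :
    IsNRegular L outer g ζ := by
  obtain ⟨E, hE, hEn, hhE, hreg⟩ := exists_regular_nilpotent_skew h2 hB0 hBd hBt hh hb hab hab' hba
    hε h1 h3 hx hhx
  refine hδ.isNRegular hE ?_ (by rw [hstd E hE]; exact isNilpotent_standard hQP hEn) hreg
  rw [(hτ E hE).2, ← map_smul]
  exact congrArg δ (conj_eq_of_mul_eq_smul hhE)

lemma sq_eq_one_of_pow_mem_formGroup [Nonempty (Fin a)] {B : Matrix (Fin a) (Fin a) k}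
    (hB : B.det ≠ 0) {h : GL (Fin a) k} (hh : h ∈ formGroup B) {lam : k}
    (hpow : (h : Matrix (Fin a) (Fin a) k) ^ m = lam • 1) : lam ^ 2 = 1 := by
  have h1 : ((h ^ m : GL (Fin a) k) : Matrix (Fin a) (Fin a) k)ᵀ * B *
      ((h ^ m : GL (Fin a) k) : Matrix (Fin a) (Fin a) k) = B := pow_mem hh m
  rw [Units.val_pow_eq_pow_val, hpow, Matrix.transpose_smul, Matrix.transpose_one,
    Matrix.mul_smul, Matrix.mul_one, Matrix.smul_mul, Matrix.one_mul, smul_smul, ← sq] at h1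
  have hB0 : B ≠ 0 := by
    rintro rfl
    exact hB Matrix.det_zero
  exact smul_left_injective k hB0 (h1.trans (one_smul k B).symm)

lemma exists_pow_eq_smul_one_of_commute [Infinite k] {M : Subgroup (GL (Fin a) k)}
    {𝔪 : Submodule k (Matrix (Fin a) (Fin a) k)}
    (h𝔪 : ∀ X ∈ 𝔪, IsTangent (fun x : M => (x : GL (Fin a) k)) X)
    (hcomm : ∀ T : Matrix (Fin a) (Fin a) k, (∀ X ∈ 𝔪, T * X = X * T) → ∃ μ : k, T = μ • 1)
    {h : GL (Fin a) k} (hc : ∀ x ∈ M, h ^ m * x = x * h ^ m) :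
    ∃ lam : k, lam ≠ 0 ∧ (h : Matrix (Fin a) (Fin a) k) ^ m = lam • 1 := by
  obtain ⟨μ, hμ⟩ := hcomm ((h : Matrix (Fin a) (Fin a) k) ^ m) fun X hX =>
    (h𝔪 X hX).commute fun x => by simpa using congrArg Units.val (hc x x.2)
  rw [← Units.val_pow_eq_pow_val] at hμ ⊢
  exact exists_ne_zero_eq_smul_one hμ

lemma conj_mem_soGroup {h x : GL (Fin a) k} (hh : h ∈ oGroup k a) (hx : x ∈ soGroup k a) :
    autHom false h x ∈ soGroup k a := by
  refine ⟨(oGroup k a).mul_mem ((oGroup k a).mul_mem hh hx.1) ((oGroup k a).inv_mem hh), ?_⟩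
  have hx' : Matrix.GeneralLinearGroup.det x = 1 := hx.2
  change Matrix.GeneralLinearGroup.det (autHom false h x) = 1
  rw [coe_autHom_false, map_mul, map_mul, hx', mul_one, map_inv, mul_inv_cancel]

/-- No information about the scalar `h ^ m` beyond its sign property is needed: in odd dimension the
determinant of `h`, which is ±1, forces the square of the leading eigenvalue `η` to be 1. -/
theorem isNRegular_so_add_one [IsAlgClosed k] (h2 : (2 : k) ≠ 0) {R : ℕ} (hmk : (m : k) ≠ 0) {ζ : k}
    (hζ : IsPrimitiveRoot ζ m) {outer : Bool} {G L : Subgroup (GL (Fin N) k)}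
    {g : GL (Fin N) k} (hord : HasOrderOn G (autHom outer g) m) (hLG : L ≤ G)
    {c : Submodule k (Matrix (Fin N) (Fin N) k)}
    (hcar : IsCartanSubspace G outer g ζ c) (hcL : c ≤ lieAlg L)
    (hR : Module.finrank k c = R ∨ Odd m ∧ 2 * Module.finrank k c = R) (heven : Even (R * m))
    (hL : HasForm (autHom outer g) L (LForm.so (R * m + 1))) : IsNRegular L outer g ζ := by
  obtain ⟨h, hh, hr⟩ := hL
  have hσ : ∀ x ∈ soGroup k (R * m + 1), autHom false h x ∈ soGroup k (R * m + 1) :=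
    fun x hx => conj_mem_soGroup hh hx
  obtain ⟨δ, P, Q, hQP, hδ, hτ, hstd⟩ := exists_isLieModel_standard hr le_rfl hσ
    (fun X => isTangent_soGroup_iff h2)
  rcases Nat.lt_or_ge 2 (R * m + 1) with ha | ha
  swap
  · exact hδ.isNRegular_of_commute fun X hX Y hY =>
      commute_of_mem_skewMatrices_antidiag h2 ha hX hY
  obtain ⟨lam, hlam, hpow⟩ := exists_pow_eq_smul_one_of_commute
    (fun X hX => (isTangent_soGroup_iff h2).2 hX)
    (fun T hT => exists_eq_smul_one_of_commute_orthogonal (by rwa [Fintype.card_fin])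
      det_antidiag transpose_antidiag hT)
    (hr.pow_mul_eq_mul_pow Function.injective_id hσ (hord.iterate_eq hLG))
  have hlam2 := sq_eq_one_of_pow_mem_formGroup det_antidiag hh hpow
  have hstd' := fun X hX => hstd X ((isTangent_soGroup_iff h2).2 hX)
  obtain ⟨v, hv⟩ := hδ.exists_cyclic_family h2 hord.1 hζ det_antidiag hτ hQP hstd' hcar hcL hR
  obtain ⟨η, hη, x, hx, hhx⟩ := exists_diagonal_add_one rfl hmk hζ hlam hpow hv
  have hζRm : ζ ^ (R * m) = 1 := by rw [mul_comm, pow_mul, hζ.pow_eq_one, one_pow]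
  have hηRm : (η ^ (R * m)) ^ 2 = 1 := by
    rw [mul_comm R, pow_mul, hη, ← pow_mul, mul_comm, pow_mul, hlam2, one_pow]
  have hdet1 : (h : Matrix (Fin (R * m + 1)) (Fin (R * m + 1)) k).det ^ 2 = 1 := by
    have h3 : (h : Matrix (Fin (R * m + 1)) (Fin (R * m + 1)) k)ᵀ * antidiag k (R * m + 1) *
      (h : Matrix (Fin (R * m + 1)) (Fin (R * m + 1)) k) = antidiag k (R * m + 1) := hh
    have h4 := congrArg Matrix.det h3
    rw [Matrix.det_mul, Matrix.det_mul, Matrix.det_transpose] at h4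
    refine mul_right_cancel₀ (det_antidiag (k := k) (a := R * m + 1)) ?_
    linear_combination h4
  have hdet2 : (h : Matrix (Fin (R * m + 1)) (Fin (R * m + 1)) k).det
      = ∏ i : Fin (R * m + 1), η * ζ ^ (i : ℕ) := by
    have h3 := congrArg Matrix.det hhx
    rw [Matrix.det_mul, Matrix.det_mul, Matrix.det_diagonal, mul_comm] at h3
    exact mul_left_cancel₀ hx h3
  -- The square of the determinant is `η ^ (2 (R * m + 1))` times a power of `ζ ^ (R * m) = 1`.
  -- Since `η ^ (R * m)` is a sign, only `η ^ 2` survives.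
  have hη2 : η ^ 2 = 1 := by
    rw [hdet2, Finset.prod_mul_distrib, Finset.prod_const, Finset.card_univ, Fintype.card_fin,
      Fin.prod_univ_eq_prod_range (fun i => ζ ^ i), Finset.prod_pow_eq_pow_sum, mul_pow,
      ← pow_mul ζ, Finset.sum_range_id_mul_two, Nat.add_sub_cancel, mul_comm _ (R * m), pow_mul ζ,
      hζRm, one_pow, mul_one, pow_succ η, mul_pow, hηRm, one_mul] at hdet1
    exact hdet1
  refine hδ.isNRegular_skew h2 antidiag_apply_of_ne det_antidiag transpose_antidiag hh hτ hQP hstd'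
    (b := R * m + 1) (Nat.succ_pos _) (Or.inl le_rfl) (Nat.le_succ _) le_rfl ?_ ?_ (Or.inl le_rfl)
    hx hhx
  · rw [Nat.add_sub_cancel, heven.neg_one_pow]
  · rw [Nat.add_sub_cancel, hη2, hζRm, one_mul]

/-- Both `lam` and `α ^ m` are signs; if they differ, `m` is odd and `α` is replaced by `-α`. -/
lemma exists_sign_pow_eq {lam α : k} (hα : (α ^ m) ^ 2 = 1) (hlam : lam ^ 2 = 1)
    (h : Odd m ∨ lam = α ^ m) : ∃ β : k, β ^ 2 = α ^ 2 ∧ β ^ m = lam := by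
  rcases h with h | h
  · have h1 : (α ^ m - lam) * (α ^ m + lam) = 0 := by linear_combination hα - hlam
    rcases mul_eq_zero.1 h1 with h1 | h1
    · exact ⟨α, rfl, sub_eq_zero.1 h1⟩
    · exact ⟨-α, neg_sq α, by rw [h.neg_pow]; linear_combination -h1⟩
  · exact ⟨α, rfl, h.symm⟩

/-- Here `R * m` is even and the nilpotent has blocks of sizes `R * m - 1` and 1. Preservation of
the form requires `α ^ 2 = ζ ^ 2`, which is compatible with `α ^ m = lam` for even `m` exactly
because `lam = 1`. -/
theorem isNRegular_so [IsAlgClosed k] (h2 : (2 : k) ≠ 0) {R : ℕ} {ζ : k}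
    (hζ : IsPrimitiveRoot ζ m) {outer : Bool} {G L : Subgroup (GL (Fin N) k)}
    {g : GL (Fin N) k} (hord : HasOrderOn G (autHom outer g) m) (hLG : L ≤ G)
    {c : Submodule k (Matrix (Fin N) (Fin N) k)}
    (hcar : IsCartanSubspace G outer g ζ c) (hcL : c ≤ lieAlg L)
    (hR : Module.finrank k c = R ∨ Odd m ∧ 2 * Module.finrank k c = R) (heven : Even (R * m))
    (hsign : Odd m ∨ HasScalarPower outer g L m 1)
    (hL : HasForm (autHom outer g) L (LForm.so (R * m))) : IsNRegular L outer g ζ := by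
  obtain ⟨h, hh, hr⟩ := hL
  have hσ : ∀ x ∈ soGroup k (R * m), autHom false h x ∈ soGroup k (R * m) :=
    fun x hx => conj_mem_soGroup hh hx
  obtain ⟨δ, P, Q, hQP, hδ, hτ, hstd⟩ := exists_isLieModel_standard hr le_rfl hσ
    (fun X => isTangent_soGroup_iff h2)
  rcases Nat.lt_or_ge 2 (R * m) with ha | ha
  swap
  · exact hδ.isNRegular_of_commute fun X hX Y hY =>
      commute_of_mem_skewMatrices_antidiag h2 ha hX hY
  have hne : Nonempty (Fin (R * m)) := ⟨⟨0, by omega⟩⟩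
  have hcomm : ∀ T : Matrix (Fin (R * m)) (Fin (R * m)) k,
      (∀ X ∈ skewMatrices (antidiag k (R * m)), T * X = X * T) → ∃ μ : k, T = μ • 1 :=
    fun T hT => exists_eq_smul_one_of_commute_orthogonal (by rwa [Fintype.card_fin])
      det_antidiag transpose_antidiag hT
  obtain ⟨lam, hlam, hpow⟩ := exists_pow_eq_smul_one_of_commute
    (fun X hX => (isTangent_soGroup_iff h2).2 hX) hcomm
    (hr.pow_mul_eq_mul_pow Function.injective_id hσ (hord.iterate_eq hLG))
  have hlam2 := sq_eq_one_of_pow_mem_formGroup det_antidiag hh hpow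
  have hstd' := fun X hX => hstd X ((isTangent_soGroup_iff h2).2 hX)
  have hζm := hζ.pow_eq_one
  have hsign' : Odd m ∨ lam = ζ ^ m := by
    refine hsign.imp_right fun hs => ?_
    have h1 := hs.pow_eq_smul_one det_antidiag (ε := 1) (one_pow 2) transpose_antidiag
      antidiag_apply_of_ne heven hcomm hQP hh (fun X hX => hstd' X hX ▸ hδ.mem X hX)
      (fun X hX => by rw [← hstd' X hX, (hτ X hX).2, hstd' _ (hτ X hX).1])
    rw [hζm]
    exact smul_left_injective k one_ne_zero (hpow.symm.trans h1)
  obtain ⟨α, hα2, hα⟩ := exists_sign_pow_eq (by rw [hζm, one_pow]) hlam2 hsign'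
  obtain ⟨v, hv⟩ := hδ.exists_cyclic_family h2 hord.1 hζ det_antidiag hτ hQP hstd' hcar hcL hR
  obtain ⟨x, hx, hhx⟩ := exists_diagonal rfl hord.1 hζ hlam hpow hv hα
  have hζRm : ζ ^ (R * m) = 1 := by rw [mul_comm, pow_mul, hζ.pow_eq_one, one_pow]
  obtain ⟨b, hb⟩ : ∃ b, R * m = b + 2 := ⟨R * m - 2, by omega⟩
  have hb1 : R * m - 1 - 1 = b := by omega
  -- With `b = R * m - 1` and `α ^ 2 = ζ ^ 2`, the two isometry conditions read `ζ ^ (R * m) = 1`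
  -- and its square.
  refine hδ.isNRegular_skew h2 antidiag_apply_of_ne det_antidiag transpose_antidiag hh hτ hQP hstd'
    (b := R * m - 1) (by omega) (Or.inr ?_) (by omega) (by omega) ?_ ?_ (Or.inr ?_) hx hhx
  · obtain ⟨t, ht⟩ := heven
    exact ⟨t - 1, by omega⟩
  · rw [hb1]
    refine Even.neg_one_pow ?_
    obtain ⟨t, ht⟩ := heven
    exact ⟨t - 1, by omega⟩
  · rw [hb1, hα2, ← pow_add, add_comm, ← hb, hζRm]
  · rw [mul_pow, hα2, ← mul_pow, ← pow_succ', Nat.sub_add_cancel (by omega), hζRm, one_pow]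

/-- The nilpotent is a single block of size `R * m`, so the form requires `α ^ 2 = ζ`. For even `m`
this gives `α ^ m = ζ ^ (m / 2) = -1`, which matches the sign in `hsign`. -/
theorem isNRegular_sp [IsAlgClosed k] (h2 : (2 : k) ≠ 0) {R : ℕ} {ζ : k}
    (hζ : IsPrimitiveRoot ζ m) {outer : Bool} {G L : Subgroup (GL (Fin N) k)}
    {g : GL (Fin N) k} (hord : HasOrderOn G (autHom outer g) m) (hLG : L ≤ G)
    {c : Submodule k (Matrix (Fin N) (Fin N) k)}
    (hcar : IsCartanSubspace G outer g ζ c) (hcL : c ≤ lieAlg L)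
    (hR : Module.finrank k c = R ∨ Odd m ∧ 2 * Module.finrank k c = R) (heven : Even (R * m))
    (hsign : Odd m ∨ HasScalarPower outer g L m (-1))
    (hL : HasForm (autHom outer g) L (LForm.sp (R * m))) : IsNRegular L outer g ζ := by
  obtain ⟨h, hh, hr⟩ := hL
  have hσ : ∀ x ∈ spGroup k (R * m), autHom false h x ∈ spGroup k (R * m) :=
    fun x hx => mul_mem (mul_mem hh hx) (inv_mem hh)
  obtain ⟨δ, P, Q, hQP, hδ, hτ, hstd⟩ := exists_isLieModel_standard hr le_rfl hσ
    (fun X => isTangent_spGroup_iff h2)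
  rcases Nat.eq_zero_or_pos (R * m) with ha | ha
  · have : IsEmpty (Fin (R * m)) := by rw [ha]; infer_instance
    exact hδ.isNRegular_of_commute fun X hX Y hY => Subsingleton.elim _ _
  have hne : Nonempty (Fin (R * m)) := ⟨⟨0, ha⟩⟩
  have hcomm : ∀ T : Matrix (Fin (R * m)) (Fin (R * m)) k,
      (∀ X ∈ skewMatrices (skewAntidiag k (R * m)), T * X = X * T) → ∃ μ : k, T = μ • 1 :=
    fun T hT => exists_eq_smul_one_of_commute_symplectic det_skewAntidiag
      (transpose_skewAntidiag heven) hT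
  obtain ⟨lam, hlam, hpow⟩ := exists_pow_eq_smul_one_of_commute
    (fun X hX => (isTangent_spGroup_iff h2).2 hX) hcomm
    (hr.pow_mul_eq_mul_pow Function.injective_id hσ (hord.iterate_eq hLG))
  have hlam2 := sq_eq_one_of_pow_mem_formGroup det_skewAntidiag hh hpow
  have hstd' := fun X hX => hstd X ((isTangent_spGroup_iff h2).2 hX)
  obtain ⟨ξ, hξ⟩ := IsAlgClosed.exists_pow_nat_eq ζ (n := 2) (by norm_num)
  have hξm : (ξ ^ m) ^ 2 = 1 := by rw [← pow_mul, mul_comm, pow_mul, hξ, hζ.pow_eq_one]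
  have hsign' : Odd m ∨ lam = ξ ^ m := by
    refine (Nat.even_or_odd m).symm.imp_right fun hm => ?_
    obtain ⟨l, rfl⟩ := hm.two_dvd
    have hs := hsign.resolve_left (Nat.not_odd_iff_even.2 (even_two_mul l))
    have h1 := hs.pow_eq_smul_one det_skewAntidiag (ε := -1) (neg_one_sq)
      (transpose_skewAntidiag heven) skewAntidiag_apply_of_ne heven hcomm hQP hh
      (fun X hX => hstd' X hX ▸ hδ.mem X hX)
      (fun X hX => by rw [← hstd' X hX, (hτ X hX).2, hstd' _ (hτ X hX).1])
    rw [pow_mul, hξ, pow_half_eq_neg_one (by have := hord.1; omega) hζ]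
    exact smul_left_injective k one_ne_zero (hpow.symm.trans h1)
  obtain ⟨α, hα2, hα⟩ := exists_sign_pow_eq hξm hlam2 hsign'
  obtain ⟨v, hv⟩ := hδ.exists_cyclic_family h2 hord.1 hζ det_skewAntidiag hτ hQP hstd' hcar hcL hR
  obtain ⟨x, hx, hhx⟩ := exists_diagonal rfl hord.1 hζ hlam hpow hv hα
  have hζRm : ζ ^ (R * m) = 1 := by rw [mul_comm, pow_mul, hζ.pow_eq_one, one_pow]
  refine hδ.isNRegular_skew h2 skewAntidiag_apply_of_ne det_skewAntidiag
    (transpose_skewAntidiag heven) hh hτ hQP hstd' (b := R * m) ha (Or.inl le_rfl)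
    (Nat.le_succ _) le_rfl ?_ ?_ (Or.inl le_rfl) hx hhx
  · refine Odd.neg_one_pow ?_
    obtain ⟨t, ht⟩ := heven
    exact ⟨t - 1, by omega⟩
  · rw [hα2, hξ, ← pow_succ', Nat.sub_add_cancel ha, hζRm]

end OrthogonalSymplectic

/-! ### The table of cases -/

lemma TypeA.finrank_eq_of_cycles {k : Type*} [Field k] {N : ℕ} {s : TypeA} {l r : ℕ}
    {c : Submodule k (Matrix (Fin N) (Fin N) k)} (h : s.cycles l c = r) (hl : l ≠ 1) :
    Module.finrank k c = r := by
  cases s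
  · rw [TypeA.cycles, if_neg hl] at h
    exact h
  · exact h

lemma TypeA.FullRule.ne_zero {k : Type*} [Field k] {s : TypeA} {full : Bool} {r : ℕ}
    (h : s.FullRule k full r) (hfull : full = false) : (r : k) ≠ 0 := by
  subst hfull
  cases s
  · exact fun h0 => Bool.false_ne_true (h.2 h0)
  · exact h rfl

theorem mainTheorem12 {k : Type*} [Field k] [IsAlgClosed k] (hchar : (2 : k) ≠ 0)
    (m : ℕ) (hm : (m : k) ≠ 0) (ζ : k) (hζ : IsPrimitiveRoot ζ m)
    {N : ℕ} (G : Subgroup (GL (Fin N) k)) (outer : Bool) (g : GL (Fin N) k)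
    (hord : HasOrderOn G (autHom outer g) m)
    (c : Submodule k (Matrix (Fin N) (Fin N) k)) (hc : IsCartanSubspace G outer g ζ c)
    (r : ℕ) (F : LForm) (hcase : ClassicalCase m r G outer g c F)
    (L : Subgroup (GL (Fin N) k)) (hLG : L ≤ G) (hLθ : L.map (autHom outer g) = L)
    (hcL : c ≤ lieAlg L) (hL : HasForm (autHom outer g) L F) :
    IsNRegular L outer g ζ := by
  have hfull' : ∀ {full : Bool}, (full = true ↔ (r : k) = 0) → full = false → (r : k) ≠ 0 := by
    rintro _ h rfl h0
    exact Bool.false_ne_true (h.2 h0)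
  have hso : ∀ {n : ℕ}, soGroup k n ≤ formGroup (antidiag k n) := fun {n} => inf_le_left
  have hpow : ∀ {n : ℕ} {g : GL (Fin n) k} {x : GL (Fin n) k} {c : k} {j : ℕ}, g ^ j = x →
      (x : Matrix (Fin n) (Fin n) k) = c • 1 → (g : Matrix (Fin n) (Fin n) k) ^ j = c • 1 := by
    rintro n g _ c j rfl h
    rwa [← Units.val_pow_eq_pow_val]
  have hone : ∀ {n : ℕ}, ((1 : GL (Fin n) k) : Matrix (Fin n) (Fin n) k) = (1 : k) • 1 := by
    intro n
    rw [one_smul, Units.val_one]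
  have hneg : ∀ {n : ℕ}, ((-1 : GL (Fin n) k) : Matrix (Fin n) (Fin n) k) = (-1 : k) • 1 := by
    intro n
    rw [neg_one_smul, Units.val_neg, Units.val_one]
  cases hcase with
  | first s g c full hr hfull =>
    exact isNRegular_sl hm hζ hord hLG hc hcL (fun h => TypeA.finrank_eq_of_cycles hr h)
      hfull.ne_zero hL
  | secondI_odd g c hg hr he hgm =>
    exact isNRegular_so_add_one hchar hm hζ hord hLG hc hcL (Or.inl hr) (he.mul_left r) hL
  | secondI_even g c hg hr he hgm hZ =>
    exact isNRegular_so_add_one hchar hm hζ hord hLG hc hcL (Or.inl hr) (he.mul_left r) hL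
  | secondI_even' g c hg hr he hgm hZ =>
    exact isNRegular_so hchar hζ hord hLG hc hcL (Or.inl hr) (he.mul_left r)
      (Or.inr ⟨he, _, det_antidiag, hg, hLG.trans hso, hpow hgm hone⟩) hL
  | secondII g c full hg hr he hgm hfull =>
    exact isNRegular_slDual hm hζ hord hLG hc hcL (fun _ => hr) (hfull' hfull) hL
  -- For odd `m` the number of cycles is `R = 2 * r`.
  | secondIII_odd g c hg hr ho =>
    exact isNRegular_so_add_one hchar hm hζ hord hLG hc hcL (Or.inr ⟨ho, by rw [hr]⟩)
      ((even_two_mul r).mul_right m) hL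
  | secondIII_even g c hg hr ho hZ =>
    exact isNRegular_so_add_one hchar hm hζ hord hLG hc hcL (Or.inr ⟨ho, by rw [hr]⟩)
      ((even_two_mul r).mul_right m) hL
  | secondIII_even' g c hg hr ho hZ =>
    exact isNRegular_so hchar hζ hord hLG hc hcL (Or.inr ⟨ho, by rw [hr]⟩)
      ((even_two_mul r).mul_right m) (Or.inl ho) hL
  | thirdI g c hg hr he hgm =>
    exact isNRegular_sp hchar hζ hord hLG hc hcL (Or.inl hr) (he.mul_left r)
      (Or.inr ⟨he, _, det_skewAntidiag, hg, hLG, hpow hgm hneg⟩) hL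
  | thirdII g c full hg hr he hgm hfull =>
    exact isNRegular_slDual hm hζ hord hLG hc hcL (fun _ => hr) (hfull' hfull) hL
  | thirdIII g c hg hr ho =>
    exact isNRegular_sp hchar hζ hord hLG hc hcL (Or.inr ⟨ho, by rw [hr]⟩)
      ((even_two_mul r).mul_right m) (Or.inl ho) hL
  | fourthI s l g c full hr hml hl hgm hfull =>
    subst hml
    have hlk : (l : k) ≠ 0 := by
      rw [Nat.cast_mul] at hm
      exact right_ne_zero_of_mul hm
    exact isNRegular_slOuter hchar hlk hl hζ hgm hc hcL
      (fun h => TypeA.finrank_eq_of_cycles hr h) hfull.ne_zero hL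
  | fourthII s l g c full hr hml hl hgm hfull =>
    subst hml
    have hlk : (l : k) ≠ 0 := by
      rw [Nat.cast_mul] at hm
      exact right_ne_zero_of_mul hm
    exact isNRegular_slPair hlk hζ hord hLG hc hcL
      (fun h => TypeA.finrank_eq_of_cycles hr h) hfull.ne_zero hL
  | fourthIII s l g c hr hml hl hgm hZ =>
    have he : Even m := hml ▸ even_two_mul l
    exact isNRegular_so_add_one hchar hm hζ hord hLG hc hcL (Or.inl hr) (he.mul_left r) hL
  | fourthIII' s l g c hr hml hl hgm hZ =>
    have he : Even m := hml ▸ even_two_mul l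
    exact isNRegular_so hchar hζ hord hLG hc hcL (Or.inl hr) (he.mul_left r)
      (Or.inr ⟨l, hml, hl, hpow hgm hone⟩) hL
  | fourthIII'' s l g c hr hml hl hgm =>
    have he : Even m := hml ▸ even_two_mul l
    exact isNRegular_sp hchar hζ hord hLG hc hcL (Or.inl hr) (he.mul_left r)
      (Or.inr ⟨l, hml, hl, hpow hgm hneg⟩) hL
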